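/- **Setting.** Let $n,m\in\mathbb N=\{1,2,\dots\}$ and $\beta\in\mathbb C$. Put $\Gamma_0(n)=\{\begin{pmatrix}a&b\\c&d\end{pmatrix}\in SL(2,\mathbb Z): n\mid c\}$, $\mathbb H=\{x+iy:y>0\}$ and $\mathbb C'=\mathbb C\setminus(-\infty,0]$. *Cusp forms.* $S(n,\beta)$ is the space of real-analytic $u:\mathbb H\to\mathbb C$ with $u(gz)=u(z)$ for $g\in\Gamma_0(n)$, $-y^2(\partial_x^2+\partial_y^2)u=\beta(1-\beta)u$, and $u(gz)=O((\operatorname{Im}z)^C)$ as $\operatorname{Im}z\to\infty$ (uniformly in $\operatorname{Re}z$) for all $g\in SL(2,\mathbb Z)$ and all $C\in\mathbb R$. The operator $\hat H_{n,m}:S(n,\beta)\to S(n,\beta)$ is $$(\hat H_{n,m}u)(z)=\sum_j u(B_mR_j^{nm,n}z),\qquad B_m=\begin{pmatrix}m&0\\0&1\end{pmatrix},\qquad \Gamma_0(n)=\bigsqcup_j\Gamma_0(nm)R_j^{nm,n}.$$ *Indices.* $I_n$ is the set of classes $[x:y]_n$ of pairs $(x,y)\in\mathbb Z^2$ with $\gcd(x,y,n)=1$,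 where $(x,y)\sim_n(kx,ky)$ modulo $n$ for every $k$ with $\gcd(k,n)=1$. It is in bijection with $$\{(c,b):\ c\ge1,\ c\mid n,\ 0\le b<n/c,\ \gcd(c,b,n/c)=1\}$$ through $(c,b)\mapsto[c:d_n(c,b)]_n$, $d_n(c,b)=\min_{0\le k<c}\{c+b+k\tfrac nc:\gcd(c,b+k\tfrac nc)=1\}$. For $i\in I_n$ corresponding to $(c,b)$ let $A_i=\begin{pmatrix}c&b\\0&n/c\end{pmatrix}$ and let $R_i\in SL(2,\mathbb Z)$ have lower row $(c,d_n(c,b))$; the $R_i$ represent the right cosets of $\Gamma_0(n)$ in $SL(2,\mathbb Z)$. Define $h_n:I_n\to I_n$ by: if $R_i$ has lower row $(c,d)$, then $A_{h_n(i)}=\begin{pmatrix}c&b'\\0&n/c\end{pmatrix}$ with $0\le b'<n/c$, $b'\equiv d\bmod n/c$. Let $\mathcal H_n$ be the matrix with $(\mathcal H_n)_{i,j}=1$ if $h_n(j)=i$ and $0$ otherwise. Let $\sigma_{m,n}:I_{nm}\to I_n$ and $\sigma_{n,m}:I_{nm}\to I_m$ be the projections $[x:y]_{nm}\mapsto[x:y]_n$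 and $[x:y]_{nm}\mapsto[x:y]_m$. *Integral transform.* Put $(\Pi_nu)_i(z)=u(R_iz)$ for $i\in I_n$. With $R_\zeta(z)=\frac{y}{(x-\zeta)^2+y^2}$ and $\eta(u,v)=(v\,\partial_yu-u\,\partial_yv)\,dx+(u\,\partial_xv-v\,\partial_xu)\,dy$, let $$(P_n\vec u)_i(\zeta)=\int_0^{i\infty}\eta(u_i,R_\zeta^\beta).$$ The integral is taken along the imaginary axis (with the principal power) for $\operatorname{Re}\zeta>0$, and $(P_n\vec u)_i$ is the holomorphic continuation of this function to $\mathbb C'$. *Hecke-like operators.* Let $$K\begin{pmatrix}a&b\\c&d\end{pmatrix}=\begin{pmatrix}-c+\lceil d/b\rceil a&-d+\lceil d/b\rceil b\\a&b\end{pmatrix}\qquad(b\ne0).$$ For $i\in I_m$ let $k_i$ be the least $j\ge0$ for which $K^jA_i$ has upper right entry $0$. For $s\in I_{nm}$ and $0\le j\le k_{\sigma_{n,m}(s)}$ let $l_{s,j}\in I_n$ be the unique index with $A_{l_{s,j}}\,K^j(A_{\sigma_{n,m}(s)})\,A_s^{-1}\in SL(2,\mathbb Z)$. With $(f|_\beta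 h)(z)=|\det h|^\beta(cz+d)^{-2\beta}f\big(\tfrac{az+b}{cz+d}\big)$ for $h=\begin{pmatrix}a&b\\c&d\end{pmatrix}$, put for $\vec\phi=(\phi_i)_{i\in I_n}$, $\phi_i:\mathbb C'\to\mathbb C$, $$(\tilde T_{n,m}\vec\phi)_i=\sum_{s\in\sigma_{m,n}^{-1}(i)}\ \sum_{j=0}^{k_{\sigma_{n,m}(s)}}\phi_{l_{s,j}}\big|_\beta K^j(A_{\sigma_{n,m}(s)}).$$ **Theorem.** Let $n,m\in\mathbb N$, $\beta\in\mathbb C$ and $u\in S(n,\beta)$. Then $\hat H_{n,m}u\in S(n,\beta)$; the integrals defining $P_n\Pi_nu$ and $P_n\Pi_n\hat H_{n,m}u$ converge for $\operatorname{Re}\zeta>0$ and their components extend holomorphically to $\mathbb C'$; and, on $\mathbb C'$, $$\tilde T_{n,m}\,\mathcal H_n\,P_n\,\Pi_n\,u=\mathcal H_n\,P_n\,\Pi_n\,\hat H_{n,m}\,u .$$ -/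

import Mathlib

open scoped MatrixGroups UpperHalfPlane

namespace PeriodHecke

/-- Pairs `(x, y)` of integers with `gcd(x, y, n) = 1`. -/
def PrimPair (n : ℕ) : Type :=
  {p : ℤ × ℤ // Int.gcd (Int.gcd p.1 p.2) n = 1}

/-- `(x, y) ∼ₙ (x', y')` iff `x' ≡ k x` and `y' ≡ k y` mod `n` for some `k` coprime to `n`. -/
def scaleRel (n : ℕ) (p q : ℤ × ℤ) : Prop :=
  ∃ k : ℤ, Int.gcd k n = 1 ∧ q.1 ≡ k * p.1 [ZMOD n] ∧ q.2 ≡ k * p.2 [ZMOD n]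

theorem scaleRel_symm {n : ℕ} {p q : ℤ × ℤ} (h : scaleRel n p q) : scaleRel n q p := by
  obtain ⟨k, hk, h1, h2⟩ := h
  obtain ⟨r, s, hrs⟩ := Int.isCoprime_iff_gcd_eq_one.2 hk
  have key : r * k ≡ 1 [ZMOD n] := by
    rw [← hrs]; exact (Int.modEq_iff_dvd.2 ⟨s, by ring⟩)
  refine ⟨r, Int.isCoprime_iff_gcd_eq_one.1 ⟨k, s, by linarith⟩, ?_, ?_⟩
  · calc p.1 = 1 * p.1 := by ring
      _ ≡ (r * k) * p.1 [ZMOD n] := (key.symm.mul_right _)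
      _ = r * (k * p.1) := by ring
      _ ≡ r * q.1 [ZMOD n] := (h1.symm.mul_left _)
  · calc p.2 = 1 * p.2 := by ring
      _ ≡ (r * k) * p.2 [ZMOD n] := (key.symm.mul_right _)
      _ = r * (k * p.2) := by ring
      _ ≡ r * q.2 [ZMOD n] := (h2.symm.mul_left _)

theorem scaleRel_trans {n : ℕ} {p q r : ℤ × ℤ} (h : scaleRel n p q) (h' : scaleRel n q r) :
    scaleRel n p r := by
  obtain ⟨k, hk, h1, h2⟩ := h
  obtain ⟨l, hl, h3, h4⟩ := h'
  refine ⟨l * k, ?_, ?_, ?_⟩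
  · rw [← Int.isCoprime_iff_gcd_eq_one] at *
    exact hl.mul_left hk
  · rw [mul_assoc]; exact h3.trans (h1.mul_left _)
  · rw [mul_assoc]; exact h4.trans (h2.mul_left _)

instance primSetoid (n : ℕ) : Setoid (PrimPair n) where
  r p q := scaleRel n p.1 q.1
  iseqv := ⟨fun _ => ⟨1, by simp, by simp, by simp⟩, scaleRel_symm, scaleRel_trans⟩

/-- The index set `Iₙ` of classes `[x : y]ₙ` with `gcd(x, y, n) = 1`. -/
def Idx (n : ℕ) : Type := Quotient (primSetoid n)

theorem gcd_pair_of_dvd {d N : ℕ} (h : d ∣ N) {x y : ℤ}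
    (hp : Int.gcd (Int.gcd x y) N = 1) : Int.gcd (Int.gcd x y) d = 1 := by
  have := Int.gcd_dvd_gcd_of_dvd_right (Int.gcd x y : ℤ) (Int.natCast_dvd_natCast.2 h)
  rw [hp] at this
  exact Nat.dvd_one.1 this

/-- The projection `[x : y]_N ↦ [x : y]_d` for `d ∣ N`. -/
def proj {d N : ℕ} (h : d ∣ N) : Idx N → Idx d :=
  Quotient.map (fun p => ⟨p.1, gcd_pair_of_dvd h p.2⟩) (by
    rintro p q ⟨k, hk, h1, h2⟩
    have hd : (d : ℤ) ∣ N := Int.natCast_dvd_natCast.2 h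
    refine ⟨k, ?_, h1.of_dvd hd, h2.of_dvd hd⟩
    have := Int.gcd_dvd_gcd_of_dvd_right k hd
    rw [hk] at this
    exact Nat.dvd_one.1 this)

/-- The set `Pₙ` of pairs `(c, b)` with `c ∣ n`, `0 ≤ b < n / c`, `gcd(c, b, n / c) = 1`. -/
def DivPair (n : ℕ) : Type :=
  {p : ℕ × ℕ // p.1 ∣ n ∧ p.2 < n / p.1 ∧ Nat.gcd (Nat.gcd p.1 p.2) (n / p.1) = 1}

/-- `dₙ(c, b) = min {c + b + k n / c : 0 ≤ k < c, gcd(c, b + k n / c) = 1}`. -/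
noncomputable def dMin (n c b : ℕ) : ℕ :=
  sInf {d | ∃ k < c, Nat.gcd c (b + k * (n / c)) = 1 ∧ d = c + b + k * (n / c)}

theorem exists_coprime_shift {c b N : ℕ} (hc : c ≠ 0) (h : Nat.gcd (Nat.gcd c b) N = 1) :
    ∃ k < c, Nat.gcd c (b + k * N) = 1 := by
  classical
  let k₀ := ∏ p ∈ c.primeFactors with ¬ p ∣ b, p
  have hk₀ : Nat.gcd c (b + k₀ * N) = 1 := by
    by_contra hne
    obtain ⟨p, pp, hp⟩ := Nat.exists_prime_and_dvd hne
    have hpc := hp.trans (Nat.gcd_dvd_left _ _)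
    have hps := hp.trans (Nat.gcd_dvd_right _ _)
    by_cases hpb : p ∣ b
    · have h2 : p ∣ k₀ * N := (Nat.dvd_add_right hpb).1 hps
      rcases pp.dvd_mul.1 h2 with h3 | h3
      · obtain ⟨q, hq, hpq⟩ := (pp.prime.dvd_finsetProd_iff _).1 h3
        rw [Finset.mem_filter, Nat.mem_primeFactors] at hq
        rw [← (Nat.prime_dvd_prime_iff_eq pp hq.1.1).1 hpq] at hq
        exact hq.2 hpb
      · have : p ∣ 1 := h ▸ Nat.dvd_gcd (Nat.dvd_gcd hpc hpb) h3
        exact pp.one_lt.ne' (Nat.dvd_one.1 this)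
    · have : p ∣ k₀ := Finset.dvd_prod_of_mem (fun q => q)
        (Finset.mem_filter.2 ⟨Nat.mem_primeFactors.2 ⟨pp, hpc, hc⟩, hpb⟩)
      exact hpb ((Nat.dvd_add_left (this.mul_right N)).1 hps)
  refine ⟨k₀ % c, Nat.mod_lt _ (Nat.pos_of_ne_zero hc), ?_⟩
  have e : b + k₀ * N = (b + k₀ % c * N) + c * (k₀ / c * N) := by
    conv_lhs => rw [← Nat.mod_add_div k₀ c]
    ring
  rwa [e, Nat.gcd_add_mul_left_right] at hk₀

theorem dMin_spec {n : ℕ} [NeZero n] (p : DivPair n) :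
    Nat.gcd p.1.1 (dMin n p.1.1 p.1.2) = 1 ∧
      ∃ k, dMin n p.1.1 p.1.2 = p.1.1 + p.1.2 + k * (n / p.1.1) := by
  obtain ⟨⟨c, b⟩, hc, hb, hg⟩ := p
  have hc0 : c ≠ 0 := fun h => NeZero.ne n (Nat.eq_zero_of_zero_dvd (h ▸ hc))
  obtain ⟨k, hk, hk1⟩ := exists_coprime_shift hc0 hg
  have hne : {d | ∃ k < c, Nat.gcd c (b + k * (n / c)) = 1 ∧ d = c + b + k * (n / c)}.Nonempty :=
    ⟨_, k, hk, hk1, rfl⟩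
  obtain ⟨k', _, h1, h2⟩ := Nat.sInf_mem hne
  change dMin n c b = _ at h2
  refine ⟨?_, k', h2⟩
  change Nat.gcd c (dMin n c b) = 1
  rw [h2, add_assoc, Nat.gcd_self_add_right, h1]

/-- The map `Pₙ → Iₙ`, `(c, b) ↦ [c : dₙ(c, b)]ₙ`. -/
noncomputable def toIdx (n : ℕ) [NeZero n] (p : DivPair n) : Idx n :=
  Quotient.mk _ ⟨((p.1.1 : ℤ), (dMin n p.1.1 p.1.2 : ℤ)), by
    simp [Int.gcd_natCast_natCast, (dMin_spec p).1]⟩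

theorem scaleRel_of_modEq {n c : ℕ} [NeZero n] (hc : c ∣ n) {d e : ℤ} (hd : Int.gcd c d = 1)
    (he : Int.gcd c e = 1) (h : e ≡ d [ZMOD (n / c : ℕ)]) : scaleRel n (c, d) (c, e) := by
  obtain ⟨N, rfl⟩ := hc
  have hc0 : 0 < c := by
    rcases Nat.eq_zero_or_pos c with h | h
    · exact absurd (by simp [h]) (NeZero.ne (c * N))
    · exact h
  rw [Nat.mul_div_cancel_left _ hc0] at h
  obtain ⟨s, hs⟩ := h.symm.dvd
  rw [← Int.isCoprime_iff_gcd_eq_one] at hd he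
  obtain ⟨a, y, hay⟩ := hd
  have hmod : e - (1 + s * y * N) * d = c * N * (a * s) := by
    linear_combination hs - s * N * hay
  have h1 : IsCoprime (1 + s * y * N) (N : ℤ) := ⟨1, -(s * y), by ring⟩
  have h2 : IsCoprime (1 + s * y * N) (c : ℤ) := by
    obtain ⟨x, z, hxz⟩ := he
    exact ⟨z * d, x + z * (N * (a * s)), by linear_combination hxz - z * hmod⟩
  refine ⟨1 + s * y * N, ?_, ?_, ?_⟩
  · rw [← Int.isCoprime_iff_gcd_eq_one]
    push_cast
    exact h2.mul_right h1
  · exact Int.modEq_iff_dvd.2 ⟨s * y, by push_cast; ring⟩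
  · exact (Int.modEq_iff_dvd.2 ⟨a * s, by push_cast; linear_combination hmod⟩ : _ ≡ _ [ZMOD _]).symm

theorem toIdx_injective (n : ℕ) [NeZero n] : Function.Injective (toIdx n) := by
  intro p q hpq
  obtain ⟨hp1, kp, hp2⟩ := dMin_spec p
  obtain ⟨hq1, kq, hq2⟩ := dMin_spec q
  obtain ⟨k, hk, h1, h2⟩ : scaleRel n _ _ := Quotient.exact hpq
  obtain ⟨⟨c, b⟩, hc, hb, hg⟩ := p
  obtain ⟨⟨c', b'⟩, hc', hb', hg'⟩ := q
  dsimp only at *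
  have hcc : c = c' := by
    have e1 : Int.gcd c n = c := by
      rw [Int.gcd_natCast_natCast]; exact Nat.gcd_eq_left hc
    have e2 : Int.gcd c' n = c' := by
      rw [Int.gcd_natCast_natCast]; exact Nat.gcd_eq_left hc'
    have e3 : Int.gcd c' n = Int.gcd (k * c) n := by
      rw [← Int.gcd_emod, h1, Int.gcd_emod]
    rw [← e1, ← e2, e3, Int.gcd_mul_right_left_of_gcd_eq_one hk]
  subst hcc
  obtain ⟨N, rfl⟩ := hc
  have hc0 : 0 < c := by
    rcases Nat.eq_zero_or_pos c with h | h
    · exact absurd (by simp [h]) (NeZero.ne (c * N))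
    · exact h
  rw [Nat.mul_div_cancel_left _ hc0] at *
  have hk1 : k ≡ 1 [ZMOD N] := by
    obtain ⟨t, ht⟩ := h1.dvd
    refine (Int.modEq_iff_dvd.2 ⟨t, ?_⟩ : (1 : ℤ) ≡ k [ZMOD N]).symm
    have : (c : ℤ) * (k - 1) = c * (N * t) := by push_cast at ht; linear_combination ht
    exact mul_left_cancel₀ (by exact_mod_cast hc0.ne') this
  have h3 := (h2.of_dvd (⟨c, by push_cast; ring⟩ : (N : ℤ) ∣ ((c * N : ℕ) : ℤ))).trans
    (hk1.mul_right _)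
  rw [hp2, hq2] at h3
  obtain ⟨t, ht⟩ := h3.dvd
  push_cast at ht
  have hbb : b ≡ b' [MOD N] := by
    rw [← Int.natCast_modEq_iff]
    exact (Int.modEq_iff_dvd.2 ⟨t + kq - kp, by linear_combination ht⟩ :
      (b' : ℤ) ≡ b [ZMOD N]).symm
  have : b = b' := Nat.ModEq.eq_of_lt_of_lt hbb hb hb'
  subst this
  rfl

theorem toIdx_surjective (n : ℕ) [NeZero n] : Function.Surjective (toIdx n) := by
  intro i
  induction i using Quotient.inductionOn with | _ p
  obtain ⟨⟨x, y⟩, hxy⟩ := p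
  dsimp only at hxy
  obtain ⟨c, hc, u, hu, hxu⟩ := ZMod.eq_unit_mul_divisor (x : ZMod n)
  obtain ⟨v, rfl⟩ := hu
  obtain ⟨k, hk⟩ := ZMod.intCast_surjective ((v⁻¹ : (ZMod n)ˣ) : ZMod n)
  have hkv : (k : ZMod n) * (v : ZMod n) = 1 := by rw [hk]; simp
  have hkc : IsCoprime k (n : ℤ) := by
    obtain ⟨w, hw⟩ := ZMod.intCast_surjective (v : ZMod n)
    rw [← hw, ← Int.cast_mul, ← Int.cast_one, ZMod.intCast_eq_intCast_iff] at hkv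
    obtain ⟨t, ht⟩ := hkv.dvd
    exact ⟨w, t, by linear_combination -ht⟩
  have hkx : (c : ℤ) ≡ k * x [ZMOD n] := by
    rw [← ZMod.intCast_eq_intCast_iff]
    push_cast
    rw [hxu, ← mul_assoc, hkv, one_mul]
  have hcn : (c : ℤ) ∣ n := Int.natCast_dvd_natCast.2 hc
  have hcy : Int.gcd c (k * y) = 1 := by
    set g := Int.gcd c (k * y) with hg
    have g1 : (g : ℤ) ∣ c := Int.gcd_dvd_left ..
    have g2 : (g : ℤ) ∣ k * y := Int.gcd_dvd_right ..
    have g3 : (g : ℤ) ∣ n := g1.trans hcn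
    have gk : IsCoprime (g : ℤ) k := (hkc.of_isCoprime_of_dvd_right g3).symm
    have g4 : (g : ℤ) ∣ k * x := by
      have := dvd_add g1 (g3.trans hkx.dvd)
      simpa using this
    have g5 := Int.dvd_coe_gcd (Int.dvd_coe_gcd (gk.dvd_of_dvd_mul_left g4)
      (gk.dvd_of_dvd_mul_left g2)) g3
    rw [hxy] at g5
    exact_mod_cast Int.eq_one_of_dvd_one (by positivity) g5
  have hn : n / c ≠ 0 := by
    have := Nat.div_mul_cancel hc
    intro h
    rw [h, zero_mul] at this
    exact NeZero.ne n this.symm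
  have hN : (0 : ℤ) < (n / c : ℕ) := by exact_mod_cast Nat.pos_of_ne_zero hn
  obtain ⟨b, hb⟩ := Int.eq_ofNat_of_zero_le (Int.emod_nonneg (k * y - c) hN.ne')
  have hbN : b < n / c := by
    have := Int.emod_lt_of_pos (k * y - c) hN
    rw [hb] at this
    exact_mod_cast this
  have hbm : (b : ℤ) ≡ k * y - c [ZMOD (n / c : ℕ)] := by
    rw [← hb]; exact Int.mod_modEq _ _
  have hg : Nat.gcd (Nat.gcd c b) (n / c) = 1 := by
    set g := Nat.gcd (Nat.gcd c b) (n / c) with hg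
    have g0 : g ∣ Nat.gcd c b := Nat.gcd_dvd_left ..
    have g1 : (g : ℤ) ∣ c := Int.natCast_dvd_natCast.2 (g0.trans (Nat.gcd_dvd_left ..))
    have g2 : (g : ℤ) ∣ b := Int.natCast_dvd_natCast.2 (g0.trans (Nat.gcd_dvd_right ..))
    have g3 : (g : ℤ) ∣ (n / c : ℕ) := Int.natCast_dvd_natCast.2 (Nat.gcd_dvd_right ..)
    have g4 : (g : ℤ) ∣ k * y := by
      have := dvd_add (dvd_add g2 (g3.trans hbm.dvd)) g1
      simpa using this
    have g5 := Int.dvd_coe_gcd g1 g4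
    rw [hcy] at g5
    exact_mod_cast Int.eq_one_of_dvd_one (by positivity) g5
  let p : DivPair n := ⟨(c, b), hc, hbN, hg⟩
  obtain ⟨hp1, r, hp2⟩ := dMin_spec p
  refine ⟨p, Quotient.sound (scaleRel_trans ?_ (q := ((c : ℤ), k * y)) ?_)⟩
  · refine scaleRel_of_modEq hc (by rw [Int.gcd_natCast_natCast]; exact hp1) hcy ?_
    rw [hp2]
    obtain ⟨t, ht⟩ := hbm.dvd
    refine (Int.modEq_iff_dvd.2 ⟨t - r, ?_⟩ : _ ≡ _ [ZMOD _]).symm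
    simp only [p]
    push_cast at ht ⊢
    linear_combination ht
  · exact scaleRel_symm ⟨k, Int.isCoprime_iff_gcd_eq_one.1 hkc, hkx, rfl⟩

/-- The bijection `Pₙ ≃ Iₙ`. -/
noncomputable def idxEquiv (n : ℕ) [NeZero n] : DivPair n ≃ Idx n :=
  Equiv.ofBijective (toIdx n) ⟨toIdx_injective n, toIdx_surjective n⟩

instance divPair_finite (n : ℕ) [NeZero n] : Finite (DivPair n) := by
  refine Finite.of_injective (β := Fin (n + 1) × Fin (n + 1)) (fun p =>
    (⟨p.1.1, Nat.lt_succ_of_le (Nat.le_of_dvd (Nat.pos_of_ne_zero (NeZero.ne n)) p.2.1)⟩,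
     ⟨p.1.2, (p.2.2.1.trans_le (Nat.div_le_self _ _)).trans (Nat.lt_succ_self n)⟩)) ?_
  intro p q h
  simp only [Prod.mk.injEq, Fin.mk.injEq] at h
  exact Subtype.ext (Prod.ext h.1 h.2)

noncomputable instance idx_fintype (n : ℕ) [NeZero n] : Fintype (Idx n) :=
  have : Finite (Idx n) := Finite.of_equiv _ (idxEquiv n)
  Fintype.ofFinite _

noncomputable instance idx_decidableEq (n : ℕ) : DecidableEq (Idx n) := Classical.decEq _

/-- The matrix `(c, b; 0, n / c)`. -/
def triMat (n c b : ℕ) : Matrix (Fin 2) (Fin 2) ℤ := !![(c : ℤ), b; 0, ((n / c : ℕ) : ℤ)]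

/-- The matrix `Aᵢ = (c, b; 0, n / c)` of the index `i`, where `(c, b) ∈ Pₙ` corresponds to `i`. -/
noncomputable def matA (n : ℕ) [NeZero n] (i : Idx n) : Matrix (Fin 2) (Fin 2) ℤ :=
  triMat n ((idxEquiv n).symm i).1.1 ((idxEquiv n).symm i).1.2

/-- The map `K` on `2 × 2` integer matrices (meaningful when the upper right entry is nonzero). -/
def stepK (M : Matrix (Fin 2) (Fin 2) ℤ) : Matrix (Fin 2) (Fin 2) ℤ :=
  !![-M 1 0 + ⌈(M 1 1 : ℚ) / (M 0 1 : ℚ)⌉ * M 0 0, -M 1 1 + ⌈(M 1 1 : ℚ) / (M 0 1 : ℚ)⌉ * M 0 1;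
    M 0 0, M 0 1]

/-- The set `Sₙ`. -/
def setS (n : ℕ) : Set (Matrix (Fin 2) (Fin 2) ℤ) :=
  {M | M.det = n ∧ M 1 0 < M 0 0 ∧ 0 ≤ M 1 0 ∧ M 0 1 < M 1 1 ∧ 0 ≤ M 0 1}

/-- The set `Yₙ` of lower triangular elements of `Sₙ`. -/
def setY (n : ℕ) : Set (Matrix (Fin 2) (Fin 2) ℤ) := {M | M ∈ setS n ∧ M 0 1 = 0}

/-- The number `k_A`: the least `j` with `K^j A ∈ Yₙ`. -/
noncomputable def stepCount (n : ℕ) (M : Matrix (Fin 2) (Fin 2) ℤ) : ℕ :=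
  sInf {j | stepK^[j] M ∈ setY n}

theorem DivPair.pos {n : ℕ} [NeZero n] (p : DivPair n) : 0 < p.1.1 ∧ 0 < n / p.1.1 := by
  have hn : 0 < n := Nat.pos_of_ne_zero (NeZero.ne n)
  exact ⟨Nat.pos_of_dvd_of_pos p.2.1 hn, Nat.div_pos (Nat.le_of_dvd hn p.2.1)
    (Nat.pos_of_dvd_of_pos p.2.1 hn)⟩

theorem DivPair.mul_div {n : ℕ} (p : DivPair n) : (p.1.1 : ℤ) * ((n / p.1.1 : ℕ) : ℤ) = n := by
  exact_mod_cast Nat.mul_div_cancel' p.2.1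

theorem stepK_iterate (M : Matrix (Fin 2) (Fin 2) ℤ) (j : ℕ) :
    ∃ G : SL(2, ℤ), stepK^[j] M = G.1 * M := by
  induction j with
  | zero => exact ⟨1, by simp⟩
  | succ j ih =>
    obtain ⟨G, hG⟩ := ih
    rw [Function.iterate_succ_apply', hG]
    set X := G.1 * M
    let H : SL(2, ℤ) := ⟨!![⌈(X 1 1 : ℚ) / (X 0 1 : ℚ)⌉, -1; 1, 0], by simp [Matrix.det_fin_two]⟩
    refine ⟨H * G, ?_⟩
    have : stepK X = H.1 * X := by
      ext a b
      fin_cases a <;> fin_cases b <;> simp [stepK, H, Matrix.mul_apply, Fin.sum_univ_two] <;> ring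
    rw [this, Matrix.SpecialLinearGroup.coe_mul, Matrix.mul_assoc]

theorem exists_left_factor {n m : ℕ} [NeZero n] [NeZero m] (i : Idx (n * m)) :
    ∃ N : Matrix (Fin 2) (Fin 2) ℤ,
      N * matA m (proj (dvd_mul_left m n) i) = matA (n * m) i := by
  obtain ⟨q, rfl⟩ := (idxEquiv (n * m)).surjective i
  obtain ⟨p, hp⟩ := (idxEquiv m).surjective (proj (dvd_mul_left m n) (idxEquiv (n * m) q))
  rw [matA, matA, ← hp, Equiv.symm_apply_apply, Equiv.symm_apply_apply]
  obtain ⟨k, hk, h1, h2⟩ : scaleRel m _ _ := Quotient.exact hp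
  obtain ⟨hp1, r, hp2⟩ := dMin_spec p
  obtain ⟨-, s, hq2⟩ := dMin_spec q
  have hpm := p.mul_div
  have hqm := q.mul_div
  have hpos := p.pos.1
  dsimp only at h1 h2
  generalize dMin m p.1.1 p.1.2 = d at *
  generalize dMin (n * m) q.1.1 q.1.2 = D at *
  simp only [triMat]
  generalize p.1.1 = c at *
  generalize p.1.2 = b at *
  generalize q.1.1 = C at *
  generalize q.1.2 = B at *
  generalize m / c = e at *
  generalize n * m / C = E at *
  have key : ∀ x y : ℤ, (m : ℤ) ∣ x * D - (x + y) * C →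
      ∃ α β : ℤ, x = α * c ∧ y = α * b + β * e := by
    intro x y h
    obtain ⟨t, ht⟩ := h
    obtain ⟨t1, ht1⟩ := h1.dvd
    obtain ⟨t2, ht2⟩ := h2.dvd
    have hck : IsCoprime (c : ℤ) d := by
      rw [Int.isCoprime_iff_gcd_eq_one, Int.gcd_natCast_natCast]; exact hp1
    obtain ⟨w, hw⟩ : (m : ℤ) ∣ x * d - (x + y) * c := by
      refine (Int.isCoprime_iff_gcd_eq_one.2 hk).symm.dvd_of_dvd_mul_left
        ⟨t + x * t2 - (x + y) * t1, ?_⟩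
      linear_combination ht + x * ht2 - (x + y) * ht1
    have hcx : (c : ℤ) ∣ x * d := ⟨x + y + e * w, by linear_combination hw - w * hpm⟩
    obtain ⟨α, hα⟩ := hck.dvd_of_dvd_mul_right hcx
    have hc : (c : ℤ) ≠ 0 := by exact_mod_cast hpos.ne'
    refine ⟨α, α * r - w, by rw [hα, mul_comm], mul_left_cancel₀ hc ?_⟩
    rw [hα, hp2] at hw
    push_cast at hw
    linear_combination -hw + w * hpm
  obtain ⟨α, β, h3, h4⟩ := key C B (by
    refine ⟨n * s, ?_⟩
    rw [hq2]; push_cast at hqm ⊢; linear_combination (s : ℤ) * hqm)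
  obtain ⟨γ, δ, h5, h6⟩ := key 0 E (by
    refine ⟨-n, ?_⟩
    push_cast at hqm ⊢; linear_combination -hqm)
  refine ⟨!![α, β; γ, δ], ?_⟩
  ext a b
  fin_cases a <;> fin_cases b <;>
    simp [Matrix.mul_apply, Fin.sum_univ_two, h3, h4, ← h5, h6]

theorem exists_hermite {n : ℕ} [NeZero n] (M : Matrix (Fin 2) (Fin 2) ℤ) (hM : M.det = n)
    (hprim : ∀ g : ℤ, (∀ a b, g ∣ M a b) → IsUnit g) :
    ∃ (p : DivPair n) (γ : SL(2, ℤ)), γ.1 * M = triMat n p.1.1 p.1.2 := by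
  have hn : (n : ℤ) ≠ 0 := by exact_mod_cast NeZero.ne n
  rw [Matrix.det_fin_two] at hM
  have hne : Int.gcd (M 0 0) (M 1 0) ≠ 0 := by
    intro h
    rw [Int.gcd_eq_zero_iff] at h
    rw [h.1, h.2] at hM
    exact hn (by linear_combination -hM)
  set c := Int.gcd (M 0 0) (M 1 0) with hc
  have hcz : (c : ℤ) ≠ 0 := by exact_mod_cast hne
  have hbez := Int.gcd_eq_gcd_ab (M 0 0) (M 1 0)
  rw [← hc] at hbez
  obtain ⟨x, hx⟩ : (c : ℤ) ∣ M 0 0 := Int.gcd_dvd_left ..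
  obtain ⟨z, hz⟩ : (c : ℤ) ∣ M 1 0 := Int.gcd_dvd_right ..
  generalize Int.gcdA (M 0 0) (M 1 0) = s at hbez
  generalize Int.gcdB (M 0 0) (M 1 0) = t at hbez
  have h1 : x * s + z * t = 1 :=
    mul_left_cancel₀ hcz (by rw [hx, hz] at hbez; linear_combination -hbez)
  have hcN : (n : ℤ) = c * (x * M 1 1 - z * M 0 1) := by
    rw [← hM, hx, hz]; ring
  have hcn : c ∣ n := Int.natCast_dvd_natCast.1 ⟨_, hcN⟩
  have hN : ((n / c : ℕ) : ℤ) = x * M 1 1 - z * M 0 1 := by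
    rw [Int.natCast_div, hcN, Int.mul_ediv_cancel_left _ hcz]
  have hNpos : 0 < n / c :=
    Nat.div_pos (Nat.le_of_dvd (Nat.pos_of_ne_zero (NeZero.ne n)) hcn) (Nat.pos_of_ne_zero hne)
  generalize hNN : n / c = N at *
  have hNz : (0 : ℤ) < N := by exact_mod_cast hNpos
  set y := s * M 0 1 + t * M 1 1 with hy
  obtain ⟨b, hb⟩ := Int.eq_ofNat_of_zero_le (Int.emod_nonneg y hNz.ne')
  have hbN : b < N := by
    have := Int.emod_lt_of_pos y hNz
    rw [hb] at this
    exact_mod_cast this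
  have hdiv := Int.emod_add_mul_ediv y N
  rw [hb] at hdiv
  generalize y / N = k at hdiv
  have hdiv' : (b : ℤ) + N * k = y := hdiv
  have e1 : M 0 1 = x * y - t * N := by rw [hN, hy]; linear_combination -M 0 1 * h1
  have e2 : M 1 1 = z * y + s * N := by rw [hN, hy]; linear_combination -M 1 1 * h1
  refine ⟨⟨(c, b), hcn, by rw [hNN]; exact hbN, ?_⟩,
    ⟨!![s + k * z, t - k * x; -z, x], ?_⟩, ?_⟩
  · dsimp only
    rw [hNN]
    set g := Nat.gcd (Nat.gcd c b) N with hg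
    have g0 : g ∣ Nat.gcd c b := Nat.gcd_dvd_left ..
    have g1 : (g : ℤ) ∣ c := Int.natCast_dvd_natCast.2 (g0.trans (Nat.gcd_dvd_left ..))
    have g2 : (g : ℤ) ∣ b := Int.natCast_dvd_natCast.2 (g0.trans (Nat.gcd_dvd_right ..))
    have g3 : (g : ℤ) ∣ N := Int.natCast_dvd_natCast.2 (Nat.gcd_dvd_right ..)
    have g4 : (g : ℤ) ∣ y := hdiv' ▸ dvd_add g2 (g3.mul_right k)
    have := hprim g (by
      intro a b
      fin_cases a <;> fin_cases b
      · exact hx ▸ g1.mul_right x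
      · exact e1 ▸ dvd_sub (g4.mul_left x) (g3.mul_left t)
      · exact hz ▸ g1.mul_right z
      · exact e2 ▸ dvd_add (g4.mul_left z) (g3.mul_left s))
    rw [Int.isUnit_iff_natAbs_eq] at this
    simpa using this
  · rw [Matrix.det_fin_two]
    simp
    linear_combination h1
  · have f0 : (s + k * z) * M 0 0 + (t - k * x) * M 1 0 = c := by
      rw [hx, hz]; linear_combination c * h1
    have f1 : (s + k * z) * M 0 1 + (t - k * x) * M 1 1 = b := by
      linear_combination -hdiv' + k * hN - hy
    have f2 : -z * M 0 0 + x * M 1 0 = 0 := by rw [hx, hz]; ring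
    have f3 : -z * M 0 1 + x * M 1 1 = N := by rw [hN]; ring
    ext a b
    fin_cases a <;> fin_cases b <;> simp [triMat, Matrix.mul_apply, Fin.sum_univ_two, hNN]
    · exact f0
    · exact f1
    · linear_combination f2
    · linear_combination f3

theorem triMat_det {n : ℕ} (p : DivPair n) : (triMat n p.1.1 p.1.2).det = n := by
  rw [triMat, Matrix.det_fin_two_of, p.mul_div]; ring

theorem triMat_inj {n : ℕ} [NeZero n] {p q : DivPair n} {γ : SL(2, ℤ)}
    (h : triMat n p.1.1 p.1.2 = γ.1 * triMat n q.1.1 q.1.2) : p = q := by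
  have hp := p.pos
  have hq := q.pos
  have hp3 := p.2.2.1
  have hq3 := q.2.2.1
  have hdet := γ.2
  rw [Matrix.det_fin_two] at hdet
  have h00 := congrFun (congrFun h 0) 0
  have h01 := congrFun (congrFun h 0) 1
  have h10 := congrFun (congrFun h 1) 0
  have h11 := congrFun (congrFun h 1) 1
  simp [triMat, Matrix.mul_apply, Fin.sum_univ_two] at h00 h01 h10 h11
  have hγ : γ.1 1 0 = 0 := by
    rcases h10 with h | h
    · exact h
    · omega
  rw [hγ, mul_zero, sub_zero] at hdet
  have hα : γ.1 0 0 = 1 := by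
    rcases Int.eq_one_or_neg_one_of_mul_eq_one hdet with h | h
    · exact h
    · exfalso
      have h' : γ 0 0 = -1 := h
      rw [h'] at h00
      omega
  have hα' : γ 0 0 = 1 := hα
  rw [hα'] at h00 h01
  have hcc : p.1.1 = q.1.1 := by omega
  rw [← hcc] at h01 hq3
  apply Subtype.ext
  refine Prod.ext hcc ?_
  have : p.1.2 ≡ q.1.2 [MOD n / p.1.1] := by
    rw [← Int.natCast_modEq_iff]
    refine (Int.modEq_iff_dvd.2 ⟨γ 0 1, ?_⟩ : (q.1.2 : ℤ) ≡ p.1.2 [ZMOD (n / p.1.1 : ℕ)]).symm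
    push_cast
    rw [h01]; ring
  exact Nat.ModEq.eq_of_lt_of_lt this hp3 hq3

/-- For `i ∈ I_{nm}` and every `j` there is exactly one `l ∈ Iₙ` with
`A_l K^j(A_σ(i)) Aᵢ⁻¹ ∈ SL(2, ℤ)`, where `σ : I_{nm} → I_m` is the projection. -/
theorem existsUnique_transfer (n m : ℕ) [NeZero n] [NeZero m] (i : Idx (n * m)) (j : ℕ) :
    ∃! l : Idx n, ∃ γ : SL(2, ℤ),
      matA n l * stepK^[j] (matA m (proj (dvd_mul_left m n) i)) = γ.1 * matA (n * m) i := by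
  obtain ⟨N, hN⟩ := exists_left_factor (n := n) (m := m) i
  obtain ⟨G, hG⟩ := stepK_iterate (matA m (proj (dvd_mul_left m n) i)) j
  have hm : (m : ℤ) ≠ 0 := by exact_mod_cast NeZero.ne m
  have hdA : (matA m (proj (dvd_mul_left m n) i)).det = m := triMat_det _
  have hdB : (matA (n * m) i).det = (n * m : ℕ) := triMat_det _
  have hdN : N.det = n := by
    have := congrArg Matrix.det hN
    rw [Matrix.det_mul, hdA, hdB] at this
    push_cast at this
    exact mul_right_cancel₀ hm this
  have hGi : N = N * (G⁻¹).1 * G.1 := by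
    rw [Matrix.mul_assoc, ← Matrix.SpecialLinearGroup.coe_mul, inv_mul_cancel]; simp
  obtain ⟨p, γ, hγ⟩ := exists_hermite (n := n) (N * (G⁻¹).1)
    (by rw [Matrix.det_mul, hdN, (G⁻¹).2, mul_one]) (by
      intro g hg
      have h1 : ∀ a b, g ∣ matA (n * m) i a b := by
        intro a b
        rw [← hN, hGi, Matrix.mul_assoc, Matrix.mul_apply]
        exact Finset.dvd_sum fun x _ => (hg a x).mul_right _
      set q := (idxEquiv (n * m)).symm i with hq
      have c1 : g ∣ q.1.1 := by simpa [matA, triMat] using h1 0 0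
      have c2 : g ∣ q.1.2 := by simpa [matA, triMat] using h1 0 1
      have c3 : g ∣ ((n * m / q.1.1 : ℕ) : ℤ) := h1 1 1
      have c4 := Int.dvd_coe_gcd (Int.dvd_coe_gcd c1 c2) c3
      rw [Int.gcd_natCast_natCast, Int.gcd_natCast_natCast, q.2.2.2] at c4
      exact isUnit_of_dvd_one (by exact_mod_cast c4))
  refine ⟨idxEquiv n p, ⟨γ, ?_⟩, ?_⟩
  · rw [matA, Equiv.symm_apply_apply, ← hγ, hG, ← hN]
    simp only [Matrix.mul_assoc]
    rw [← Matrix.mul_assoc (G⁻¹).1, ← Matrix.SpecialLinearGroup.coe_mul, inv_mul_cancel]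
    simp
  · rintro l ⟨δ, hδ⟩
    rw [hG, ← hN, ← Matrix.mul_assoc, ← Matrix.mul_assoc] at hδ
    have hcan : matA n l * G.1 = δ.1 * N := by
      have := congrArg (· * (matA m (proj (dvd_mul_left m n) i)).adjugate) hδ
      simp only [Matrix.mul_assoc, Matrix.mul_adjugate, hdA, Matrix.mul_smul, mul_one] at this
      exact smul_right_injective _ hm this
    have h2 : matA n l = (δ * γ⁻¹).1 * triMat n p.1.1 p.1.2 := by
      have h3 : matA n l = matA n l * G.1 * (G⁻¹).1 := by
        rw [Matrix.mul_assoc, ← Matrix.SpecialLinearGroup.coe_mul, mul_inv_cancel]; simp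
      rw [h3, hcan, ← hγ, Matrix.SpecialLinearGroup.coe_mul, Matrix.mul_assoc, Matrix.mul_assoc,
        ← Matrix.mul_assoc (γ⁻¹).1, ← Matrix.SpecialLinearGroup.coe_mul, inv_mul_cancel]
      simp
    exact (Equiv.symm_apply_eq _).1 (triMat_inj h2)

/-- The index `l_{i,j} ∈ Iₙ`. -/
noncomputable def transferIdx (n m : ℕ) [NeZero n] [NeZero m] (i : Idx (n * m)) (j : ℕ) : Idx n :=
  (existsUnique_transfer n m i j).choose

/-- The slash action `(f |_β h)(z) = |det h|^β (c z + d)^(-2β) f(h z)` of an integer matrix. -/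
noncomputable def slash (β : ℂ) (f : ℂ → ℂ) (h : Matrix (Fin 2) (Fin 2) ℤ) (z : ℂ) : ℂ :=
  ((|h.det| : ℤ) : ℂ) ^ β * ((h 1 0 : ℂ) * z + (h 1 1 : ℂ)) ^ (-2 * β) *
    f (((h 0 0 : ℂ) * z + (h 0 1 : ℂ)) / ((h 1 0 : ℂ) * z + (h 1 1 : ℂ)))

/-- The operator `T̃_{n,m}` on vector valued functions. -/
noncomputable def heckeLike (n m : ℕ) [NeZero n] [NeZero m] (β : ℂ) (φ : Idx n → ℂ → ℂ)
    (i : Idx n) (z : ℂ) : ℂ :=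
  ∑ s : Idx (n * m) with proj (dvd_mul_right n m) s = i,
    ∑ j ∈ Finset.range (stepCount m (matA m (proj (dvd_mul_left m n) s)) + 1),
      slash β (φ (transferIdx n m s j)) (stepK^[j] (matA m (proj (dvd_mul_left m n) s))) z

/-- The representative `Rᵢ ∈ SL(2, ℤ)` of the right coset of `Γ₀(n)` belonging to `i ∈ Iₙ`; its
lower row is `(c, dₙ(c, b))`, where `(c, b) ∈ Pₙ` corresponds to `i`. -/
noncomputable def cosetRep (n : ℕ) [NeZero n] (i : Idx n) : SL(2, ℤ) :=
  let p := (idxEquiv n).symm i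
  let d := dMin n p.1.1 p.1.2
  ⟨!![Nat.gcdB p.1.1 d, -Nat.gcdA p.1.1 d; (p.1.1 : ℤ), (d : ℤ)], by
    have h := Nat.gcd_eq_gcd_ab p.1.1 d
    rw [(dMin_spec p).1] at h
    rw [Matrix.det_fin_two_of]
    push_cast at h
    linear_combination -h⟩

theorem gcd_mod_eq_one {c d N : ℕ} (h : Nat.gcd c d = 1) :
    Nat.gcd (Nat.gcd c (d % N)) N = 1 := by
  rw [Nat.gcd_assoc, ← Nat.gcd_rec, Nat.gcd_comm N d, ← Nat.gcd_assoc, h, Nat.gcd_one_left]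

/-- The map `hₙ : Iₙ → Iₙ`: if `Rᵢ` has lower row `(c, d)`, then `A_{hₙ(i)} = (c, b; 0, n / c)` with
`b ≡ d mod n / c`. -/
noncomputable def hMap (n : ℕ) [NeZero n] (i : Idx n) : Idx n :=
  let p := (idxEquiv n).symm i
  let d := dMin n p.1.1 p.1.2
  idxEquiv n ⟨(p.1.1, d % (n / p.1.1)), p.2.1, Nat.mod_lt _ p.pos.2, by
    exact gcd_mod_eq_one (dMin_spec p).1⟩

/-- The permutation matrix `ℋₙ`, with entries `1` if `hₙ(j) = i` and `0` otherwise. -/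
noncomputable def hMatrix (n : ℕ) [NeZero n] : Matrix (Idx n) (Idx n) ℂ :=
  Matrix.of fun i j => if hMap n j = i then 1 else 0

/-- `ℋₙ` acting on vector valued functions. -/
noncomputable def hAct (n : ℕ) [NeZero n] (φ : Idx n → ℂ → ℂ) (i : Idx n) (z : ℂ) : ℂ :=
  (hMatrix n).mulVec (fun j => φ j z) i

open UpperHalfPlane in
/-- `u` is a Maass cusp form for `Γ₀(n)` with spectral parameter `β`, i.e. `u ∈ S(n, β)`. -/
structure IsMaassCuspForm (n : ℕ) (β : ℂ) (u : ℍ → ℂ) : Prop where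
  analytic : AnalyticOnNhd ℝ (u ∘ ofComplex) {z : ℂ | 0 < z.im}
  invariant : ∀ g ∈ CongruenceSubgroup.Gamma0 n, ∀ z : ℍ, u (g • z) = u z
  eigen : ∀ z : ℍ, -(z.im : ℂ) ^ 2 * Laplacian.laplacian (u ∘ ofComplex) (z : ℂ) =
    β * (1 - β) * u z
  decay : ∀ (g : SL(2, ℤ)) (C : ℝ), (fun z : ℍ => u (g • z)) =O[atImInfty] fun z => z.im ^ C

/-- The vector `Πₙ u` with components `u(Rᵢ z)`. -/
noncomputable def vecForm (n : ℕ) [NeZero n] (u : ℍ → ℂ) (i : Idx n) (z : ℍ) : ℂ :=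
  u (cosetRep n i • z)

/-- `u |₀ B_m`, that is `z ↦ u(m z)`. -/
noncomputable def dilate (m : ℕ) (u : ℍ → ℂ) (z : ℍ) : ℂ :=
  u (UpperHalfPlane.ofComplex ((m : ℂ) * z))

/-- The right cosets of `Γ₀(n m)` in `Γ₀(n)`. -/
abbrev RightCosets (n m : ℕ) : Type :=
  Quotient (QuotientGroup.rightRel
    ((CongruenceSubgroup.Gamma0 (n * m)).subgroupOf (CongruenceSubgroup.Gamma0 n)))

noncomputable instance rightCosets_fintype (n m : ℕ) [NeZero n] [NeZero m] :
    Fintype (RightCosets n m) :=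
  have : Fintype (CongruenceSubgroup.Gamma0 n ⧸
      (CongruenceSubgroup.Gamma0 (n * m)).subgroupOf (CongruenceSubgroup.Gamma0 n)) :=
    Subgroup.fintypeQuotientOfFiniteIndex
  QuotientGroup.fintypeQuotientRightRel

/-- The Hecke operator `Ĥ_{n,m} u = (u |₀ B_m) |₀ ∑ⱼ Rⱼ`, with `Rⱼ` running through representatives of
the right cosets of `Γ₀(n m)` in `Γ₀(n)`. -/
noncomputable def heckeOp (n m : ℕ) [NeZero n] [NeZero m] (u : ℍ → ℂ) (z : ℍ) : ℂ :=
  ∑ j : RightCosets n m, dilate m u ((Quotient.out j : CongruenceSubgroup.Gamma0 n).1 • z)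

/-- `∂_x f` at `z = x + i y`. -/
noncomputable def dx (f : ℂ → ℂ) (z : ℂ) : ℂ := fderiv ℝ f z 1

/-- `∂_y f` at `z = x + i y`. -/
noncomputable def dy (f : ℂ → ℂ) (z : ℂ) : ℂ := fderiv ℝ f z Complex.I

/-- The 1-form `η(u, v) = (v ∂_y u - u ∂_y v) dx + (u ∂_x v - v ∂_x u) dy` at the point `z`, evaluated
on the tangent vector `w`. -/
noncomputable def eta (u v : ℂ → ℂ) (z w : ℂ) : ℂ :=
  (v z * dy u z - u z * dy v z) * (w.re : ℂ) + (u z * dx v z - v z * dx u z) * (w.im : ℂ)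

/-- The Poisson kernel `R_ζ(z) = y / ((x - ζ)² + y²)`. -/
noncomputable def poisson (ζ z : ℂ) : ℂ := (z.im : ℂ) / (((z.re : ℂ) - ζ) ^ 2 + (z.im : ℂ) ^ 2)

/-- The integrand of `∫₀^{i∞} η(f, R_ζ^β)` along the path `y ↦ i y`. -/
noncomputable def periodIntegrand (β : ℂ) (f : ℍ → ℂ) (ζ : ℂ) (y : ℝ) : ℂ :=
  eta (f ∘ UpperHalfPlane.ofComplex) (fun z => poisson ζ z ^ β) ((y : ℂ) * Complex.I) Complex.I

/-- `F` is holomorphic on the cut plane `ℂ ∖ (-∞, 0]`, and for `Re ζ > 0`, where the imaginary axis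
avoids the singularities of `R_ζ^β`, it is the convergent integral `∫₀^{i∞} η(f, R_ζ^β)`. -/
def IsPeriodTransform (β : ℂ) (f : ℍ → ℂ) (F : ℂ → ℂ) : Prop :=
  DifferentiableOn ℂ F Complex.slitPlane ∧
    ∀ ζ : ℂ, 0 < ζ.re →
      MeasureTheory.IntegrableOn (periodIntegrand β f ζ) (Set.Ioi 0) ∧
        F ζ = ∫ y in Set.Ioi (0 : ℝ), periodIntegrand β f ζ y

open Classical in
/-- The function `ζ ↦ ∫₀^{i∞} η(f, R_ζ^β)` on the cut plane: given by the integral along the imaginary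
axis for `Re ζ > 0`, and by holomorphic continuation elsewhere (unique, as the cut plane is
connected). -/
noncomputable def periodTransform (β : ℂ) (f : ℍ → ℂ) : ℂ → ℂ :=
  if h : ∃ F : ℂ → ℂ, IsPeriodTransform β f F then h.choose else 0

/-- The transform `Pₙ` of vector valued functions, taken componentwise. -/
noncomputable def vecPeriod (n : ℕ) (β : ℂ) (f : Idx n → ℍ → ℂ) (i : Idx n) : ℂ → ℂ :=
  periodTransform β (f i)

end PeriodHecke

/-! For real `ζ > 0`, a cusp form `u` and `R_ζ^β` (written `horo β 1 (-ζ)`) are eigenfunctions of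
the hyperbolic Laplacian for the same eigenvalue. Hence `η(u, R_ζ^β)` is closed
(`fderiv_etaForm_symm`) and has a primitive `Φ` on the half-plane. Rapid decay of `u` and of its
gradient gives `Φ` a limit at each cusp `N∞`, with `N` an integer matrix of positive determinant
(`exists_cuspLimit`). The period transform at `ζ` is then `Φ(∞) - Φ(0)` (`periodTransform_eq_sub`).

The construction is natural under fractional linear maps. If `G` lies in `setS m` and `Φ` belongs to
`g ∘ G`, then slashing the period transform of `g` by `G` gives `Φ(G⁻¹∞) - Φ(G⁻¹0)` at `ζ`
(`slash_periodTransform_eq_sub`). The map `K` is left multiplication by some `(q, -1; 1, 0)`, so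
`(KG)⁻¹∞ = G⁻¹0`. When all `g_j ∘ K^j A` are one function `W`, the sum over `j` telescopes along a
chain of cusps from `∞` to `0` and equals the period transform of `W` (`sum_slash_periodTransform`).

The arithmetic input is that `Iₙ` is `Γ₀(n) \ SL(2, ℤ)`, that `hₙ` is right multiplication by `T`
(`hMap_rowIdx`), and that `A_{hₙ(i)}` lies in `SL(2, ℤ) B_n R_i` (`exists_matA_rowIdx`). With `R`
and `Q` representing the preimages of `s` and `l_{s,j}` under `h_{nm}` and `hₙ`, this yields `Q K^j
A ∈ Γ₀(n) B_m R`, so that every `g_j ∘ K^j A` is `z ↦ u(B_m R z)` (`dilateCoset_eq_vecForm`).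
Summing over the fibre of `s` produces the Hecke operator.

This proves the identity for `ζ > 0`; both sides are holomorphic on the cut plane, so it holds
there. The continuation of the period transform comes from integrating along rays other than the
imaginary axis, with a branch of the kernel that is holomorphic in `ζ` on the sector cut out by the
ray and its conjugate. -/

namespace PeriodHecke

open Complex Filter Topology InnerProductSpace
open UpperHalfPlane hiding I

/-! ### Conformal behaviour of the Laplacian; closedness of the form `η`. -/

section Laplacian

variable {F : Type*} [NormedAddCommGroup F] [NormedSpace ℝ F]

theorem laplacian_apply_eq (f : ℂ → F) (z : ℂ) :
    Laplacian.laplacian f z = fderiv ℝ (fderiv ℝ f) z 1 1 + fderiv ℝ (fderiv ℝ f) z I I := by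
  rw [laplacian_eq_iteratedFDeriv_complexPlane]
  simp [iteratedFDeriv_two_apply]

theorem fderiv_comp_analyticAt {f : ℂ → F} {g : ℂ → ℂ} {z : ℂ} (hf : DifferentiableAt ℝ f (g z))
    (hg : DifferentiableAt ℂ g z) (a : ℂ) :
    fderiv ℝ (f ∘ g) z a = fderiv ℝ f (g z) (deriv g z * a) := by
  have h1 : HasFDerivAt g ((fderiv ℂ g z).restrictScalars ℝ) z :=
    hg.hasFDerivAt.restrictScalars ℝ
  rw [(hf.hasFDerivAt.comp z h1).fderiv]
  have : fderiv ℂ g z a = deriv g z * a := by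
    rw [fderiv_eq_smul_deriv, smul_eq_mul, mul_comm]
  simp [this]

/-- The second derivative of `f ∘ g` in direction `e` is `D²f(g'e, g'e) + Df(g'' e²)`. Over `e = 1,
I` the `g''` terms cancel because `I² = -1`, and `g'`, `g' I` form an orthogonal frame of length
`‖g'‖`. -/
theorem laplacian_comp_analyticAt {f : ℂ → F} {g : ℂ → ℂ} {z : ℂ} (hf : ContDiffAt ℝ 2 f (g z))
    (hg : AnalyticAt ℂ g z) :
    Laplacian.laplacian (f ∘ g) z = ‖deriv g z‖ ^ 2 • Laplacian.laplacian f (g z) := by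
  have hf1 : DifferentiableAt ℝ (fderiv ℝ f) (g z) :=
    (hf.fderiv_right (m := 1) (by norm_num)).differentiableAt (by norm_num)
  have hfn : ∀ᶠ y in 𝓝 (g z), DifferentiableAt ℝ f y := by
    filter_upwards [hf.eventually (by simp)] with y hy using hy.differentiableAt (by norm_num)
  have hgz : HasFDerivAt g ((fderiv ℂ g z).restrictScalars ℝ) z :=
    hg.differentiableAt.hasFDerivAt.restrictScalars ℝ
  have hev : ∀ e : ℂ, (fun y => fderiv ℝ (f ∘ g) y e) =ᶠ[𝓝 z]
      fun y => fderiv ℝ f (g y) (deriv g y * e) := by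
    intro e
    filter_upwards [hg.continuousAt.eventually hfn, hg.eventually_analyticAt] with y hy hy'
    exact fderiv_comp_analyticAt hy hy'.differentiableAt e
  have hd : ContDiffAt ℝ 2 (f ∘ g) z := hf.comp z
    ((hg.restrictScalars (𝕜 := ℝ)).contDiffAt)
  have hd1 : DifferentiableAt ℝ (fderiv ℝ (f ∘ g)) z :=
    (hd.fderiv_right (m := 1) (by norm_num)).differentiableAt (by norm_num)
  have hmul : ∀ (h : ℂ → ℂ) (a : ℂ), fderiv ℂ h z a = deriv h z * a := by
    intro h a
    rw [fderiv_eq_smul_deriv, smul_eq_mul, mul_comm]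
  have key : ∀ e : ℂ, fderiv ℝ (fderiv ℝ (f ∘ g)) z e e =
      fderiv ℝ (fderiv ℝ f) (g z) (deriv g z * e) (deriv g z * e) +
        fderiv ℝ f (g z) (deriv (deriv g) z * e * e) := by
    intro e
    have h1 : fderiv ℝ (fun y => fderiv ℝ (f ∘ g) y e) z e =
        fderiv ℝ (fderiv ℝ (f ∘ g)) z e e := by
      rw [(hd1.hasFDerivAt.clm_apply (hasFDerivAt_const e z)).fderiv]
      simp
    have h2 : HasFDerivAt (fun y => deriv g y * e)
        (((fderiv ℂ (deriv g) z).smulRight e).restrictScalars ℝ) z := by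
      have := (hg.deriv.differentiableAt.hasFDerivAt.mul_const e).restrictScalars ℝ
      refine this.congr_fderiv ?_
      ext a; simp [mul_comm]
    have h3 : HasFDerivAt (fun y => fderiv ℝ f (g y))
        ((fderiv ℝ (fderiv ℝ f) (g z)).comp ((fderiv ℂ g z).restrictScalars ℝ)) z :=
      hf1.hasFDerivAt.comp z hgz
    rw [← h1, (hev e).fderiv_eq, (h3.clm_apply h2).fderiv]
    simp [hmul, add_comm]
  rw [laplacian_apply_eq, laplacian_apply_eq, key, key]
  set D := fderiv ℝ (fderiv ℝ f) (g z)
  set p := (deriv g z).re with hp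
  set q := (deriv g z).im with hq
  have e1 : deriv g z * 1 = p • (1 : ℂ) + q • I := by
    apply Complex.ext <;> simp [hp, hq]
  have e2 : deriv g z * I = (-q) • (1 : ℂ) + p • I := by
    apply Complex.ext <;> simp [hp, hq]
  have e3 : deriv (deriv g) z * I * I = -(deriv (deriv g) z * 1 * 1) := by
    rw [mul_assoc, I_mul_I]; ring
  have e4 : ‖deriv g z‖ ^ 2 = p * p + q * q := by
    rw [← Complex.normSq_eq_norm_sq, Complex.normSq_apply]
  rw [e1, e2, e3, e4]
  simp only [map_add, map_smul, map_neg, _root_.add_apply, _root_.smul_apply, smul_add, smul_smul]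
  module

end Laplacian

/-- Multiplication by `i` as a real linear map. -/
noncomputable def mulI : ℂ →L[ℝ] ℂ := ContinuousLinearMap.mul ℝ ℂ I

@[simp] theorem mulI_apply (a : ℂ) : mulI a = I * a := rfl

/-- The 1-form `η(u, v)` with values in the real linear maps. -/
noncomputable def etaForm (u v : ℂ → ℂ) (z : ℂ) : ℂ →L[ℝ] ℂ :=
  v z • (fderiv ℝ u z).comp mulI - u z • (fderiv ℝ v z).comp mulI

theorem etaForm_apply (u v : ℂ → ℂ) (z a : ℂ) :
    etaForm u v z a = v z * fderiv ℝ u z (I * a) - u z * fderiv ℝ v z (I * a) := by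
  simp [etaForm]

theorem fderiv_apply_I_mul (u : ℂ → ℂ) (z a : ℂ) :
    fderiv ℝ u z (I * a) = a.re * dy u z - a.im * dx u z := by
  have : I * a = a.re • I + (-a.im) • (1 : ℂ) := by apply Complex.ext <;> simp
  rw [this, map_add, map_smul, map_smul]
  simp [dx, dy, sub_eq_add_neg]

theorem eta_eq_etaForm (u v : ℂ → ℂ) (z a : ℂ) : eta u v z a = etaForm u v z a := by
  rw [etaForm_apply, fderiv_apply_I_mul, fderiv_apply_I_mul, eta]
  ring

theorem norm_etaForm_le (u v : ℂ → ℂ) (z : ℂ) :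
    ‖etaForm u v z‖ ≤ ‖v z‖ * ‖fderiv ℝ u z‖ + ‖u z‖ * ‖fderiv ℝ v z‖ := by
  refine ContinuousLinearMap.opNorm_le_bound _ (by positivity) fun a => ?_
  rw [etaForm_apply]
  have h : ∀ f : ℂ → ℂ, ‖fderiv ℝ f z (I * a)‖ ≤ ‖fderiv ℝ f z‖ * ‖a‖ := by
    intro f
    simpa using (fderiv ℝ f z).le_opNorm (I * a)
  calc _ ≤ ‖v z‖ * ‖fderiv ℝ u z (I * a)‖ + ‖u z‖ * ‖fderiv ℝ v z (I * a)‖ := by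
        refine (norm_sub_le _ _).trans ?_
        rw [norm_mul, norm_mul]
    _ ≤ ‖v z‖ * (‖fderiv ℝ u z‖ * ‖a‖) + ‖u z‖ * (‖fderiv ℝ v z‖ * ‖a‖) := by
        gcongr <;> exact h _
    _ = _ := by ring

/-- Naturality under holomorphic maps: `η` involves only derivatives in the direction `i a`, and
multiplication by `i` commutes with multiplication by `g'`. -/
theorem etaForm_comp {u v g : ℂ → ℂ} {z : ℂ} (hu : DifferentiableAt ℝ u (g z))
    (hv : DifferentiableAt ℝ v (g z)) (hg : DifferentiableAt ℂ g z) (a : ℂ) :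
    etaForm (u ∘ g) (v ∘ g) z a = etaForm u v (g z) (deriv g z * a) := by
  rw [etaForm_apply, etaForm_apply, fderiv_comp_analyticAt hu hg, fderiv_comp_analyticAt hv hg,
    mul_left_comm]
  rfl

theorem etaForm_congr {u u' v v' : ℂ → ℂ} {z : ℂ} (hu : u =ᶠ[𝓝 z] u') (hv : v =ᶠ[𝓝 z] v') :
    etaForm u v z = etaForm u' v' z := by
  rw [etaForm, etaForm, hu.fderiv_eq, hv.fderiv_eq, hu.eq_of_nhds, hv.eq_of_nhds]

theorem etaForm_const_mul_right (u v : ℂ → ℂ) (c : ℂ) {z : ℂ} (hv : DifferentiableAt ℝ v z) :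
    etaForm u (fun y => c * v y) z = c • etaForm u v z := by
  ext a
  rw [_root_.smul_apply, etaForm_apply, etaForm_apply, fderiv_const_mul hv]
  simp
  ring

/-- `w` is a `C²` eigenfunction of the hyperbolic Laplacian with eigenvalue `β (1 - β)`. -/
def IsEigen (β : ℂ) (w : ℂ → ℂ) : Prop :=
  ∀ z : ℂ, 0 < z.im → ContDiffAt ℝ 2 w z ∧
    -(z.im : ℂ) ^ 2 * Laplacian.laplacian w z = β * (1 - β) * w z

theorem IsEigen.differentiableAt {β : ℂ} {w : ℂ → ℂ} (h : IsEigen β w) {z : ℂ} (hz : 0 < z.im) :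
    DifferentiableAt ℝ w z :=
  (h z hz).1.differentiableAt (by norm_num)

theorem IsEigen.laplacian_eq {β : ℂ} {w : ℂ → ℂ} (h : IsEigen β w) {z : ℂ} (hz : 0 < z.im) :
    Laplacian.laplacian w z = -(β * (1 - β)) / (z.im : ℂ) ^ 2 * w z := by
  have hy : (z.im : ℂ) ≠ 0 := by exact_mod_cast hz.ne'
  field_simp
  linear_combination -(h z hz).2

theorem IsEigen.const_mul {β : ℂ} {w : ℂ → ℂ} (h : IsEigen β w) (c : ℂ) :
    IsEigen β (fun z => c * w z) := by
  intro z hz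
  obtain ⟨h1, h2⟩ := h z hz
  refine ⟨contDiffAt_const.mul h1, ?_⟩
  have : (fun z => c * w z) = ((c • ContinuousLinearMap.id ℝ ℂ) : ℂ →L[ℝ] ℂ) ∘ w := by
    ext; simp
  rw [this, h1.laplacian_CLM_comp_left]
  simp only [Function.comp_apply, _root_.smul_apply, ContinuousLinearMap.id_apply,
    smul_eq_mul]
  linear_combination c * h2

/-- Green's formula: the exterior derivative of `η(u, v)` is, up to sign, `(v Δu - u Δv) dx ∧ dy`,
which vanishes because `Δu` and `Δv` are the same multiple of `u` and of `v` at each point. -/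
theorem fderiv_etaForm_symm {β : ℂ} {u v : ℂ → ℂ} (hu : IsEigen β u) (hv : IsEigen β v) {z : ℂ}
    (hz : 0 < z.im) : DifferentiableAt ℝ (etaForm u v) z ∧
      ∀ a b, fderiv ℝ (etaForm u v) z a b = fderiv ℝ (etaForm u v) z b a := by
  have d2 : ∀ w, IsEigen β w → DifferentiableAt ℝ (fderiv ℝ w) z := fun w hw =>
    ((hw z hz).1.fderiv_right (m := 1) (by norm_num)).differentiableAt (by norm_num)
  have h1 : ∀ f g : ℂ → ℂ, IsEigen β f → IsEigen β g → HasFDerivAt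
      (fun y => g y • (fderiv ℝ f y).comp mulI)
      (g z • ((ContinuousLinearMap.compL ℝ ℂ ℂ ℂ).flip mulI).comp (fderiv ℝ (fderiv ℝ f) z) +
        (fderiv ℝ g z).smulRight ((fderiv ℝ f z).comp mulI)) z := by
    intro f g hf hg
    exact (hg.differentiableAt hz).hasFDerivAt.smul
      (((ContinuousLinearMap.compL ℝ ℂ ℂ ℂ).flip mulI).hasFDerivAt.comp z (d2 f hf).hasFDerivAt)
  have h2 := (h1 u v hu hv).sub (h1 v u hv hu)
  refine ⟨h2.differentiableAt, ?_⟩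
  have h3 : fderiv ℝ (etaForm u v) z = _ := h2.fderiv
  rw [h3]
  -- On a real plane a bilinear form is symmetric as soon as it is so on one pair of basis vectors.
  have key : ∀ a b : ℂ, ∀ L : ℂ →L[ℝ] ℂ →L[ℝ] ℂ, L 1 I = L I 1 → L a b = L b a := by
    intro a b L hL
    have ha : a = a.re • (1 : ℂ) + a.im • I := by apply Complex.ext <;> simp
    have hb : b = b.re • (1 : ℂ) + b.im • I := by apply Complex.ext <;> simp
    rw [ha, hb]
    simp only [map_add, map_smul, _root_.add_apply, _root_.smul_apply, hL]
    module
  intro a b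
  apply key
  have l1 := hu.laplacian_eq hz
  have l2 := hv.laplacian_eq hz
  rw [laplacian_apply_eq] at l1 l2
  simp only [_root_.sub_apply, _root_.add_apply,
    _root_.smul_apply, ContinuousLinearMap.comp_apply,
    ContinuousLinearMap.flip_apply, ContinuousLinearMap.compL_apply,
    ContinuousLinearMap.smulRight_apply, mulI_apply, I_mul_I, mul_one, smul_eq_mul, map_neg]
  linear_combination -v z * l1 + u z * l2

/-- Poincaré lemma on the upper half-plane, which is convex. -/
theorem exists_primitive {β : ℂ} {u v : ℂ → ℂ} (hu : IsEigen β u) (hv : IsEigen β v) :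
    ∃ Φ : ℂ → ℂ, ∀ z : ℂ, 0 < z.im → HasFDerivAt Φ (etaForm u v z) z :=
  (convex_halfSpace_im_gt 0).exists_forall_hasFDerivAt_of_fderiv_symmetric
    isOpen_upperHalfPlaneSet
    (fun _ hz => (fderiv_etaForm_symm hu hv hz).1.differentiableWithinAt)
    (fun _ hz => (fderiv_etaForm_symm hu hv hz).2)

end PeriodHecke

/-! ### Fractional linear maps and the eigenfunctions `R_ζ^β`. -/

namespace PeriodHecke

open Complex Filter Topology InnerProductSpace
open UpperHalfPlane hiding I

/-- The fractional linear map `z ↦ (a z + b) / (c z + d)`. -/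
noncomputable def mob (a b c d : ℝ) (z : ℂ) : ℂ := (a * z + b) / (c * z + d)

theorem mob_denom_ne_zero {c d : ℝ} (h : c ≠ 0 ∨ d ≠ 0) {z : ℂ} (hz : 0 < z.im) :
    (c : ℂ) * z + d ≠ 0 := by
  intro h0
  have h1 := congrArg Complex.im h0
  have h2 := congrArg Complex.re h0
  simp only [add_im, mul_im, ofReal_re, ofReal_im, zero_mul, add_zero, zero_im, mul_eq_zero] at h1
  rcases h1 with h1 | h1
  · simp [h1] at h2
    simp [h1, h2] at h
  · exact hz.ne' h1

theorem ne_zero_of_det_pos {a b c d : ℝ} (h : 0 < a * d - b * c) : c ≠ 0 ∨ d ≠ 0 := by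
  by_contra! h0
  simp [h0.1, h0.2] at h

section Mob

variable {a b c d : ℝ} {z : ℂ}

theorem mob_im (a b c d : ℝ) (z : ℂ) :
    (mob a b c d z).im = (a * d - b * c) * z.im / normSq (c * z + d) := by
  rw [mob, div_im]
  simp
  ring

theorem mob_im_pos (h : 0 < a * d - b * c) (hz : 0 < z.im) : 0 < (mob a b c d z).im := by
  rw [mob_im]
  have := normSq_pos.2 (mob_denom_ne_zero (ne_zero_of_det_pos h) hz)
  positivity

theorem mob_hasDerivAt (h : 0 < a * d - b * c) (hz : 0 < z.im) :
    HasDerivAt (mob a b c d) ((a * d - b * c) / (c * z + d) ^ 2) z := by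
  have h0 := mob_denom_ne_zero (ne_zero_of_det_pos h) hz
  have h1 : ∀ p q : ℝ, HasDerivAt (fun z : ℂ => (p : ℂ) * z + q) p z := fun p q => by
    simpa using ((hasDerivAt_id z).const_mul (p : ℂ)).add_const (q : ℂ)
  refine ((h1 a b).div (h1 c d) h0).congr_deriv ?_
  ring

theorem mob_analyticAt (h : 0 < a * d - b * c) (hz : 0 < z.im) : AnalyticAt ℂ (mob a b c d) z := by
  refine AnalyticAt.div ?_ ?_ (mob_denom_ne_zero (ne_zero_of_det_pos h) hz) <;> fun_prop

/-- Real fractional linear maps of positive determinant are hyperbolic isometries. In this form the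
fact turns the conformal factor of the Laplacian into the ratio of the squared heights. -/
theorem norm_deriv_mob (h : 0 < a * d - b * c) (hz : 0 < z.im) :
    ‖deriv (mob a b c d) z‖ * z.im = (mob a b c d z).im := by
  rw [(mob_hasDerivAt h hz).deriv, mob_im, norm_div, norm_pow, ← normSq_eq_norm_sq]
  have : ‖(a * d - b * c : ℂ)‖ = a * d - b * c := by
    rw [← ofReal_mul, ← ofReal_mul, ← ofReal_sub, norm_real, Real.norm_of_nonneg h.le]
  rw [this]; ring

theorem IsEigen.comp_mob {β : ℂ} {w : ℂ → ℂ} (hw : IsEigen β w) (h : 0 < a * d - b * c) :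
    IsEigen β (w ∘ mob a b c d) := by
  intro z hz
  obtain ⟨h1, h2⟩ := hw _ (mob_im_pos h hz)
  have h3 := mob_analyticAt h hz
  refine ⟨h1.comp z (h3.restrictScalars (𝕜 := ℝ)).contDiffAt, ?_⟩
  rw [laplacian_comp_analyticAt h1 h3, Function.comp_apply, ← h2, ← norm_deriv_mob h hz]
  simp only [real_smul]
  push_cast
  ring

end Mob

/-- The function `y ^ β`. -/
noncomputable def powIm (β : ℂ) (z : ℂ) : ℂ := (z.im : ℂ) ^ β

/-- The imaginary part as a real linear map to `ℂ`. -/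
noncomputable def imL : ℂ →L[ℝ] ℂ := ofRealCLM.comp imCLM

@[simp] theorem imL_apply (z : ℂ) : imL z = z.im := rfl

theorem hasFDerivAt_powIm (β : ℂ) {z : ℂ} (hz : 0 < z.im) :
    HasFDerivAt (powIm β) ((β * powIm (β - 1) z) • imL) z := by
  have h1 : HasFDerivAt (fun w : ℂ => w ^ β)
      (((ContinuousLinearMap.toSpanSingleton ℂ (β * (imL z) ^ (β - 1))).restrictScalars ℝ)) (imL z) :=
    ((hasDerivAt_id _).cpow_const (c := β) (by simp [hz])).hasFDerivAt.restrictScalars ℝ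
      |>.congr_fderiv (by ext; simp)
  refine (h1.comp z imL.hasFDerivAt).congr_fderiv ?_
  ext a
  simp [powIm, mul_comm]

theorem contDiffAt_powIm (β : ℂ) {z : ℂ} (hz : 0 < z.im) : ContDiffAt ℝ 2 (powIm β) z := by
  have h1 : ContDiffAt ℝ 2 (fun w : ℂ => w ^ β) (imL z) := by
    have : AnalyticAt ℂ (fun w : ℂ => w ^ β) (imL z) :=
      analyticAt_id.cpow analyticAt_const (by simp [hz])
    exact (this.restrictScalars (𝕜 := ℝ)).contDiffAt
  exact h1.comp z imL.contDiff.contDiffAt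

theorem isEigen_powIm (β : ℂ) : IsEigen β (powIm β) := by
  intro z hz
  refine ⟨contDiffAt_powIm β hz, ?_⟩
  have hev : fderiv ℝ (powIm β) =ᶠ[𝓝 z] fun z => (β * powIm (β - 1) z) • imL := by
    filter_upwards [isOpen_upperHalfPlaneSet.mem_nhds hz] with y hy
    exact (hasFDerivAt_powIm β hy).fderiv
  have h2 := ((hasFDerivAt_powIm (β - 1) hz).const_mul β).smul_const imL
  rw [laplacian_apply_eq, hev.fderiv_eq, h2.fderiv]
  have hy : (z.im : ℂ) ≠ 0 := by exact_mod_cast hz.ne'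
  have h3 : (z.im : ℂ) ^ β = (z.im : ℂ) ^ (β - 1 - 1) * (z.im : ℂ) ^ 2 := by
    rw [← cpow_natCast, ← cpow_add _ _ hy]
    congr 1; push_cast; ring
  simp [powIm]
  rw [h3]; ring

theorem norm_fderiv_powIm_le (β : ℂ) {z : ℂ} (hz : 0 < z.im) :
    ‖fderiv ℝ (powIm β) z‖ * z.im ≤ ‖β‖ * ‖powIm β z‖ := by
  rw [(hasFDerivAt_powIm β hz).fderiv]
  have h1 : ‖imL‖ ≤ 1 := ContinuousLinearMap.opNorm_le_bound _ zero_le_one fun a => by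
    simpa using abs_im_le_norm a
  have hy : (z.im : ℂ) ≠ 0 := by exact_mod_cast hz.ne'
  have h3 : ‖powIm β z‖ = ‖powIm (β - 1) z‖ * z.im := by
    rw [powIm, powIm, show β = β - 1 + 1 by ring, cpow_add _ _ hy, norm_mul]
    simp [abs_of_pos hz]
  rw [norm_smul, norm_mul, h3]
  have : 0 ≤ ‖β‖ * ‖powIm (β - 1) z‖ * z.im := by positivity
  nlinarith

/-- The eigenfunction `(y / |p z + q|²) ^ β`. -/
noncomputable def horo (β : ℂ) (p q : ℝ) (z : ℂ) : ℂ :=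
  ((z.im / normSq (p * z + q) : ℝ) : ℂ) ^ β

/-- Any nonzero real row `(p, q)` completes to a matrix of determinant one, so `horo β p q` is a
translate of `y ^ β` and inherits its eigenvalue equation and gradient bound. -/
theorem horo_eq_comp {p q : ℝ} (h : p ≠ 0 ∨ q ≠ 0) (β : ℂ) : ∃ a b : ℝ, a * q - b * p = 1 ∧
    horo β p q = powIm β ∘ mob a b p q := by
  have h0 : p ^ 2 + q ^ 2 ≠ 0 := by
    rcases h with h | h <;> positivity
  have h1 : q / (p ^ 2 + q ^ 2) * q - -p / (p ^ 2 + q ^ 2) * p = 1 := by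
    field_simp; ring
  refine ⟨q / (p ^ 2 + q ^ 2), -p / (p ^ 2 + q ^ 2), h1, ?_⟩
  ext z
  rw [Function.comp_apply, powIm, mob_im, h1, one_mul, horo]

theorem isEigen_horo {p q : ℝ} (h : p ≠ 0 ∨ q ≠ 0) (β : ℂ) : IsEigen β (horo β p q) := by
  obtain ⟨a, b, h1, h2⟩ := horo_eq_comp h β
  rw [h2]
  exact (isEigen_powIm β).comp_mob (by rw [h1]; norm_num)

theorem norm_fderiv_comp_le {f g : ℂ → ℂ} {z : ℂ} (hf : DifferentiableAt ℝ f (g z))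
    (hg : DifferentiableAt ℂ g z) :
    ‖fderiv ℝ (f ∘ g) z‖ ≤ ‖fderiv ℝ f (g z)‖ * ‖deriv g z‖ := by
  refine ContinuousLinearMap.opNorm_le_bound _ (by positivity) fun e => ?_
  rw [fderiv_comp_analyticAt hf hg]
  refine (ContinuousLinearMap.le_opNorm _ _).trans ?_
  rw [norm_mul, mul_assoc]

theorem norm_fderiv_horo_le {p q : ℝ} (h : p ≠ 0 ∨ q ≠ 0) (β : ℂ) {z : ℂ} (hz : 0 < z.im) :
    ‖fderiv ℝ (horo β p q) z‖ * z.im ≤ ‖β‖ * ‖horo β p q z‖ := by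
  obtain ⟨a, b, h1, h2⟩ := horo_eq_comp h β
  rw [h2]
  have hd : 0 < a * q - b * p := by rw [h1]; norm_num
  have hm := mob_im_pos hd hz
  have h3 := (isEigen_powIm β).differentiableAt hm
  have h4 := norm_fderiv_comp_le h3 (mob_analyticAt hd hz).differentiableAt
  calc _ ≤ ‖fderiv ℝ (powIm β) (mob a b p q z)‖ * ‖deriv (mob a b p q) z‖ * z.im := by gcongr
    _ = ‖fderiv ℝ (powIm β) (mob a b p q z)‖ * (mob a b p q z).im := by
        rw [mul_assoc, norm_deriv_mob hd hz]
    _ ≤ _ := norm_fderiv_powIm_le β hm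

theorem norm_horo {p q : ℝ} (h : p ≠ 0 ∨ q ≠ 0) (β : ℂ) {z : ℂ} (hz : 0 < z.im) :
    ‖horo β p q z‖ = (z.im / normSq (p * z + q)) ^ β.re := by
  rw [horo, norm_cpow_eq_rpow_re_of_pos]
  have := normSq_pos.2 (mob_denom_ne_zero h hz)
  positivity

/-- A change of variable acts on the row `(p, q)` by right multiplication. With the homogeneity
`horo_smul` this is where the automorphy factor `|det|^β (cζ + d)^(-2β)` of the slash action
originates. -/
theorem horo_mob {a b c d : ℝ} (h : 0 < a * d - b * c) (β : ℂ) (p q : ℝ) {z : ℂ} (hz : 0 < z.im) :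
    horo β p q (mob a b c d z) =
      ((a * d - b * c : ℝ) : ℂ) ^ β * horo β (p * a + q * c) (p * b + q * d) z := by
  have h0 := mob_denom_ne_zero (ne_zero_of_det_pos h) hz
  rw [horo, horo, ← mul_cpow_ofReal_nonneg h.le (div_nonneg hz.le (normSq_nonneg _)), ← ofReal_mul,
    mob_im]
  have h1 : (p : ℂ) * mob a b c d z + q =
      (((p * a + q * c : ℝ) : ℂ) * z + ((p * b + q * d : ℝ) : ℂ)) / (c * z + d) := by
    rw [mob, ← mul_div_assoc, div_add' _ _ _ h0]; push_cast; ring_nf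
  have h2 := (normSq_pos.2 h0).ne'
  rw [h1, normSq_div]
  congr 2
  field_simp

theorem horo_smul {t : ℝ} (ht : 0 < t) (β : ℂ) (p q : ℝ) {z : ℂ} (hz : 0 < z.im) :
    horo β (t * p) (t * q) z = (t : ℂ) ^ (-2 * β) * horo β p q z := by
  have h1 : ((t * p : ℝ) : ℂ) * z + ((t * q : ℝ) : ℂ) = t * (p * z + q) := by push_cast; ring
  have h2 : z.im / normSq (t * (p * z + q)) = t ^ (-2 : ℝ) * (z.im / normSq (p * z + q)) := by
    rw [normSq_mul, normSq_ofReal, Real.rpow_neg ht.le, Real.rpow_two]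
    field_simp
  have h3 : ((t ^ (-2 : ℝ) : ℝ) : ℂ) ^ β = (t : ℂ) ^ (-2 * β) := by
    have h4 := (Real.rpow_pos_of_pos ht (-2)).ne'
    rw [cpow_def_of_ne_zero (by exact_mod_cast h4), cpow_def_of_ne_zero (by exact_mod_cast ht.ne'),
      ← ofReal_log ht.le, ← ofReal_log (by positivity), Real.log_rpow ht]
    push_cast; ring_nf
  rw [horo, horo, h1, h2, ofReal_mul, mul_cpow_ofReal_nonneg (by positivity)
    (div_nonneg hz.le (normSq_nonneg _)), h3]

theorem poisson_cpow_eq_horo (β : ℂ) (ζ : ℝ) : (fun z => poisson ζ z ^ β) = horo β 1 (-ζ) := by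
  ext z
  rw [horo, poisson]
  congr 1
  rw [normSq_apply]
  simp
  ring

/-- The action of an integer matrix by fractional linear maps. -/
noncomputable def act (M : Matrix (Fin 2) (Fin 2) ℤ) (z : ℂ) : ℂ :=
  mob (M 0 0) (M 0 1) (M 1 0) (M 1 1) z

theorem det_cast (M : Matrix (Fin 2) (Fin 2) ℤ) :
    (M 0 0 : ℝ) * M 1 1 - M 0 1 * M 1 0 = (M.det : ℤ) := by
  rw [Matrix.det_fin_two]; push_cast; ring

theorem det_cast_pos {M : Matrix (Fin 2) (Fin 2) ℤ} (h : 0 < M.det) :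
    0 < (M 0 0 : ℝ) * M 1 1 - M 0 1 * M 1 0 := by
  rw [det_cast]; exact_mod_cast h

theorem act_im_pos {M : Matrix (Fin 2) (Fin 2) ℤ} (h : 0 < M.det) {z : ℂ} (hz : 0 < z.im) :
    0 < (act M z).im := mob_im_pos (det_cast_pos h) hz

theorem act_mul {M N : Matrix (Fin 2) (Fin 2) ℤ} (hN : 0 < N.det) {z : ℂ}
    (hz : 0 < z.im) : act (M * N) z = act M (act N z) := by
  have h0 := mob_denom_ne_zero (ne_zero_of_det_pos (det_cast_pos hN)) hz
  simp only [act, mob, Matrix.mul_apply, Fin.sum_univ_two]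
  push_cast at h0 ⊢
  have e : ∀ x y A D : ℂ, D ≠ 0 → x * (A / D) + y = (x * A + y * D) / D := by
    intro x y A D h; field_simp
  rw [e _ _ _ _ h0, e _ _ _ _ h0, div_div_div_cancel_right₀ h0]
  congr 1 <;> ring

/-- Lets the adjugate serve as an integral inverse, since the product of a matrix with its adjugate
is a scalar. -/
theorem act_scalar {t : ℤ} (ht : t ≠ 0) (z : ℂ) : act (t • 1) z = z := by
  have : (t : ℂ) ≠ 0 := by exact_mod_cast ht
  simp [act, mob]
  field_simp

theorem coe_smul_eq_act (γ : SL(2, ℤ)) (z : ℍ) : ((γ • z : ℍ) : ℂ) = act γ.1 z := by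
  rw [UpperHalfPlane.coe_specialLinearGroup_apply]
  simp [act, mob]

end PeriodHecke

/-! ### An interior gradient estimate by the maximum principle. -/

namespace PeriodHecke

open Complex Filter Topology InnerProductSpace
open UpperHalfPlane hiding I

/-- A positive second derivative at a critical point would give a local minimum as well, so `f`
would be locally constant and its second derivative zero. -/
theorem second_deriv_nonpos_of_isLocalMax {f f' : ℝ → ℝ} {a c : ℝ} (hmax : IsLocalMax f a)
    (h1 : ∀ᶠ x in 𝓝 a, HasDerivAt f (f' x) x) (h2 : HasDerivAt f' c a) : c ≤ 0 := by
  by_contra! hc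
  have hd : deriv f =ᶠ[𝓝 a] f' := by filter_upwards [h1] with x hx using hx.deriv
  have hdd : deriv (deriv f) a = c := by rw [hd.deriv_eq, h2.deriv]
  have hmin := isLocalMin_of_deriv_deriv_pos (by rw [hdd]; exact hc) hmax.deriv_eq_zero
    h1.self_of_nhds.continuousAt
  have heq : f =ᶠ[𝓝 a] fun _ => f a := by
    filter_upwards [hmin, hmax] with x hx hx' using le_antisymm hx' hx
  have h3 : deriv f =ᶠ[𝓝 a] fun _ => 0 := by
    filter_upwards [heq.eventuallyEq_nhds] with x hx
    rw [hx.deriv_eq, deriv_const]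
  rw [h3.deriv_eq, deriv_const] at hdd
  exact hc.ne hdd

theorem hasDerivAt_slice {h : ℂ → ℝ} {z : ℂ} (hh : ContDiffAt ℝ 2 h z) (e : ℂ) :
    (∀ᶠ s : ℝ in 𝓝 0, HasDerivAt (fun s : ℝ => h (z + s * e)) (fderiv ℝ h (z + s * e) e) s) ∧
    HasDerivAt (fun s : ℝ => fderiv ℝ h (z + s * e) e) (fderiv ℝ (fderiv ℝ h) z e e) 0 := by
  have hl : ∀ s : ℝ, HasDerivAt (fun s : ℝ => z + s * e) e s := fun s => by
    simpa using ((hasDerivAt_id s).ofReal_comp.mul_const e).const_add z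
  have h0 : z + ((0 : ℝ) : ℂ) * e = z := by simp
  constructor
  · have h1 : ∀ᶠ y in 𝓝 (z + ((0 : ℝ) : ℂ) * e), DifferentiableAt ℝ h y := by
      rw [h0]
      filter_upwards [hh.eventually (by simp)] with y hy using hy.differentiableAt (by norm_num)
    filter_upwards [(hl 0).continuousAt.eventually h1] with s hs
    exact hs.hasFDerivAt.comp_hasDerivAt s (hl s)
  · have h1 : DifferentiableAt ℝ (fderiv ℝ h) (z + ((0 : ℝ) : ℂ) * e) := by
      rw [h0]
      exact (hh.fderiv_right (m := 1) (by norm_num)).differentiableAt (by norm_num)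
    have h2 : HasDerivAt (fun s : ℝ => fderiv ℝ h (z + s * e))
        (fderiv ℝ (fderiv ℝ h) (z + ((0 : ℝ) : ℂ) * e) e) 0 :=
      HasFDerivAt.comp_hasDerivAt (0 : ℝ) h1.hasFDerivAt (hl 0)
    rw [h0] at h2
    simpa using h2.clm_apply (hasDerivAt_const (0 : ℝ) e)

/-- Interior gradient estimate at the centre of a disc, in the vertical direction. -/
theorem fderiv_I_le_of_laplacian {h : ℂ → ℝ} {d M N : ℝ} (hd : 0 < d)
    (hh : ∀ z : ℂ, ‖z‖ ≤ 2 * d → ContDiffAt ℝ 2 h z) (hM : ∀ z : ℂ, ‖z‖ ≤ 2 * d → |h z| ≤ M)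
    (hN : ∀ z : ℂ, ‖z‖ ≤ 2 * d → |Laplacian.laplacian h z| < N) :
    fderiv ℝ h 0 I ≤ 2 * M / d + N * d / 2 := by
  -- Barrier for the odd part of `h` in `y` on `[-d, d] × [0, d]`. Its first summand is harmonic and
  -- at least `M` on the three edges away from `y = 0`; the second is nonnegative with Laplacian
  -- `-N`. The slope of `ψ` at the origin in `y` is the claimed bound, so it suffices that `k ≤ 0`
  -- on the rectangle.
  set ψ : ℝ → ℝ → ℝ := fun x y => M / d ^ 2 * (x ^ 2 + y * (2 * d - y)) + N / 2 * (y * (d - y))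
    with hψ
  set k : ℝ × ℝ → ℝ := fun p =>
    1 / 2 * (h (p.1 + p.2 * I) - h (p.1 + -p.2 * I)) - ψ p.1 p.2 with hk
  have hM0 : 0 ≤ M := (abs_nonneg _).trans (hM 0 (by simp; positivity))
  have hN0 : 0 < N := (abs_nonneg _).trans_lt (hN 0 (by simp; positivity))
  have hnorm : ∀ x y : ℝ, |x| ≤ d → |y| ≤ d → ‖(x : ℂ) + y * I‖ ≤ 2 * d := by
    intro x y hx hy
    refine (norm_add_le _ _).trans ?_
    simp
    linarith
  have hnorm' : ∀ x y : ℝ, |x| ≤ d → |y| ≤ d → ‖(x : ℂ) + -y * I‖ ≤ 2 * d := by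
    intro x y hx hy
    have := hnorm x (-y) hx (by rwa [abs_neg])
    push_cast at this
    exact this
  have hkc : ContinuousOn k (Set.Icc (-d) d ×ˢ Set.Icc 0 d) := by
    have hc : ∀ z : ℂ, ‖z‖ ≤ 2 * d → ContinuousAt h z := fun z hz => (hh z hz).continuousAt
    intro p hp
    have h1 : |p.1| ≤ d := abs_le.2 hp.1
    have h2 : |p.2| ≤ d := abs_le.2 ⟨by linarith [hp.2.1], hp.2.2⟩
    refine ContinuousAt.continuousWithinAt ?_
    refine ContinuousAt.sub (ContinuousAt.mul continuousAt_const (ContinuousAt.sub ?_ ?_)) ?_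
    · exact (hc _ (hnorm _ _ h1 h2)).comp (f := fun p : ℝ × ℝ => (p.1 : ℂ) + p.2 * I) (by fun_prop)
    · exact (hc _ (hnorm' _ _ h1 h2)).comp (f := fun p : ℝ × ℝ => (p.1 : ℂ) + -p.2 * I)
        (by fun_prop)
    · simp only [hψ]; fun_prop
  obtain ⟨⟨x₀, y₀⟩, hp, hmax⟩ := (isCompact_Icc.prod isCompact_Icc).exists_isMaxOn
    ⟨(0, 0), ⟨by simp [hd.le], by simp [hd.le]⟩⟩ hkc
  obtain ⟨⟨hx1, hx2⟩, hy1, hy2⟩ := hp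
  dsimp only at hx1 hx2 hy1 hy2
  have hx : |x₀| ≤ d := abs_le.2 ⟨hx1, hx2⟩
  have hy : |y₀| ≤ d := abs_le.2 ⟨by linarith, hy2⟩
  have hle : ∀ p ∈ Set.Icc (-d) d ×ˢ Set.Icc 0 d, k p ≤ 0 := by
    intro p hp
    refine (hmax hp).trans ?_
    change k (x₀, y₀) ≤ 0
    have hdiff : 1 / 2 * (h (x₀ + y₀ * I) - h (x₀ + -y₀ * I)) ≤ M := by
      have a1 := abs_le.1 (hM _ (hnorm x₀ y₀ hx hy))
      have a2 := abs_le.1 (hM _ (hnorm' x₀ y₀ hx hy))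
      linarith [a1.2, a2.1]
    have hMd : M = M / d ^ 2 * d ^ 2 := by field_simp
    have hMd0 : 0 ≤ M / d ^ 2 := by positivity
    have hedge : d ^ 2 ≤ x₀ ^ 2 + y₀ * (2 * d - y₀) → k (x₀, y₀) ≤ 0 := by
      intro he
      have : 0 ≤ N / 2 * (y₀ * (d - y₀)) :=
        mul_nonneg (by positivity) (mul_nonneg hy1 (by linarith))
      have h2 := mul_le_mul_of_nonneg_left he hMd0
      simp only [hk, hψ]
      linarith
    rcases hy1.eq_or_lt with e | hy0
    · rw [← e]
      simp only [hk, hψ]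
      have : 0 ≤ M / d ^ 2 * x₀ ^ 2 := by positivity
      simp
      linarith
    rcases hy2.eq_or_lt with e | hyd
    · exact hedge (by rw [e]; nlinarith [sq_nonneg x₀])
    rcases hx1.eq_or_lt with e | hxl
    · exact hedge (by rw [← e]; nlinarith [mul_nonneg hy1 (by linarith : 0 ≤ 2 * d - y₀)])
    rcases hx2.eq_or_lt with e | hxr
    · exact hedge (by rw [e]; nlinarith [mul_nonneg hy1 (by linarith : 0 ≤ 2 * d - y₀)])
    -- At an interior maximum the second derivatives of `k` in both coordinate directions are
    -- nonpositive, but their sum is `(Δh(z) - Δh(z'))/2 + N > 0`, with `z'` the reflection of `z`.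
    exfalso
    set z := (x₀ : ℂ) + y₀ * I with hz
    set z' := (x₀ : ℂ) + -y₀ * I with hz'
    have c1 := hh z (hnorm x₀ y₀ hx hy)
    have c2 := hh z' (hnorm' x₀ y₀ hx hy)
    have hloc : IsLocalMax k (x₀, y₀) :=
      hmax.isLocalMax (prod_mem_nhds (Icc_mem_nhds hxl hxr) (Icc_mem_nhds hy0 hyd))
    -- One argument for both coordinate directions: `e'` is the reflection of `e`, and `c₁`, `c₂`
    -- are the Taylor coefficients of the quadratic `ψ` along the slice.
    have hslice : ∀ (e e' : ℂ) (a b c₁ c₂ : ℝ),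
        (∀ s : ℝ, k (x₀ + a * s, y₀ + b * s) = 1 / 2 * (h (z + s * e) - h (z' + s * e')) -
          (ψ x₀ y₀ + c₁ * s + c₂ / 2 * s ^ 2)) →
        1 / 2 * (fderiv ℝ (fderiv ℝ h) z e e - fderiv ℝ (fderiv ℝ h) z' e' e') - c₂ ≤ 0 := by
      intro e e' a b c₁ c₂ hs
      obtain ⟨d1, d2⟩ := hasDerivAt_slice c1 e
      obtain ⟨d3, d4⟩ := hasDerivAt_slice c2 e'
      have hq : ∀ s : ℝ, HasDerivAt (fun s => ψ x₀ y₀ + c₁ * s + c₂ / 2 * s ^ 2) (c₁ + c₂ * s) s := by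
        intro s
        refine ((((hasDerivAt_id s).const_mul c₁).const_add (ψ x₀ y₀)).add
          (((hasDerivAt_id s).pow 2).const_mul (c₂ / 2))).congr_deriv ?_
        simp; ring
      have hq2 : HasDerivAt (fun s => c₁ + c₂ * s) c₂ (0 : ℝ) := by
        simpa using ((hasDerivAt_id (0 : ℝ)).const_mul c₂).const_add c₁
      refine second_deriv_nonpos_of_isLocalMax (f := fun s : ℝ => k (x₀ + a * s, y₀ + b * s))
        (f' := fun s : ℝ => 1 / 2 * (fderiv ℝ h (z + s * e) e - fderiv ℝ h (z' + s * e') e') -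
          (c₁ + c₂ * s)) (a := 0) ?_ ?_ (((d2.sub d4).const_mul (1 / 2)).sub hq2)
      · have ht : Tendsto (fun s : ℝ => (x₀ + a * s, y₀ + b * s)) (𝓝 0) (𝓝 (x₀, y₀)) := by
          have : Continuous fun s : ℝ => (x₀ + a * s, y₀ + b * s) := by fun_prop
          simpa using this.tendsto 0
        have hl0 : ∀ᶠ p in 𝓝 (x₀, y₀), k p ≤ k (x₀, y₀) := hloc
        filter_upwards [ht.eventually hl0] with s hs
        simpa using hs
      · filter_upwards [d1, d3] with s e1 e3
        refine (((e1.sub e3).const_mul (1 / 2)).sub (hq s)).congr_of_eventuallyEq ?_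
        exact Eventually.of_forall hs
    have s1 := hslice 1 1 1 0 (M / d ^ 2 * (2 * x₀)) (2 * (M / d ^ 2)) (by
      intro s
      simp only [hk, hψ, hz, hz']
      push_cast
      ring_nf)
    have s2 := hslice I (-I) 0 1 (M / d ^ 2 * (2 * d - 2 * y₀) + N / 2 * (d - 2 * y₀))
      (-2 * (M / d ^ 2) - N) (by
      intro s
      simp only [hk, hψ, hz, hz']
      push_cast
      ring_nf)
    have l1 := abs_lt.1 (hN z (hnorm x₀ y₀ hx hy))
    have l2 := abs_lt.1 (hN z' (hnorm' x₀ y₀ hx hy))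
    rw [laplacian_apply_eq] at l1 l2
    simp only [map_neg, _root_.neg_apply, neg_neg] at s2
    linarith [l1.1, l2.2]
  have c0 := hh 0 (by simp; positivity)
  have h0 : HasDerivAt (fun s : ℝ => k (0, s)) (fderiv ℝ h 0 I - (2 * M / d + N * d / 2)) 0 := by
    have e1 := (hasDerivAt_slice c0 I).1.self_of_nhds
    have e2 := (hasDerivAt_slice c0 (-I)).1.self_of_nhds
    have e3 : HasDerivAt (fun s => ψ 0 s) (2 * M / d + N * d / 2) 0 := by
      have i := hasDerivAt_id (0 : ℝ)
      refine ((((i.mul (i.const_sub (2 * d))).const_add (0 ^ 2)).const_mul (M / d ^ 2)).add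
        ((i.mul (i.const_sub d)).const_mul (N / 2))).congr_deriv ?_
      simp
      field_simp
    refine ((((e1.sub e2).const_mul (1 / 2)).sub e3).congr_of_eventuallyEq
      (Eventually.of_forall fun s => ?_)).congr_deriv ?_
    · simp [hk]
    · simp; ring
  have ht := (hasDerivWithinAt_iff_tendsto_slope' (s := Set.Ioi 0) (by simp)).1
    h0.hasDerivWithinAt
  -- `k` vanishes at the origin and is nonpositive above it, so its one-sided slope there is
  -- nonpositive.
  have := le_of_tendsto ht (b := 0) (by
    filter_upwards [Ioc_mem_nhdsGT hd] with s hs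
    have h1 := hle (0, s) ⟨by simp [hd.le], hs.1.le, hs.2⟩
    have h2 : k (0, 0) = 0 := by simp [hk, hψ]
    rw [slope_def_field, h2, sub_zero, sub_zero]
    exact div_nonpos_of_nonpos_of_nonneg h1 hs.1.le)
  linarith

/-- Interior gradient estimate for functions with bounded Laplacian. -/
theorem norm_fderiv_le_of_laplacian {w : ℂ → ℂ} {z₀ : ℂ} {d M N : ℝ} (hd : 0 < d)
    (hw : ∀ z : ℂ, ‖z - z₀‖ ≤ 2 * d → ContDiffAt ℝ 2 w z)
    (hM : ∀ z : ℂ, ‖z - z₀‖ ≤ 2 * d → ‖w z‖ ≤ M)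
    (hN : ∀ z : ℂ, ‖z - z₀‖ ≤ 2 * d → ‖Laplacian.laplacian w z‖ < N) :
    ‖fderiv ℝ w z₀‖ ≤ 2 * M / d + N * d / 2 := by
  have hM0 : 0 ≤ M := (norm_nonneg _).trans (hM z₀ (by simp; positivity))
  have hN0 : 0 < N := (norm_nonneg _).trans_lt (hN z₀ (by simp; positivity))
  refine ContinuousLinearMap.opNorm_le_of_unit_norm (by positivity) fun a ha => ?_
  -- Reduction to a real function and the vertical direction: the unimodular `c` rotates the value
  -- of the derivative at `a` onto the positive reals, and `e = -I * a` rotates the plane so that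
  -- `I` goes to `a`. Neither rotation changes the bounds.
  obtain ⟨c, hc, hcv⟩ : ∃ c : ℂ, ‖c‖ = 1 ∧ c * fderiv ℝ w z₀ a = ‖fderiv ℝ w z₀ a‖ := by
    set v := fderiv ℝ w z₀ a
    rcases eq_or_ne v 0 with h | h
    · exact ⟨1, by simp, by simp [h]⟩
    · have hv : (‖v‖ : ℂ) ≠ 0 := by simpa using h
      refine ⟨‖v‖ / v, by simp [h], by field_simp⟩
  set e := -I * a with he
  have hen : ‖e‖ = 1 := by simp [he, ha]
  set g : ℂ → ℂ := fun z => z₀ + e * z with hg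
  have hgd : ∀ z, HasDerivAt g e z := fun z =>
    (((hasDerivAt_id z).const_mul e).const_add z₀).congr_deriv (mul_one e)
  have hga : ∀ z, AnalyticAt ℂ g z := fun z => by fun_prop
  have hgn : ∀ z : ℂ, ‖z‖ ≤ 2 * d → ‖g z - z₀‖ ≤ 2 * d := by
    intro z hz
    simpa [hg, hen] using hz
  set l : ℂ →L[ℝ] ℝ := reCLM.comp (ContinuousLinearMap.mul ℝ ℂ c) with hl
  have hl1 : ∀ v, |l v| ≤ ‖v‖ := fun v => by
    refine (abs_re_le_norm _).trans ?_
    simp [hc]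
  have hwg : ∀ z : ℂ, ‖z‖ ≤ 2 * d → ContDiffAt ℝ 2 (w ∘ g) z := fun z hz =>
    (hw _ (hgn z hz)).comp z ((hga z).restrictScalars (𝕜 := ℝ)).contDiffAt
  have key := fderiv_I_le_of_laplacian (h := l ∘ (w ∘ g)) (M := M) (N := N) hd
    (fun z hz => l.contDiff.contDiffAt.comp z (hwg z hz))
    (fun z hz => (hl1 _).trans (hM _ (hgn z hz))) (fun z hz => by
      rw [(hwg z hz).laplacian_CLM_comp_left, Function.comp_apply,
        laplacian_comp_analyticAt (hw _ (hgn z hz)) (hga z), (hgd z).deriv, hen]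
      refine (hl1 _).trans_lt ?_
      simpa using hN _ (hgn z hz))
  have h0 : ‖(0 : ℂ)‖ ≤ 2 * d := by simp; positivity
  have hdw := (hw _ (hgn 0 h0)).differentiableAt (by norm_num)
  have e1 : fderiv ℝ (l ∘ (w ∘ g)) 0 I = l (fderiv ℝ (w ∘ g) 0 I) := by
    rw [(l.hasFDerivAt.comp (0 : ℂ)
      ((hwg 0 h0).differentiableAt (by norm_num)).hasFDerivAt).fderiv]
    rfl
  rw [e1, fderiv_comp_analyticAt hdw (hgd 0).differentiableAt, (hgd 0).deriv] at key
  have e2 : e * I = a := by rw [he]; linear_combination -a * I_mul_I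
  have e3 : g 0 = z₀ := by simp [hg]
  rw [e2, e3] at key
  have e4 : l (fderiv ℝ w z₀ a) = ‖fderiv ℝ w z₀ a‖ := by
    simp [hl, hcv]
  rwa [e4] at key

end PeriodHecke

/-! ### Cuspidal eigenfunctions and limits of primitives at the cusps. -/

namespace PeriodHecke

open Complex Filter Topology InnerProductSpace
open UpperHalfPlane hiding I

/-- Real analytic eigenfunctions of the hyperbolic Laplacian that decay rapidly at all cusps. -/
structure CuspEigen (β : ℂ) (w : ℂ → ℂ) : Prop where
  analytic : AnalyticOnNhd ℝ w {z | 0 < z.im}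
  eigen : ∀ z : ℂ, 0 < z.im → -(z.im : ℂ) ^ 2 * Laplacian.laplacian w z = β * (1 - β) * w z
  decay : ∀ M : Matrix (Fin 2) (Fin 2) ℤ, 0 < M.det → ∀ k : ℕ, ∃ K Y : ℝ, 0 < Y ∧
    ∀ z : ℂ, Y ≤ z.im → ‖w (act M z)‖ * z.im ^ k ≤ K

namespace CuspEigen

variable {β : ℂ} {w : ℂ → ℂ}

theorem isEigen (h : CuspEigen β w) : IsEigen β w := fun z hz =>
  ⟨(h.analytic z hz).contDiffAt, h.eigen z hz⟩

theorem congr {w' : ℂ → ℂ} (h : CuspEigen β w) (hw : ∀ z : ℂ, 0 < z.im → w' z = w z) :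
    CuspEigen β w' := by
  have hev : ∀ z : ℂ, 0 < z.im → w' =ᶠ[𝓝 z] w := fun z hz => by
    filter_upwards [isOpen_upperHalfPlaneSet.mem_nhds hz] with y hy using hw y hy
  refine ⟨fun z hz => (h.analytic z hz).congr (hev z hz).symm, fun z hz => ?_, fun M hM k => ?_⟩
  · rw [(laplacian_congr_nhds (hev z hz)).eq_of_nhds, hw z hz, h.eigen z hz]
  · obtain ⟨K, Y, hY, hK⟩ := h.decay M hM k
    refine ⟨K, Y, hY, fun z hz => ?_⟩
    rw [hw _ (act_im_pos hM (hY.trans_le hz))]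
    exact hK z hz

/-- Decay is demanded along all integer matrices of positive determinant, not only along `SL(2, ℤ)`,
exactly so that the class is stable under this operation, in particular under `B_m`. -/
theorem comp_act (h : CuspEigen β w) {M : Matrix (Fin 2) (Fin 2) ℤ} (hM : 0 < M.det) :
    CuspEigen β (w ∘ act M) := by
  have hd := det_cast_pos hM
  refine ⟨fun z hz => ?_, fun z hz => ((h.isEigen.comp_mob hd) z hz).2, fun N hN k => ?_⟩
  · exact (h.analytic _ (mob_im_pos hd hz)).comp
      ((mob_analyticAt hd hz).restrictScalars (𝕜 := ℝ))
  · obtain ⟨K, Y, hY, hK⟩ := h.decay (M * N) (by rw [Matrix.det_mul]; positivity) k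
    refine ⟨K, Y, hY, fun z hz => ?_⟩
    rw [Function.comp_apply, ← act_mul hN (hY.trans_le hz)]
    exact hK z hz

theorem zero : CuspEigen β (fun _ => 0) := by
  refine ⟨fun _ _ => analyticAt_const, fun z _ => ?_, fun M _ k => ⟨0, 1, one_pos, by simp⟩⟩
  rw [laplacian_const]; simp

theorem add {w' : ℂ → ℂ} (h : CuspEigen β w) (h' : CuspEigen β w') :
    CuspEigen β (fun z => w z + w' z) := by
  refine ⟨fun z hz => (h.analytic z hz).add (h'.analytic z hz), fun z hz => ?_, fun M hM k => ?_⟩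
  · have := ContDiffAt.laplacian_add (h.isEigen z hz).1 (h'.isEigen z hz).1
    change Laplacian.laplacian (fun z => w z + w' z) z = _ at this
    rw [this]
    linear_combination h.eigen z hz + h'.eigen z hz
  · obtain ⟨K, Y, hY, hK⟩ := h.decay M hM k
    obtain ⟨K', Y', hY', hK'⟩ := h'.decay M hM k
    refine ⟨K + K', max Y Y', lt_max_of_lt_left hY, fun z hz => ?_⟩
    have h1 := hK z ((le_max_left _ _).trans hz)
    have h2 := hK' z ((le_max_right _ _).trans hz)
    have : 0 < z.im := hY.trans_le ((le_max_left _ _).trans hz)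
    calc _ ≤ (‖w (act M z)‖ + ‖w' (act M z)‖) * z.im ^ k := by gcongr; exact norm_add_le _ _
      _ ≤ _ := by rw [add_mul]; exact add_le_add h1 h2

theorem sum {ι : Type*} (s : Finset ι) {f : ι → ℂ → ℂ} (h : ∀ i ∈ s, CuspEigen β (f i)) :
    CuspEigen β (fun z => ∑ i ∈ s, f i z) := by
  classical
  induction s using Finset.induction_on with
  | empty => simpa using zero
  | insert i s hi ih =>
    simp_rw [Finset.sum_insert hi]
    exact (h i (by simp)).add (ih fun j hj => h j (by simp [hj]))

/-- The eigenvalue equation bounds `Δw` by a multiple of `y⁻² ‖w‖`, so the interior gradient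
estimate on the disc of radius `y / 2` transfers the decay of `w` to its derivative. -/
theorem decay_fderiv (h : CuspEigen β w) (k : ℕ) : ∃ K Y : ℝ, 0 < Y ∧
    ∀ z : ℂ, Y ≤ z.im → ‖w z‖ * z.im ^ k ≤ K ∧ ‖fderiv ℝ w z‖ * z.im ^ k ≤ K := by
  obtain ⟨K, Y, hY, hK⟩ := h.decay 1 (by simp) k
  have hK1 : ∀ z : ℂ, Y ≤ z.im → ‖w z‖ * z.im ^ k ≤ K := by
    intro z hz
    have := hK z hz
    rwa [← one_smul ℤ (1 : Matrix (Fin 2) (Fin 2) ℤ), act_scalar one_ne_zero] at this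
  have hK0 : 0 ≤ K := le_trans (mul_nonneg (norm_nonneg _) (pow_nonneg (by simp [hY.le]) _))
    (hK1 (Y * I) (by simp))
  set L := ‖β * (1 - β)‖ with hL
  have hL0 : 0 ≤ L := norm_nonneg _
  -- `2 ^ k` pays for heights dropping to `y / 2` inside the disc; `8 + (L + 1) / 2` is what the
  -- gradient estimate gives for `d = y / 4`. The additions of `1` make the quantities positive and
  -- the Laplacian bound strict.
  set C := (K + 1) * 2 ^ k * (8 + (L + 1) / 2) with hC
  have hCK : K ≤ C := by
    have : (1 : ℝ) ≤ 2 ^ k := one_le_pow₀ (by norm_num)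
    have h8 : 1 ≤ 8 + (L + 1) / 2 := by linarith
    calc K ≤ (K + 1) * 1 * 1 := by linarith
      _ ≤ C := by rw [hC]; gcongr
  refine ⟨C, max 1 (2 * Y), by positivity, fun z₀ hz₀ => ⟨(hK1 z₀ ?_).trans hCK, ?_⟩⟩
  · linarith [(le_max_right 1 (2 * Y)).trans hz₀]
  set y := z₀.im with hy
  have hy1 : 1 ≤ y := (le_max_left _ _).trans hz₀
  have hy2 : 2 * Y ≤ y := (le_max_right _ _).trans hz₀
  have hy0 : 0 < y := by linarith
  set A := (K + 1) * 2 ^ k / y ^ k with hA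
  have hA0 : 0 < A := by positivity
  have him : ∀ z : ℂ, ‖z - z₀‖ ≤ 2 * (y / 4) → y / 2 ≤ z.im := by
    intro z hz
    have := (abs_im_le_norm (z - z₀)).trans hz
    rw [sub_im] at this
    linarith [(abs_le.1 this).1]
  have hw : ∀ z : ℂ, ‖z - z₀‖ ≤ 2 * (y / 4) → ‖w z‖ ≤ A := by
    intro z hz
    have h1 := him z hz
    have h2 := hK1 z (by linarith)
    have h3 : (y / 2) ^ k ≤ z.im ^ k := by gcongr
    rw [hA, le_div_iff₀ (by positivity)]
    have h4 : y ^ k = (y / 2) ^ k * 2 ^ k := by rw [← mul_pow]; congr 1; ring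
    rw [h4, ← mul_assoc]
    gcongr
    calc _ ≤ ‖w z‖ * z.im ^ k := by gcongr
      _ ≤ K + 1 := by linarith
  have key := norm_fderiv_le_of_laplacian (w := w) (z₀ := z₀) (d := y / 4) (M := A)
    (N := (L + 1) * (4 / y ^ 2) * A) (by positivity)
    (fun z hz => (h.isEigen z (by linarith [him z hz])).1) hw (fun z hz => by
      have h1 := him z hz
      have h0 : 0 < z.im := by linarith
      rw [h.isEigen.laplacian_eq h0, norm_mul, norm_div, norm_neg, ← hL, norm_pow, norm_real,
        Real.norm_of_nonneg h0.le]
      have h2 : L / z.im ^ 2 ≤ L * (4 / y ^ 2) := by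
        rw [div_eq_mul_inv]
        refine mul_le_mul_of_nonneg_left ?_ hL0
        rw [inv_le_comm₀ (by positivity) (by positivity), inv_div]
        nlinarith
      have h3 : L / z.im ^ 2 * ‖w z‖ ≤ L * (4 / y ^ 2) * A :=
        mul_le_mul h2 (hw z hz) (norm_nonneg _) (by positivity)
      have h4 : 0 < 4 / y ^ 2 * A := by positivity
      linarith)
  have h5 : 2 * A / (y / 4) + (L + 1) * (4 / y ^ 2) * A * (y / 4) / 2 =
      A * (8 + (L + 1) / 2) / y := by
    field_simp; ring
  rw [h5] at key
  have h6 : A * (8 + (L + 1) / 2) / y ≤ A * (8 + (L + 1) / 2) := div_le_self (by positivity) hy1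
  calc _ ≤ A * (8 + (L + 1) / 2) * y ^ k := by gcongr; exact key.trans h6
    _ = C := by rw [hA, hC]; field_simp

end CuspEigen

theorem rpow_le_pow_of_inv_le {Q T σ : ℝ} {m : ℕ} (hT : 1 ≤ T) (h1 : T⁻¹ ≤ Q) (h2 : Q ≤ T)
    (hm : |σ| ≤ m) : Q ^ σ ≤ T ^ m := by
  have hT0 : 0 < T := by linarith
  have hQ : 0 < Q := (inv_pos.2 hT0).trans_le h1
  rw [← Real.rpow_natCast]
  rcases le_total 0 σ with hσ | hσ
  · calc Q ^ σ ≤ T ^ σ := by gcongr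
      _ ≤ _ := Real.rpow_le_rpow_of_exponent_le hT ((le_abs_self _).trans hm)
  · calc Q ^ σ = (Q⁻¹) ^ (-σ) := by rw [Real.inv_rpow hQ.le, Real.rpow_neg hQ.le, inv_inv]
      _ ≤ T ^ (-σ) := by
        refine Real.rpow_le_rpow (by positivity) ?_ (by linarith)
        rwa [inv_le_comm₀ hQ hT0]
      _ ≤ _ := Real.rpow_le_rpow_of_exponent_le hT ((neg_le_abs _).trans hm)

/-- In the cone `δ ‖z‖ ≤ y` with `y ≥ 1`, `|pz + q|²` lies between a positive constant and a
multiple of `y²`. So `y / |pz + q|²` lies between `(T y)⁻¹` and `T y`, and its powers grow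
polynomially whatever the sign of `Re β`. -/
theorem norm_horo_le_pow {p q δ : ℝ} (h : p ≠ 0 ∨ q ≠ 0) (hδ : 0 < δ) (β : ℂ) :
    ∃ (K : ℝ) (m : ℕ), 0 ≤ K ∧ ∀ z : ℂ, 1 ≤ z.im → δ * ‖z‖ ≤ z.im →
      ‖horo β p q z‖ ≤ K * z.im ^ m := by
  obtain ⟨c, hc, hc'⟩ : ∃ c : ℝ, 0 < c ∧ ∀ z : ℂ, 1 ≤ z.im → c ≤ normSq (p * z + q) := by
    rcases eq_or_ne p 0 with hp | hp
    · have hq : q ≠ 0 := by simpa [hp] using h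
      refine ⟨q ^ 2, by positivity, fun z _ => ?_⟩
      simp [hp, normSq_apply, sq]
    · refine ⟨p ^ 2, by positivity, fun z hz => ?_⟩
      have h1 : (1 : ℝ) ≤ z.im ^ 2 := one_le_pow₀ hz
      rw [normSq_apply]
      simp
      nlinarith [mul_self_nonneg (p * z.re + q), sq_nonneg p,
        mul_nonneg (sq_nonneg p) (sub_nonneg.2 h1)]
  set B := (|p| / δ + |q|) ^ 2 with hB
  set T := max 1 (max c⁻¹ B) with hT
  have hT1 : 1 ≤ T := le_max_left _ _
  have hTc : c⁻¹ ≤ T := (le_max_left _ _).trans (le_max_right _ _)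
  have hTB : B ≤ T := (le_max_right _ _).trans (le_max_right _ _)
  obtain ⟨m, hm⟩ := exists_nat_ge |β.re|
  refine ⟨T ^ m, m, by positivity, fun z hz1 hz2 => ?_⟩
  have hz0 : 0 < z.im := by linarith
  have hn := normSq_pos.2 (mob_denom_ne_zero h hz0)
  rw [norm_horo h β hz0, ← mul_pow]
  refine rpow_le_pow_of_inv_le (by nlinarith) ?_ ?_ hm
  · have h1 : normSq (p * z + q) ≤ B * z.im ^ 2 := by
      rw [normSq_eq_norm_sq, hB, ← mul_pow]
      gcongr
      calc ‖(p : ℂ) * z + q‖ ≤ |p| * ‖z‖ + |q| := by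
            refine (norm_add_le _ _).trans ?_
            simp
        _ ≤ |p| * (z.im / δ) + |q| * z.im := by
            gcongr
            · rw [le_div_iff₀ hδ]; linarith
            · exact le_mul_of_one_le_right (abs_nonneg q) hz1
        _ = _ := by ring
    rw [inv_le_comm₀ (by positivity) (by positivity), inv_div, div_le_iff₀ hz0]
    nlinarith [mul_le_mul_of_nonneg_right hTB (sq_nonneg z.im)]
  · rw [div_eq_mul_inv, mul_comm]
    gcongr
    exact (inv_anti₀ hc (hc' z hz1)).trans hTc

/-- Rapid decay of `w` and its gradient absorbs the polynomial growth of `horo`. The exponent `2`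
gives integrability towards `i∞` and beats the linear growth of the distance between two lines. -/
theorem norm_etaForm_horo_le {β : ℂ} {w : ℂ → ℂ} (hw : CuspEigen β w) {p q δ : ℝ}
    (h : p ≠ 0 ∨ q ≠ 0) (hδ : 0 < δ) : ∃ K Y : ℝ, 0 ≤ K ∧ 1 ≤ Y ∧ ∀ z : ℂ, Y ≤ z.im →
      δ * ‖z‖ ≤ z.im → ‖etaForm w (horo β p q) z‖ ≤ K / z.im ^ 2 := by
  obtain ⟨H, m, hH, hH'⟩ := norm_horo_le_pow h hδ β
  obtain ⟨K, Y, hY, hK⟩ := hw.decay_fderiv (m + 2)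
  have hK0 : 0 ≤ K := le_trans (mul_nonneg (norm_nonneg _) (pow_nonneg (by simp [hY.le]) _))
    (hK (Y * I) (by simp)).1
  refine ⟨H * K * (1 + ‖β‖), max 1 Y, by positivity, le_max_left _ _, fun z hz hz2 => ?_⟩
  have hz1 : 1 ≤ z.im := (le_max_left _ _).trans hz
  have hz0 : 0 < z.im := by linarith
  obtain ⟨h1, h2⟩ := hK z ((le_max_right _ _).trans hz)
  have h3 := hH' z hz1 hz2
  have h4 := norm_fderiv_horo_le h β hz0
  have h5 : ‖fderiv ℝ (horo β p q) z‖ ≤ ‖β‖ * ‖horo β p q z‖ :=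
    (le_mul_of_one_le_right (norm_nonneg _) hz1).trans h4
  rw [le_div_iff₀ (by positivity)]
  calc ‖etaForm w (horo β p q) z‖ * z.im ^ 2
      ≤ (‖horo β p q z‖ * ‖fderiv ℝ w z‖ + ‖w z‖ * ‖fderiv ℝ (horo β p q) z‖) * z.im ^ 2 := by
        gcongr; exact norm_etaForm_le _ _ _
    _ ≤ ((H * z.im ^ m) * ‖fderiv ℝ w z‖ + ‖w z‖ * (‖β‖ * (H * z.im ^ m))) * z.im ^ 2 := by
        gcongr
        exact h5.trans (by gcongr)
    _ = H * (‖fderiv ℝ w z‖ * z.im ^ (m + 2)) + H * ‖β‖ * (‖w z‖ * z.im ^ (m + 2)) := by ring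
    _ ≤ H * K + H * ‖β‖ * K := by gcongr
    _ = _ := by ring

/-- Along any two lines going up into the half plane, a primitive of `η(w, R^β)` behaves alike. -/
theorem tendsto_primitive_sub {β : ℂ} {w : ℂ → ℂ} (hw : CuspEigen β w) {p q : ℝ}
    (h : p ≠ 0 ∨ q ≠ 0) {κ : ℂ} {Φ : ℂ → ℂ}
    (hΦ : ∀ z : ℂ, 0 < z.im → HasFDerivAt Φ (κ • etaForm w (horo β p q) z) z) {e₁ e₂ : ℂ}
    (c₁ c₂ : ℂ) (he₁ : 0 < e₁.im) (he₂ : 0 < e₂.im) :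
    Tendsto (fun t : ℝ => Φ (t * e₁ + c₁) - Φ (t * e₂ + c₂)) atTop (𝓝 0) := by
  -- Every line with upward direction eventually stays in a cone, where `η` is controlled. Half the
  -- slope `e.im` is sacrificed to absorb `c`.
  have hline : ∀ e c : ℂ, 0 < e.im → ∃ δ > 0, ∀ᶠ t : ℝ in atTop, 0 < t ∧
      t * (e.im / 2) ≤ (t * e + c).im ∧ δ * ‖t * e + c‖ ≤ (t * e + c).im := by
    intro e c he
    have hs : 0 < ‖e‖ + ‖c‖ := by
      have : e ≠ 0 := by rintro rfl; simp at he
      positivity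
    refine ⟨e.im / 2 / (‖e‖ + ‖c‖), by positivity, ?_⟩
    filter_upwards [eventually_ge_atTop (max 1 (2 * ‖c‖ / e.im))] with t ht
    have ht1 : 1 ≤ t := (le_max_left _ _).trans ht
    have ht2 : 2 * ‖c‖ / e.im ≤ t := (le_max_right _ _).trans ht
    rw [div_le_iff₀ he] at ht2
    have h1 : t * (e.im / 2) ≤ (t * e + c).im := by
      simp
      linarith [neg_abs_le c.im, abs_im_le_norm c]
    refine ⟨by linarith, h1, le_trans ?_ h1⟩
    have h2 : ‖t * e + c‖ ≤ t * (‖e‖ + ‖c‖) := by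
      refine (norm_add_le _ _).trans ?_
      rw [norm_mul, norm_real, Real.norm_of_nonneg (by linarith)]
      nlinarith [norm_nonneg c]
    calc _ ≤ e.im / 2 / (‖e‖ + ‖c‖) * (t * (‖e‖ + ‖c‖)) := by gcongr
      _ = _ := by field_simp
  obtain ⟨δ₁, hδ₁, hl₁⟩ := hline e₁ c₁ he₁
  obtain ⟨δ₂, hδ₂, hl₂⟩ := hline e₂ c₂ he₂
  set δ := min δ₁ δ₂ with hδ
  have hδ0 : 0 < δ := lt_min hδ₁ hδ₂
  obtain ⟨K, Y, hK, hY, hb⟩ := norm_etaForm_horo_le hw h hδ0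
  set μ := min (e₁.im / 2) (e₂.im / 2) with hμ
  have hμ0 : 0 < μ := lt_min (by linarith) (by linarith)
  set D := ‖e₁ - e₂‖ + ‖c₁ - c₂‖ with hD
  refine squeeze_zero_norm' (a := fun t => ‖κ‖ * K * D / μ ^ 2 * t⁻¹) ?_ (by
    simpa using tendsto_inv_atTop_zero.const_mul (‖κ‖ * K * D / μ ^ 2))
  filter_upwards [hl₁, hl₂, eventually_ge_atTop (max 1 (Y / μ))] with t ⟨_, h1, h1'⟩ ⟨_, h2, h2'⟩ ht
  have ht1 : 1 ≤ t := (le_max_left _ _).trans ht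
  have ht0 : 0 < t := by linarith
  have ht2 : Y ≤ t * μ := by
    rw [← div_le_iff₀ hμ0]; exact (le_max_right _ _).trans ht
  -- Mean value inequality on a convex set containing both points: the derivative is `O(t⁻²)` there,
  -- while the points are `O(t)` apart.
  set s : Set ℂ := {z | t * μ ≤ z.im ∧ δ * ‖z‖ ≤ z.im} with hs
  have hconv : Convex ℝ s := by
    have hc1 : Convex ℝ {z : ℂ | t * μ ≤ z.im} := convex_halfSpace_im_ge _
    have hc2 : Convex ℝ {z : ℂ | δ * ‖z‖ ≤ z.im} := by
      intro x hx y hy a b ha hb _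
      simp only [Set.mem_ofPred_eq] at hx hy ⊢
      calc δ * ‖a • x + b • y‖ ≤ δ * (a * ‖x‖ + b * ‖y‖) := by
            gcongr
            refine (norm_add_le _ _).trans ?_
            rw [norm_smul, norm_smul, Real.norm_of_nonneg ha, Real.norm_of_nonneg hb]
        _ = a * (δ * ‖x‖) + b * (δ * ‖y‖) := by ring
        _ ≤ a * x.im + b * y.im := by gcongr
        _ = _ := by simp
    exact hc1.inter hc2
  have hbd : ∀ z ∈ s, ‖κ • etaForm w (horo β p q) z‖ ≤ ‖κ‖ * (K / (t * μ) ^ 2) := by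
    rintro z ⟨hz1, hz2⟩
    rw [norm_smul]
    have h3 := hb z (ht2.trans hz1) hz2
    have : 0 < t * μ := by positivity
    calc _ ≤ ‖κ‖ * (K / z.im ^ 2) := by gcongr
      _ ≤ _ := by gcongr
  have m1 : t * e₁ + c₁ ∈ s := by
    refine ⟨le_trans ?_ h1, le_trans ?_ h1'⟩
    · gcongr; exact min_le_left _ _
    · gcongr; exact min_le_left _ _
  have m2 : t * e₂ + c₂ ∈ s := by
    refine ⟨le_trans ?_ h2, le_trans ?_ h2'⟩
    · gcongr; exact min_le_right _ _
    · gcongr; exact min_le_right _ _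
  have key := hconv.norm_image_sub_le_of_norm_hasFDerivWithin_le (f := Φ)
    (fun z hz => (hΦ z (lt_of_lt_of_le (by positivity) hz.1)).hasFDerivWithinAt) hbd m2 m1
  refine key.trans ?_
  have hdist : ‖t * e₁ + c₁ - (t * e₂ + c₂)‖ ≤ t * D := by
    have e : t * e₁ + c₁ - (t * e₂ + c₂) = t * (e₁ - e₂) + (c₁ - c₂) := by ring
    rw [e]
    refine (norm_add_le _ _).trans ?_
    rw [norm_mul, norm_real, Real.norm_of_nonneg ht0.le]
    nlinarith [norm_nonneg (c₁ - c₂)]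
  calc _ ≤ ‖κ‖ * (K / (t * μ) ^ 2) * (t * D) := by gcongr
    _ = _ := by field_simp

/-- On the imaginary axis the limit exists because the derivative is integrable; comparison with
that axis gives the same limit on all other lines. -/
theorem tendsto_primitive {β : ℂ} {w : ℂ → ℂ} (hw : CuspEigen β w) {p q : ℝ}
    (h : p ≠ 0 ∨ q ≠ 0) {κ : ℂ} {Φ : ℂ → ℂ}
    (hΦ : ∀ z : ℂ, 0 < z.im → HasFDerivAt Φ (κ • etaForm w (horo β p q) z) z) :
    ∃ l : ℂ, ∀ e c : ℂ, 0 < e.im → Tendsto (fun t : ℝ => Φ (t * e + c)) atTop (𝓝 l) := by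
  obtain ⟨K, Y, hK, hY, hb⟩ := norm_etaForm_horo_le hw h one_pos
  have hd : ∀ t ∈ Set.Ioi Y, HasDerivAt (fun t : ℝ => Φ (t * I))
      (κ * etaForm w (horo β p q) (t * I) I) t := by
    intro t ht
    have ht : Y < t := ht
    have h1 : HasDerivAt (fun t : ℝ => (t : ℂ) * I) I t := by
      simpa using (hasDerivAt_id t).ofReal_comp.mul_const I
    exact (hΦ (t * I) (by simp; linarith)).comp_hasDerivAt t h1
  have hcont : ContinuousOn (fun t : ℝ => κ * etaForm w (horo β p q) (t * I) I) (Set.Ioi Y) := by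
    intro t ht
    have ht : Y < t := ht
    have h1 := (fderiv_etaForm_symm hw.isEigen (isEigen_horo h β) (z := t * I)
      (by simp; linarith)).1.continuousAt
    refine (continuousAt_const.mul ((ContinuousAt.comp (f := fun t : ℝ => (t : ℂ) * I) h1
      (by fun_prop)).clm_apply continuousAt_const)).continuousWithinAt
  have hint : MeasureTheory.IntegrableOn
      (fun t : ℝ => κ * etaForm w (horo β p q) (t * I) I) (Set.Ioi Y) := by
    refine MeasureTheory.Integrable.mono' (g := fun t : ℝ => ‖κ‖ * K * t ^ (-2 : ℝ))
      ((integrableOn_Ioi_rpow_of_lt (by norm_num) (by linarith)).const_mul _)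
      (hcont.aestronglyMeasurable measurableSet_Ioi) ?_
    filter_upwards [MeasureTheory.ae_restrict_mem measurableSet_Ioi] with t ht
    have ht : Y < t := ht
    have h1 := hb (t * I) (by simp; linarith) (by simp [abs_of_pos (by linarith : 0 < t)])
    have h2 : ‖etaForm w (horo β p q) (t * I) I‖ ≤ K / t ^ 2 := by
      refine (ContinuousLinearMap.le_opNorm _ _).trans ?_
      simpa using h1
    rw [norm_mul, mul_assoc, Real.rpow_neg (by linarith), Real.rpow_two]
    gcongr
    exact h2
  have hl := MeasureTheory.tendsto_limUnder_of_hasDerivAt_of_integrableOn_Ioi hd hint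
  refine ⟨limUnder atTop fun t : ℝ => Φ (t * I), fun e c he => ?_⟩
  have := (tendsto_primitive_sub hw h hΦ c 0 he (e₂ := I) (by simp)).add hl
  simpa using this

theorem row_ne_zero {N : Matrix (Fin 2) (Fin 2) ℤ} (hN : 0 < N.det) {p q : ℝ} (h : p ≠ 0 ∨ q ≠ 0) :
    p * N 0 0 + q * N 1 0 ≠ 0 ∨ p * N 0 1 + q * N 1 1 ≠ 0 := by
  have hd := det_cast_pos hN
  by_contra! h0
  obtain ⟨h1, h2⟩ := h0
  have e1 : p * ((N 0 0 : ℝ) * N 1 1 - N 0 1 * N 1 0) = 0 := by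
    linear_combination (N 1 1 : ℝ) * h1 - (N 1 0 : ℝ) * h2
  have e2 : q * ((N 0 0 : ℝ) * N 1 1 - N 0 1 * N 1 0) = 0 := by
    linear_combination (N 0 0 : ℝ) * h2 - (N 0 1 : ℝ) * h1
  rcases h with h | h
  · exact h ((mul_eq_zero.1 e1).resolve_right hd.ne')
  · exact h ((mul_eq_zero.1 e2).resolve_right hd.ne')

theorem etaForm_comp_act {β : ℂ} {w : ℂ → ℂ} (hw : IsEigen β w) {p q : ℝ} (h : p ≠ 0 ∨ q ≠ 0)
    {N : Matrix (Fin 2) (Fin 2) ℤ} (hN : 0 < N.det) {z : ℂ} (hz : 0 < z.im) (a : ℂ) :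
    etaForm w (horo β p q) (act N z) (deriv (act N) z * a) = (((N.det : ℝ) : ℂ) ^ β •
      etaForm (w ∘ act N) (horo β (p * N 0 0 + q * N 1 0) (p * N 0 1 + q * N 1 1)) z) a := by
  have hd := det_cast_pos hN
  have hz' := act_im_pos hN hz
  rw [← etaForm_const_mul_right _ _ _ ((isEigen_horo (row_ne_zero hN h) β).differentiableAt hz),
    ← etaForm_comp (hw.differentiableAt hz') ((isEigen_horo h β).differentiableAt hz')
      (mob_analyticAt hd hz).differentiableAt]
  congr 1
  refine etaForm_congr EventuallyEq.rfl ?_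
  filter_upwards [isOpen_upperHalfPlaneSet.mem_nhds hz] with y hy
  rw [Function.comp_apply, act, horo_mob hd β p q hy, det_cast]

theorem hasFDerivAt_primitive_comp_act {β : ℂ} {w : ℂ → ℂ} (hw : IsEigen β w) {p q : ℝ}
    (h : p ≠ 0 ∨ q ≠ 0) {Φ : ℂ → ℂ}
    (hΦ : ∀ z : ℂ, 0 < z.im → HasFDerivAt Φ (etaForm w (horo β p q) z) z)
    {N : Matrix (Fin 2) (Fin 2) ℤ} (hN : 0 < N.det) {z : ℂ} (hz : 0 < z.im) :
    HasFDerivAt (Φ ∘ act N) (((N.det : ℝ) : ℂ) ^ β •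
      etaForm (w ∘ act N) (horo β (p * N 0 0 + q * N 1 0) (p * N 0 1 + q * N 1 1)) z) z := by
  have h1 : HasFDerivAt (act N) ((fderiv ℂ (act N) z).restrictScalars ℝ) z :=
    (mob_analyticAt (det_cast_pos hN) hz).differentiableAt.hasFDerivAt.restrictScalars ℝ
  refine ((hΦ _ (act_im_pos hN hz)).comp z h1).congr_fderiv ?_
  ext a
  rw [← etaForm_comp_act hw h hN hz, ContinuousLinearMap.comp_apply,
    ContinuousLinearMap.coe_restrictScalars', fderiv_eq_smul_deriv, smul_eq_mul, mul_comm]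

/-- `Φ ∘ act N` is again a primitive of a form of the same kind, for `w ∘ act N`, so the limit at
`∞` applies to it. `L N` is the value of `Φ` at the cusp `N∞`. -/
theorem exists_cuspLimit {β : ℂ} {w : ℂ → ℂ} (hw : CuspEigen β w) {p q : ℝ}
    (h : p ≠ 0 ∨ q ≠ 0) {Φ : ℂ → ℂ}
    (hΦ : ∀ z : ℂ, 0 < z.im → HasFDerivAt Φ (etaForm w (horo β p q) z) z) :
    ∃ L : Matrix (Fin 2) (Fin 2) ℤ → ℂ, ∀ N, 0 < N.det → ∀ e c : ℂ, 0 < e.im →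
      Tendsto (fun t : ℝ => Φ (act N (t * e + c))) atTop (𝓝 (L N)) := by
  have key : ∀ N : Matrix (Fin 2) (Fin 2) ℤ, ∃ l : ℂ, 0 < N.det → ∀ e c : ℂ, 0 < e.im →
      Tendsto (fun t : ℝ => Φ (act N (t * e + c))) atTop (𝓝 l) := by
    intro N
    by_cases hN : 0 < N.det
    · obtain ⟨l, hl⟩ := tendsto_primitive (hw.comp_act hN) (row_ne_zero hN h)
        (fun z hz => hasFDerivAt_primitive_comp_act hw.isEigen h hΦ hN hz)
      exact ⟨l, fun _ => hl⟩
    · exact ⟨0, fun h => absurd h hN⟩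
  choose L hL using key
  exact ⟨L, hL⟩

end PeriodHecke

/-! ### Integrals with a holomorphic parameter; the branch of `R_ζ^β`. -/

namespace PeriodHecke

open Complex Filter Topology InnerProductSpace ComplexConjugate MeasureTheory
open UpperHalfPlane hiding I

theorem integrableOn_of_norm_le_inv_one_add_sq {f : ℝ → ℂ} {K : ℝ}
    (hc : ContinuousOn f (Set.Ioi 0)) (hb : ∀ t > 0, ‖f t‖ ≤ K / (1 + t ^ 2)) :
    IntegrableOn f (Set.Ioi 0) := by
  refine Integrable.mono' (g := fun t : ℝ => K * (1 + t ^ 2)⁻¹)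
    (integrable_inv_one_add_sq.const_mul K).integrableOn
    (hc.aestronglyMeasurable measurableSet_Ioi) ?_
  filter_upwards [ae_restrict_mem measurableSet_Ioi] with t ht
  rw [← div_eq_mul_inv]
  exact hb t ht

/-- Cauchy's estimate turns the locally uniform bound on `G` into one on its `ζ`-derivative over a
smaller ball, which justifies differentiation under the integral. -/
theorem differentiableOn_integral_of_norm_le {U : Set ℂ} (hU : IsOpen U) {G : ℂ → ℝ → ℂ}
    (hc : ∀ ζ ∈ U, ContinuousOn (G ζ) (Set.Ioi 0))
    (hd : ∀ t > 0, DifferentiableOn ℂ (fun ζ => G ζ t) U)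
    (hb : ∀ ζ₀ ∈ U, ∃ ε > 0, ∃ K : ℝ, ∀ ζ ∈ Metric.ball ζ₀ ε, ∀ t > 0,
      ‖G ζ t‖ ≤ K / (1 + t ^ 2)) :
    DifferentiableOn ℂ (fun ζ => ∫ t in Set.Ioi (0 : ℝ), G ζ t) U := by
  intro ζ₀ hζ₀
  obtain ⟨ε₁, hε₁, K, hK⟩ := hb ζ₀ hζ₀
  obtain ⟨ε₂, hε₂, hball⟩ := Metric.isOpen_iff.1 hU ζ₀ hζ₀
  set ε := min ε₁ ε₂ / 2 with hε
  have hε0 : 0 < ε := by positivity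
  have h1 : 2 * ε ≤ ε₁ := by rw [hε]; linarith [min_le_left ε₁ ε₂]
  have h2 : 2 * ε ≤ ε₂ := by rw [hε]; linarith [min_le_right ε₁ ε₂]
  have hsub : ∀ ζ ∈ Metric.ball ζ₀ ε, Metric.closedBall ζ (ε / 2) ⊆ Metric.ball ζ₀ (2 * ε) := by
    intro ζ hζ ξ hξ
    rw [Metric.mem_ball] at *
    rw [Metric.mem_closedBall] at hξ
    linarith [dist_triangle ξ ζ ζ₀]
  have hU2 : Metric.ball ζ₀ (2 * ε) ⊆ U := (Metric.ball_subset_ball h2).trans hball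
  have hm : ∀ ζ ∈ U, AEStronglyMeasurable (G ζ) (volume.restrict (Set.Ioi 0)) := fun ζ hζ =>
    (hc ζ hζ).aestronglyMeasurable measurableSet_Ioi
  have hderiv : ∀ t > 0, ∀ ζ ∈ Metric.ball ζ₀ ε, HasDerivAt (fun ζ => G ζ t)
      (deriv (fun ζ => G ζ t) ζ) ζ := fun t ht ζ hζ =>
    ((hd t ht).differentiableAt (hU.mem_nhds
      (hU2 (hsub ζ hζ (Metric.mem_closedBall_self (by positivity)))))).hasDerivAt
  have hmem : ζ₀ ∈ Metric.ball ζ₀ ε := Metric.mem_ball_self hε0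
  refine (hasDerivAt_integral_of_dominated_loc_of_deriv_le (Metric.ball_mem_nhds ζ₀ hε0)
    (F' := fun ζ t => deriv (fun ζ => G ζ t) ζ)
    (bound := fun t => K / (ε / 2) * (1 + t ^ 2)⁻¹) ?_ ?_ ?_ ?_
    (integrable_inv_one_add_sq.const_mul _).integrableOn
    ?_).2.differentiableAt.differentiableWithinAt
  · filter_upwards [hU.mem_nhds hζ₀] with ζ hζ using hm ζ hζ
  · exact integrableOn_of_norm_le_inv_one_add_sq (hc ζ₀ hζ₀)
      (hK ζ₀ (Metric.mem_ball_self hε₁))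
  -- Measurability in `t` of the derivative at `ζ₀`: it is a pointwise limit of difference quotients
  -- along a sequence tending to `ζ₀`.
  · set h : ℕ → ℂ := fun n => ζ₀ + ((ε / 2 * (1 / ((n : ℝ) + 1)) : ℝ) : ℂ) with hh
    have hne : ∀ n, h n ≠ ζ₀ := by
      intro n hn
      have : ((ε / 2 * (1 / ((n : ℝ) + 1)) : ℝ) : ℂ) = 0 := by simpa [hh] using hn
      rw [ofReal_eq_zero] at this
      have : 0 < ε / 2 * (1 / ((n : ℝ) + 1)) := by positivity
      linarith
    have hlim : Tendsto h atTop (𝓝[≠] ζ₀) := by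
      refine tendsto_nhdsWithin_iff.2 ⟨?_, Eventually.of_forall hne⟩
      have h0 : Tendsto (fun n : ℕ => ε / 2 * (1 / ((n : ℝ) + 1))) atTop (𝓝 0) := by
        simpa using tendsto_one_div_add_atTop_nhds_zero_nat.const_mul (ε / 2)
      simpa [hh] using ((continuous_ofReal.tendsto 0).comp h0).const_add ζ₀
    have hin : ∀ n, h n ∈ U := by
      intro n
      refine hU2 (hsub ζ₀ hmem ?_)
      rw [Metric.mem_closedBall, Complex.dist_eq, hh]
      simp only [add_sub_cancel_left, norm_real]
      rw [Real.norm_of_nonneg (by positivity)]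
      refine mul_le_of_le_one_right (by positivity) ?_
      rw [div_le_one (by positivity)]
      linarith [Nat.cast_nonneg (α := ℝ) n]
    refine aestronglyMeasurable_of_tendsto_ae atTop
      (f := fun n t => (h n - ζ₀)⁻¹ * (G (h n) t - G ζ₀ t))
      (fun n => ((hm _ (hin n)).sub (hm _ hζ₀)).const_mul _) ?_
    filter_upwards [ae_restrict_mem measurableSet_Ioi] with t ht
    simpa [slope_def_module, Function.comp_def] using
      (hasDerivAt_iff_tendsto_slope.1 (hderiv t ht ζ₀ hmem)).comp hlim
  · filter_upwards [ae_restrict_mem measurableSet_Ioi] with t ht ζ hζ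
    have hR : 0 < ε / 2 := by positivity
    have hdc : DiffContOnCl ℂ (fun ζ => G ζ t) (Metric.ball ζ (ε / 2)) := by
      refine DifferentiableOn.diffContOnCl ?_
      rw [closure_ball _ hR.ne']
      exact (hd t ht).mono ((hsub ζ hζ).trans hU2)
    have := norm_deriv_le_of_forall_mem_sphere_norm_le (C := K / (1 + t ^ 2)) hR hdc
      fun ξ hξ => hK ξ (Metric.ball_subset_ball h1 (hsub ζ hζ (Metric.sphere_subset_closedBall hξ)))
        t ht
    refine this.trans (le_of_eq ?_)
    field_simp
  · filter_upwards [ae_restrict_mem measurableSet_Ioi] with t ht ζ hζ using hderiv t ht ζ hζ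

theorem integral_Ioi_eq_sub_of_tendsto {f f' : ℝ → ℂ} {l₀ l : ℂ}
    (hd : ∀ t > 0, HasDerivAt f (f' t) t) (hi : IntegrableOn f' (Set.Ioi 0))
    (h0 : Tendsto f (𝓝[>] 0) (𝓝 l₀)) (h1 : Tendsto f atTop (𝓝 l)) :
    ∫ t in Set.Ioi (0 : ℝ), f' t = l - l₀ := by
  have := integral_Ioi_of_hasDerivAt_of_tendsto (f := Function.update f 0 l₀) (a := 0) (m := l)
    (f' := f') ?_ (fun t ht => ?_) hi ?_
  · rwa [Function.update_self] at this
  · rw [continuousWithinAt_update_same]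
    have : Set.Ici (0 : ℝ) \ {0} = Set.Ioi 0 := by ext; simp [lt_iff_le_and_ne, eq_comm]
    rwa [this]
  · refine (hd t ht).congr_of_eventuallyEq ?_
    filter_upwards [Ioi_mem_nhds ht] with s hs
    exact Function.update_of_ne (ne_of_gt hs) _ _
  · refine h1.congr' ?_
    filter_upwards [eventually_gt_atTop 0] with s hs
    exact (Function.update_of_ne hs.ne' _ _).symm

/-- The branch of `R_ζ(z) ^ β` that is holomorphic in `ζ` on the sector bounded by the rays through
`z` and its conjugate. -/
noncomputable def kernelPow (β ζ z : ℂ) : ℂ :=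
  (z.im : ℂ) ^ β * (‖z‖ : ℂ) ^ (-2 * β) * (1 - ζ / z) ^ (-β) * (1 - ζ / conj z) ^ (-β)

/-- The logarithmic derivative of `R_ζ` at `z` in the direction `a`. -/
noncomputable def poissonLogDeriv (ζ z a : ℂ) : ℂ :=
  (a.im : ℂ) / z.im - a / (z - ζ) - conj a / (conj z - ζ)

/-- The integrand `η(w, R_ζ^β)` at `z` in the direction `a`, with the branch `kernelPow`. -/
noncomputable def kernelForm (β : ℂ) (w : ℂ → ℂ) (ζ z a : ℂ) : ℂ :=
  kernelPow β ζ z * (fderiv ℝ w z (I * a) - w z * (β * poissonLogDeriv ζ z (I * a)))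

theorem poisson_eq (ζ z : ℂ) : poisson ζ z = (z.im : ℂ) / ((z - ζ) * (conj z - ζ)) := by
  rw [poisson]
  congr 1
  have h1 : z = z.re + z.im * I := (re_add_im z).symm
  have h2 : conj z = z.re - z.im * I := by
    apply Complex.ext <;> simp
  rw [h2]
  nth_rewrite 3 [h1]
  linear_combination (z.im : ℂ) ^ 2 * I_sq

/-- `R_ζ(z)` is `y / ‖z‖²` divided by the two factors `1 - ζ / z` and `1 - ζ / conj z`. Their
arguments lie in `(0, π)` and `(-π, 0)`, so the sum stays in `(-π, π)` and the principal logarithms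
add without a jump. -/
theorem log_poisson {ζ z : ℂ} (hz : 0 < z.im) (h1 : 0 < (1 - ζ / z).im)
    (h2 : (1 - ζ / conj z).im < 0) : poisson ζ z ∈ slitPlane ∧
      log (poisson ζ z) = Real.log z.im - 2 * Real.log ‖z‖ - log (1 - ζ / z) -
        log (1 - ζ / conj z) := by
  have hz0 : z ≠ 0 := by rintro rfl; simp at hz
  have hzc : conj z ≠ 0 := by simpa using hz0
  have hn : 0 < ‖z‖ := norm_pos_iff.2 hz0
  set A := 1 - ζ / z with hA
  set B := 1 - ζ / conj z with hB
  have hA0 : A ≠ 0 := fun h => by simp [h] at h1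
  have hB0 : B ≠ 0 := fun h => by simp [h] at h2
  have a1 : 0 ≤ A.arg := arg_nonneg_iff.2 h1.le
  have a2 : A.arg < Real.pi := arg_lt_pi_iff.2 (Or.inr h1.ne')
  have b1 : B.arg < 0 := arg_neg_iff.2 h2
  have b2 : -Real.pi < B.arg := neg_pi_lt_arg B
  have hs : A.arg + B.arg ∈ Set.Ioc (-Real.pi) Real.pi := ⟨by linarith, by linarith⟩
  have hargAB : (A * B).arg < Real.pi := by rw [arg_mul hA0 hB0 hs]; linarith
  have hAB : (A * B)⁻¹.arg ≠ Real.pi := by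
    rw [Complex.arg_inv, if_neg hargAB.ne, arg_mul hA0 hB0 hs]
    intro h; linarith
  have hr : 0 < z.im / ‖z‖ ^ 2 := by positivity
  have hP : poisson ζ z = ((z.im / ‖z‖ ^ 2 : ℝ) : ℂ) * (A * B)⁻¹ := by
    have h3 : z - ζ = z * A := by rw [hA]; field_simp
    have h4 : conj z - ζ = conj z * B := by rw [hB]; field_simp
    have h5 : z * conj z = ((‖z‖ ^ 2 : ℝ) : ℂ) := by rw [mul_conj, normSq_eq_norm_sq]
    rw [poisson_eq, h3, h4, show z * A * (conj z * B) = z * conj z * (A * B) by ring, h5]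
    push_cast
    field_simp
  have hP0 : (A * B)⁻¹ ≠ 0 := inv_ne_zero (mul_ne_zero hA0 hB0)
  constructor
  · rw [hP, mem_slitPlane_iff_arg, arg_real_mul _ hr]
    exact ⟨hAB, mul_ne_zero (by exact_mod_cast hr.ne') hP0⟩
  · rw [hP, log_ofReal_mul hr hP0, log_inv _ hargAB.ne, (log_mul_eq_add_log_iff hA0 hB0).2 hs,
      Real.log_div hz.ne' (by positivity), Real.log_pow]
    push_cast
    ring

theorem poisson_cpow_eq_kernelPow {ζ z : ℂ} (β : ℂ) (hz : 0 < z.im) (h1 : 0 < (1 - ζ / z).im)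
    (h2 : (1 - ζ / conj z).im < 0) : poisson ζ z ^ β = kernelPow β ζ z := by
  obtain ⟨h3, h4⟩ := log_poisson hz h1 h2
  have hz0 : z ≠ 0 := by rintro rfl; simp at hz
  have hA0 : 1 - ζ / z ≠ 0 := fun h => by simp [h] at h1
  have hB0 : 1 - ζ / conj z ≠ 0 := fun h => by simp [h] at h2
  rw [kernelPow, cpow_def_of_ne_zero (slitPlane_ne_zero h3), h4, cpow_def_of_ne_zero hA0,
    cpow_def_of_ne_zero hB0, cpow_def_of_ne_zero (by exact_mod_cast hz.ne'),
    cpow_def_of_ne_zero (by simpa using hz0), ← ofReal_log hz.le, ← ofReal_log (norm_nonneg _),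
    ← exp_add, ← exp_add, ← exp_add]
  congr 1
  ring

/-- The kernel depends on `z` and `conj z`, so it is only real differentiable in `z`; its derivative
is found along the real line through `z` in direction `a`. -/
theorem fderiv_poisson_cpow {ζ z : ℂ} (β : ℂ) (h : poisson ζ z ∈ slitPlane) (a : ℂ) :
    fderiv ℝ (fun z => poisson ζ z ^ β) z a =
      poisson ζ z ^ β * (β * poissonLogDeriv ζ z a) := by
  have hP0 := slitPlane_ne_zero h
  have hD : (z - ζ) * (conj z - ζ) ≠ 0 := by
    intro h0; rw [poisson_eq, h0, div_zero] at hP0; exact hP0 rfl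
  obtain ⟨hD1, hD2⟩ := mul_ne_zero_iff.1 hD
  have hy : (z.im : ℂ) ≠ 0 := by
    intro h0; rw [poisson_eq, h0, zero_div] at hP0; exact hP0 rfl
  have hdiff : DifferentiableAt ℝ (fun z => poisson ζ z ^ β) z := by
    have e1 : DifferentiableAt ℝ (fun z : ℂ => (z - ζ) * (conj z - ζ)) z :=
      (differentiableAt_id.sub_const ζ).mul (conjCLE.differentiableAt.sub_const ζ)
    have e2 : DifferentiableAt ℝ (fun w : ℂ => w⁻¹) ((z - ζ) * (conj z - ζ)) :=
      ((hasDerivAt_inv hD).differentiableAt).restrictScalars ℝ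
    have e3 : DifferentiableAt ℝ (fun z => poisson ζ z) z := by
      have := imL.differentiableAt.mul (e2.comp z e1)
      refine this.congr_of_eventuallyEq (Eventually.of_forall fun y => ?_)
      simp [poisson_eq, div_eq_mul_inv]
    have e4 : DifferentiableAt ℝ (fun w : ℂ => w ^ β) (poisson ζ z) :=
      ((hasDerivAt_id _).cpow_const (c := β) h).differentiableAt.restrictScalars ℝ
    exact e4.comp z e3
  have hl : HasDerivAt (fun s : ℝ => z + s * a) a 0 := by
    simpa using ((hasDerivAt_id (0 : ℝ)).ofReal_comp.mul_const a).const_add z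
  have h0 : z + ((0 : ℝ) : ℂ) * a = z := by simp
  have hf : HasDerivAt (fun s : ℝ => poisson ζ (z + s * a) ^ β)
      (fderiv ℝ (fun z => poisson ζ z ^ β) z a) 0 := by
    have e : HasFDerivAt (fun z => poisson ζ z ^ β) (fderiv ℝ (fun z => poisson ζ z ^ β) z)
        (z + ((0 : ℝ) : ℂ) * a) := by rw [h0]; exact hdiff.hasFDerivAt
    exact e.comp_hasDerivAt (0 : ℝ) hl
  have hc : HasDerivAt (fun s : ℝ => conj (z + s * a)) (conj a) 0 :=
    conjCLE.hasFDerivAt.comp_hasDerivAt (0 : ℝ) hl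
  have hi : HasDerivAt (fun s : ℝ => ((z + s * a).im : ℂ)) (a.im : ℂ) 0 :=
    imL.hasFDerivAt.comp_hasDerivAt (0 : ℝ) hl
  have hp : HasDerivAt (fun s : ℝ => poisson ζ (z + s * a))
      (poisson ζ z * poissonLogDeriv ζ z a) 0 := by
    have := hi.div ((hl.sub_const ζ).mul (hc.sub_const ζ)) (by simpa using hD)
    refine (this.congr_of_eventuallyEq (Eventually.of_forall fun s => ?_)).congr_deriv ?_
    · simp only [poisson_eq]; rfl
    · simp only [Pi.mul_apply, h0]
      rw [poisson_eq, poissonLogDeriv]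
      field_simp
      ring
  have hq : HasDerivAt (fun s : ℝ => poisson ζ (z + s * a) ^ β)
      (β * poisson ζ z ^ (β - 1) * (poisson ζ z * poissonLogDeriv ζ z a)) 0 := by
    have e : HasDerivAt (fun w : ℂ => w ^ β) (β * poisson ζ z ^ (β - 1))
        (poisson ζ (z + ((0 : ℝ) : ℂ) * a)) := by
      rw [h0]
      simpa using (hasDerivAt_id (poisson ζ z)).cpow_const (c := β) h
    exact e.comp (0 : ℝ) hp
  rw [hf.unique hq, cpow_sub _ _ hP0, cpow_one]
  field_simp

theorem etaForm_poisson_eq_kernelForm {ζ z : ℂ} (β : ℂ) (w : ℂ → ℂ) (hz : 0 < z.im)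
    (h1 : 0 < (1 - ζ / z).im) (h2 : (1 - ζ / conj z).im < 0) (a : ℂ) :
    etaForm w (fun z => poisson ζ z ^ β) z a = kernelForm β w ζ z a := by
  rw [etaForm_apply, fderiv_poisson_cpow β (log_poisson hz h1 h2).1, kernelForm,
    poisson_cpow_eq_kernelPow β hz h1 h2]
  ring

theorem im_one_sub_div (ζ z : ℂ) :
    (1 - ζ / z).im = (ζ.re * z.im - ζ.im * z.re) / normSq z := by
  rw [sub_im, div_im, one_im]; ring

/-- The first of two situations in which the branch `kernelPow` is the principal power: `ζ > 0` with
`z` anywhere. The second is `Re ζ > 0` with `z` on the imaginary axis. The first links rays to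
primitives, the second links them to the defining integral. -/
theorem etaForm_horo_eq_kernelForm {ζ : ℝ} (hζ : 0 < ζ) {z : ℂ} (β : ℂ) (w : ℂ → ℂ)
    (hz : 0 < z.im) (a : ℂ) :
    etaForm w (horo β 1 (-ζ)) z a = kernelForm β w ζ z a := by
  have hn : 0 < normSq z := normSq_pos.2 (by rintro rfl; simp at hz)
  rw [← poisson_cpow_eq_horo]
  refine etaForm_poisson_eq_kernelForm β w hz ?_ ?_ a
  · rw [im_one_sub_div]
    simp
    positivity
  · rw [im_one_sub_div, normSq_conj]
    simp
    exact div_neg_of_neg_of_pos (by nlinarith) hn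

theorem etaForm_poisson_axis_eq_kernelForm {ζ : ℂ} (hζ : 0 < ζ.re) {y : ℝ} (hy : 0 < y) (β : ℂ)
    (w : ℂ → ℂ) (a : ℂ) :
    etaForm w (fun z => poisson ζ z ^ β) (y * I) a = kernelForm β w ζ (y * I) a := by
  have hn : 0 < normSq (y * I) := normSq_pos.2 (by simp [hy.ne'])
  refine etaForm_poisson_eq_kernelForm β w (by simpa using hy) ?_ ?_ a
  · rw [im_one_sub_div]
    refine div_pos ?_ hn
    simp
    positivity
  · rw [im_one_sub_div, normSq_conj]
    refine div_neg_of_neg_of_pos ?_ hn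
    simp
    positivity

end PeriodHecke

/-! ### Bounds for the kernel along rays. -/

namespace PeriodHecke

open Complex Filter Topology InnerProductSpace ComplexConjugate MeasureTheory
open UpperHalfPlane hiding I

/-- The matrix of `z ↦ -1 / z`. -/
def matS : Matrix (Fin 2) (Fin 2) ℤ := !![0, -1; 1, 0]

theorem det_matS : matS.det = 1 := by simp [matS, Matrix.det_fin_two]

theorem act_matS (z : ℂ) : act matS z = -z⁻¹ := by
  simp [act, mob, matS, div_eq_mul_inv]

theorem act_differentiableAt {M : Matrix (Fin 2) (Fin 2) ℤ} (h : 0 < M.det) {z : ℂ}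
    (hz : 0 < z.im) : DifferentiableAt ℂ (act M) z :=
  (mob_analyticAt (det_cast_pos h) hz).differentiableAt

namespace CuspEigen

variable {β : ℂ} {w : ℂ → ℂ}

theorem ray_decay_atTop (h : CuspEigen β w) {e : ℂ} (he : 0 < e.im) (k : ℕ) :
    ∃ K T : ℝ, 1 ≤ T ∧ ∀ t : ℝ, T ≤ t → ‖w (t * e)‖ * t ^ k ≤ K ∧
      ‖fderiv ℝ w (t * e)‖ * t ^ k ≤ K := by
  obtain ⟨K, Y, hY, hK⟩ := h.decay_fderiv k
  refine ⟨K / e.im ^ k, max 1 (Y / e.im), le_max_left _ _, fun t ht => ?_⟩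
  have h1 : Y ≤ ((t : ℂ) * e).im := by
    simp
    rw [← div_le_iff₀ he]
    exact (le_max_right _ _).trans ht
  obtain ⟨h2, h3⟩ := hK _ h1
  have h4 : ((t : ℂ) * e).im ^ k = t ^ k * e.im ^ k := by simp [mul_pow]
  rw [h4, ← mul_assoc] at h2 h3
  exact ⟨(le_div_iff₀ (by positivity)).2 h2, (le_div_iff₀ (by positivity)).2 h3⟩

theorem continuousOn_ray (h : CuspEigen β w) {e : ℂ} (he : 0 < e.im) :
    ContinuousOn (fun t : ℝ => w (t * e)) (Set.Ioi 0) ∧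
      ContinuousOn (fun t : ℝ => fderiv ℝ w (t * e)) (Set.Ioi 0) := by
  have hm : ∀ t ∈ Set.Ioi (0 : ℝ), 0 < ((t : ℂ) * e).im := by
    intro t ht
    have ht : 0 < t := ht
    simp
    positivity
  have hc : Continuous fun t : ℝ => (t : ℂ) * e := by fun_prop
  constructor
  · exact h.analytic.continuousOn.comp hc.continuousOn hm
  · exact h.analytic.fderiv.continuousOn.comp hc.continuousOn hm

/-- Towards `0`, the substitution `z ↦ -1 / z` turns the ray into another ray going to `∞`, where `w
∘ act matS` decays. Its derivative has norm `t⁻²` on the ray, hence the exponent `k + 2`. The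
remaining part of the ray is compact. -/
theorem ray_decay (h : CuspEigen β w) {e : ℂ} (he : 0 < e.im) (hn : ‖e‖ = 1) (k : ℕ) :
    ∃ K : ℝ, ∀ t : ℝ, 0 < t → (‖w (t * e)‖ + ‖fderiv ℝ w (t * e)‖) * (t + t⁻¹) ^ k ≤ K := by
  have he0 : e ≠ 0 := by rintro rfl; simp at he
  obtain ⟨K₁, T₁, hT₁, h₁⟩ := h.ray_decay_atTop he k
  have hS : 0 < matS.det := by rw [det_matS]; norm_num
  set w₂ := w ∘ act matS with hw₂
  have h' : CuspEigen β w₂ := h.comp_act hS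
  have he' : 0 < (-e⁻¹).im := by
    rw [neg_im, inv_im, neg_div, neg_neg]
    exact div_pos he (normSq_pos.2 he0)
  obtain ⟨K₂, T₂, hT₂, h₂⟩ := h'.ray_decay_atTop he' (k + 2)
  have hτ : ∀ t : ℝ, 1 ≤ t → (t + t⁻¹) ^ k ≤ 2 ^ k * t ^ k := by
    intro t ht
    have h0 : 0 < t := by linarith
    rw [← mul_pow]
    have : t⁻¹ ≤ 1 := inv_le_one_of_one_le₀ ht
    gcongr
    linarith
  have hcont : ContinuousOn (fun t : ℝ => (‖w (t * e)‖ + ‖fderiv ℝ w (t * e)‖) * (t + t⁻¹) ^ k)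
      (Set.Icc T₂⁻¹ T₁) := by
    have hsub : Set.Icc T₂⁻¹ T₁ ⊆ Set.Ioi 0 := fun t ht =>
      lt_of_lt_of_le (inv_pos.2 (by linarith)) ht.1
    obtain ⟨c1, c2⟩ := h.continuousOn_ray he
    refine ((c1.mono hsub).norm.add (c2.mono hsub).norm).mul ((continuousOn_id.add
      (continuousOn_id.inv₀ fun t ht => (hsub ht).ne')).pow k)
  obtain ⟨K₃, h₃⟩ := isCompact_Icc.exists_bound_of_continuousOn hcont
  refine ⟨max K₃ (max (2 ^ k * (K₁ + K₁)) (2 ^ k * (K₂ + K₂))), fun t ht => ?_⟩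
  rcases le_total T₁ t with h1 | h1
  · refine le_trans ?_ ((le_max_left _ _).trans (le_max_right _ _))
    obtain ⟨a1, a2⟩ := h₁ t h1
    calc _ ≤ (‖w (t * e)‖ + ‖fderiv ℝ w (t * e)‖) * (2 ^ k * t ^ k) := by
          gcongr; exact hτ t (hT₁.trans h1)
      _ = 2 ^ k * (‖w (t * e)‖ * t ^ k + ‖fderiv ℝ w (t * e)‖ * t ^ k) := by ring
      _ ≤ _ := by gcongr
  rcases le_total T₂⁻¹ t with h2 | h2
  · exact le_trans ((le_abs_self _).trans (h₃ t ⟨h2, h1⟩)) (le_max_left _ _)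
  · refine le_trans ?_ ((le_max_right _ _).trans (le_max_right _ _))
    set s := t⁻¹ with hs
    have hs0 : 0 < s := by positivity
    have hts : t = s⁻¹ := by rw [hs, inv_inv]
    have hsT : T₂ ≤ s := by
      rw [hs]; exact (le_inv_comm₀ (by linarith) ht).2 h2
    have hs1 : 1 ≤ s := hT₂.trans hsT
    obtain ⟨a1, a2⟩ := h₂ s hsT
    have hz : 0 < ((t : ℂ) * e).im := by simp; positivity
    have hte : act matS (t * e) = s * -e⁻¹ := by
      rw [act_matS, hs, mul_inv]; push_cast; ring
    have hte' : act matS (s * -e⁻¹) = t * e := by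
      rw [act_matS, hs]; push_cast; simp [mul_comm]
    have b1 : ‖w (t * e)‖ = ‖w₂ (s * -e⁻¹)‖ := by rw [hw₂, Function.comp_apply, hte']
    have b2 : ‖fderiv ℝ w (t * e)‖ ≤ ‖fderiv ℝ w₂ (s * -e⁻¹)‖ * s ^ 2 := by
      have hev : w =ᶠ[𝓝 (t * e)] w₂ ∘ act matS := by
        filter_upwards with y
        simp [hw₂, act_matS]
      have hd : deriv (act matS) (t * e) = ((t * e) ^ 2)⁻¹ := by
        have := (mob_hasDerivAt (det_cast_pos hS) hz).deriv
        change deriv (act matS) (t * e) = _ at this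
        rw [this]
        simp [matS]
      have hnorm : ‖((t * e : ℂ) ^ 2)⁻¹‖ = s ^ 2 := by
        rw [norm_inv, norm_pow, norm_mul, hn, norm_real, Real.norm_of_nonneg ht.le, mul_one, hs,
          inv_pow]
      rw [hev.fderiv_eq]
      refine (norm_fderiv_comp_le ?_ (act_differentiableAt hS hz)).trans (le_of_eq ?_)
      · exact h'.isEigen.differentiableAt (act_im_pos hS hz)
      · rw [hd, hnorm, hte]
    have b3 : (t + s) ^ k ≤ 2 ^ k * s ^ k := by
      have := hτ s hs1
      rwa [add_comm, ← hts] at this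
    have b4 : s ^ k ≤ s ^ (k + 2) := pow_le_pow_right₀ hs1 (by omega)
    calc _ ≤ (‖w₂ (s * -e⁻¹)‖ + ‖fderiv ℝ w₂ (s * -e⁻¹)‖ * s ^ 2) * (2 ^ k * s ^ k) := by
          rw [b1]; gcongr
      _ = 2 ^ k * (‖w₂ (s * -e⁻¹)‖ * s ^ k + ‖fderiv ℝ w₂ (s * -e⁻¹)‖ * s ^ (k + 2)) := by ring
      _ ≤ _ := by
        gcongr
        exact le_trans (by gcongr) a1

end CuspEigen

/-- The sector `|arg ζ| < θ` in the cut plane. -/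
def sector (θ : ℝ) : Set ℂ := {ζ | ζ ∈ slitPlane ∧ |arg ζ| < θ}

theorem isOpen_sector (θ : ℝ) : IsOpen (sector θ) := by
  have h : ContinuousOn (fun ζ => |arg ζ|) slitPlane := fun ζ hζ =>
    (continuousAt_arg hζ).abs.continuousWithinAt
  exact h.isOpen_inter_preimage isOpen_slitPlane isOpen_Iio

/-- The unit vector with argument `θ`. -/
noncomputable def ray (θ : ℝ) : ℂ := exp (θ * I)

theorem norm_ray (θ : ℝ) : ‖ray θ‖ = 1 := norm_exp_ofReal_mul_I θ

theorem ray_im (θ : ℝ) : (ray θ).im = Real.sin θ := by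
  rw [ray, exp_mul_I]; simp [← ofReal_cos, ← ofReal_sin]

theorem ray_im_pos {θ : ℝ} (h0 : 0 < θ) (hπ : θ < Real.pi) : 0 < (ray θ).im := by
  rw [ray_im]; exact Real.sin_pos_of_pos_of_lt_pi h0 hπ

theorem arg_mul_ray {θ : ℝ} (h0 : 0 < θ) (hπ : θ < Real.pi) {t : ℝ} (ht : 0 < t) :
    arg (t * ray θ) = θ := by
  rw [ray, exp_mul_I, arg_mul_cos_add_sin_mul_I ht ⟨by linarith, hπ.le⟩]

theorem mul_ray_notMem_sector {θ : ℝ} (h0 : 0 < θ) (hπ : θ < Real.pi) {t : ℝ} (ht : 0 < t) :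
    t * ray θ ∉ sector θ ∧ conj (t * ray θ) ∉ sector θ := by
  have h := arg_mul_ray h0 hπ ht
  constructor
  · rintro ⟨_, h1⟩
    rw [h, abs_of_pos h0] at h1
    exact h1.false
  · rintro ⟨_, h1⟩
    rw [arg_conj, h, if_neg hπ.ne, abs_neg, abs_of_pos h0] at h1
    exact h1.false

/-- If `1 - ζ / z` were on the cut, `ζ` would be a positive real multiple of `z`, and these all lie
outside the sector. -/
theorem one_sub_div_mem_slitPlane {θ : ℝ} {ζ z : ℂ} (hζ : ζ ∈ sector θ) (hz0 : z ≠ 0)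
    (hz : ∀ t : ℝ, 0 < t → t * z ∉ sector θ) : 1 - ζ / z ∈ slitPlane := by
  by_contra h
  rw [mem_slitPlane_iff, not_or, not_lt, not_not] at h
  obtain ⟨h1, h2⟩ := h
  rw [sub_im, one_im, zero_sub, neg_eq_zero] at h2
  rw [sub_re, one_re] at h1
  refine hz (ζ / z).re (by linarith) ?_
  have : ((ζ / z).re : ℂ) = ζ / z := by
    apply Complex.ext
    · simp
    · rw [ofReal_im, h2]
  rw [this, div_mul_cancel₀ _ hz0]
  exact hζ

section Kernel

variable {θ : ℝ}

theorem one_sub_div_ray_mem_slitPlane (h0 : 0 < θ) (hπ : θ < Real.pi) {ζ : ℂ} (hζ : ζ ∈ sector θ)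
    {t : ℝ} (ht : 0 < t) : 1 - ζ / (t * ray θ) ∈ slitPlane ∧
      1 - ζ / conj (t * ray θ) ∈ slitPlane := by
  have hn : (t : ℂ) * ray θ ≠ 0 := by
    intro h
    have := ray_im_pos h0 hπ
    rcases mul_eq_zero.1 h with h | h
    · exact ht.ne' (by exact_mod_cast h)
    · simp [h] at this
  constructor
  · refine one_sub_div_mem_slitPlane hζ hn fun s hs => ?_
    rw [← mul_assoc, ← ofReal_mul]
    exact (mul_ray_notMem_sector h0 hπ (mul_pos hs ht)).1
  · refine one_sub_div_mem_slitPlane hζ (by simpa using hn) fun s hs => ?_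
    have : (s : ℂ) * conj (t * ray θ) = conj ((s * t : ℝ) * ray θ) := by
      simp [mul_assoc]
    rw [this]
    exact (mul_ray_notMem_sector h0 hπ (mul_pos hs ht)).2

theorem sub_ray_ne_zero (h0 : 0 < θ) (hπ : θ < Real.pi) {ζ : ℂ} (hζ : ζ ∈ sector θ)
    {t : ℝ} (ht : 0 < t) : t * ray θ - ζ ≠ 0 ∧ conj (t * ray θ) - ζ ≠ 0 := by
  obtain ⟨h1, h2⟩ := mul_ray_notMem_sector h0 hπ ht
  exact ⟨fun h => h1 (sub_eq_zero.1 h ▸ hζ), fun h => h2 (sub_eq_zero.1 h ▸ hζ)⟩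

theorem differentiableOn_kernelForm (h0 : 0 < θ) (hπ : θ < Real.pi) (β : ℂ) (w : ℂ → ℂ) {t : ℝ}
    (ht : 0 < t) (a : ℂ) : DifferentiableOn ℂ (fun ζ => kernelForm β w ζ (t * ray θ) a)
      (sector θ) := by
  intro ζ hζ
  obtain ⟨h1, h2⟩ := one_sub_div_ray_mem_slitPlane h0 hπ hζ ht
  obtain ⟨h3, h4⟩ := sub_ray_ne_zero h0 hπ hζ ht
  refine DifferentiableAt.differentiableWithinAt ?_
  have e : ∀ z : ℂ, DifferentiableAt ℂ (fun ζ : ℂ => 1 - ζ / z) ζ := fun z => by fun_prop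
  have e' : ∀ z a : ℂ, z - ζ ≠ 0 → DifferentiableAt ℂ (fun ζ : ℂ => a / (z - ζ)) ζ := fun z a h =>
    DifferentiableAt.fun_div (by fun_prop) (by fun_prop) h
  unfold kernelForm kernelPow poissonLogDeriv
  refine DifferentiableAt.mul (DifferentiableAt.mul (DifferentiableAt.mul (by fun_prop)
    ((e _).cpow_const h1)) ((e _).cpow_const h2)) ?_
  refine DifferentiableAt.const_sub (DifferentiableAt.const_mul (DifferentiableAt.const_mul ?_ _)
    _) _
  exact DifferentiableAt.sub (DifferentiableAt.const_sub (e' _ _ h3) _) (e' _ _ h4)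

theorem continuousOn_kernelForm (h0 : 0 < θ) (hπ : θ < Real.pi) {β : ℂ} {w : ℂ → ℂ}
    (hw : CuspEigen β w) {ζ : ℂ} (hζ : ζ ∈ sector θ) (a : ℂ) :
    ContinuousOn (fun t : ℝ => kernelForm β w ζ (t * ray θ) a) (Set.Ioi 0) := by
  have he := ray_im_pos h0 hπ
  obtain ⟨c1, c2⟩ := hw.continuousOn_ray he
  have hz : Continuous fun t : ℝ => (t : ℂ) * ray θ := by fun_prop
  have hzc : Continuous fun t : ℝ => conj ((t : ℂ) * ray θ) := continuous_conj.comp hz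
  have hne : ∀ t ∈ Set.Ioi (0 : ℝ), (t : ℂ) * ray θ ≠ 0 := by
    intro t ht h
    rcases mul_eq_zero.1 h with h | h
    · exact (ne_of_gt ht) (by exact_mod_cast h)
    · simp [h] at he
  have him : ∀ t ∈ Set.Ioi (0 : ℝ), 0 < ((t : ℂ) * ray θ).im := by
    intro t ht
    have ht : 0 < t := ht
    simp
    positivity
  have hic : Continuous fun t : ℝ => ((((t : ℂ) * ray θ).im : ℝ) : ℂ) := by fun_prop
  have hnc : Continuous fun t : ℝ => ((‖(t : ℂ) * ray θ‖ : ℝ) : ℂ) := by fun_prop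
  unfold kernelForm kernelPow poissonLogDeriv
  refine ContinuousOn.mul (ContinuousOn.mul (ContinuousOn.mul (ContinuousOn.mul ?_ ?_) ?_) ?_)
    (ContinuousOn.sub (c2.clm_apply continuousOn_const) (c1.mul (continuousOn_const.mul
      (ContinuousOn.sub (ContinuousOn.sub ?_ ?_) ?_))))
  · exact hic.continuousOn.cpow continuousOn_const fun t ht =>
      ofReal_mem_slitPlane.2 (him t ht)
  · exact hnc.continuousOn.cpow continuousOn_const fun t ht =>
      ofReal_mem_slitPlane.2 (norm_pos_iff.2 (hne t ht))
  · refine ContinuousOn.cpow (continuousOn_const.sub (continuousOn_const.div hz.continuousOn hne))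
      continuousOn_const fun t ht => (one_sub_div_ray_mem_slitPlane h0 hπ hζ ht).1
  · refine ContinuousOn.cpow (continuousOn_const.sub (continuousOn_const.div hzc.continuousOn ?_))
      continuousOn_const fun t ht => (one_sub_div_ray_mem_slitPlane h0 hπ hζ ht).2
    intro t ht
    simpa using hne t ht
  · exact continuousOn_const.div hic.continuousOn fun t ht => by
      exact_mod_cast (him t ht).ne'
  · exact continuousOn_const.div (hz.sub continuous_const).continuousOn fun t ht =>
      (sub_ray_ne_zero h0 hπ hζ ht).1
  · exact continuousOn_const.div (hzc.sub continuous_const).continuousOn fun t ht =>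
      (sub_ray_ne_zero h0 hπ hζ ht).2

theorem norm_cpow_le_pow {A s : ℂ} {T : ℝ} {m : ℕ} (hT : 1 ≤ T) (h1 : T⁻¹ ≤ ‖A‖) (h2 : ‖A‖ ≤ T)
    (hm : ‖s‖ ≤ m) : ‖A ^ s‖ ≤ Real.exp (Real.pi * ‖s‖) * T ^ m := by
  have hA : A ≠ 0 := norm_pos_iff.1 ((inv_pos.2 (by linarith)).trans_le h1)
  rw [norm_cpow_of_ne_zero hA, div_eq_mul_inv, ← Real.exp_neg, mul_comm]
  gcongr
  · have a1 : |arg A * s.im| ≤ Real.pi * ‖s‖ := by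
      rw [abs_mul]
      exact mul_le_mul (abs_arg_le_pi A) (abs_im_le_norm s) (abs_nonneg _) Real.pi_pos.le
    linarith [neg_abs_le (arg A * s.im)]
  · exact rpow_le_pow_of_inv_le hT h1 h2 ((abs_re_le_norm s).trans hm)

/-- For `ζ` near `ζ₀`, the bases of the four powers in `kernelPow` have norms between `T⁻¹` and `T`,
where `T` is a constant times `t + t⁻¹`. The logarithmic derivative grows at most like `t + t⁻¹`.
The decay of `w` at both ends of the ray dominates all of this, uniformly in `ζ`. -/
theorem norm_kernelForm_le (h0 : 0 < θ) (hπ : θ < Real.pi) {β : ℂ} {w : ℂ → ℂ}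
    (hw : CuspEigen β w) {ζ₀ : ℂ} (hζ₀ : ζ₀ ∈ sector θ) : ∃ ε > 0, ∃ K : ℝ,
      ∀ ζ ∈ Metric.ball ζ₀ ε, ∀ t : ℝ, 0 < t →
        ‖kernelForm β w ζ (t * ray θ) (ray θ)‖ ≤ K / (1 + t ^ 2) := by
  obtain ⟨ε', hε', hball⟩ := Metric.isOpen_iff.1 (isOpen_sector θ) ζ₀ hζ₀
  -- Half the radius, so that every `ζ` in the small ball keeps distance at least `ε` from the
  -- complement of the sector, in particular from the ray and its conjugate.
  set ε := ε' / 2 with hε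
  have hε0 : 0 < ε := by positivity
  have he := ray_im_pos h0 hπ
  have hn := norm_ray θ
  set e := ray θ with hee
  set s := e.im with hs
  obtain ⟨m, hm⟩ := exists_nat_ge ‖-2 * β‖
  have hm1 : ‖β‖ ≤ m := by
    refine le_trans ?_ hm
    rw [norm_mul]; simp; linarith [norm_nonneg β]
  have hm2 : ‖-β‖ ≤ m := by rwa [norm_neg]
  set R := ‖ζ₀‖ + ε with hR
  set C := max (1 + R) (max ε⁻¹ s⁻¹) with hC
  have hC1 : 1 + R ≤ C := le_max_left _ _
  have hC2 : ε⁻¹ ≤ C := (le_max_left _ _).trans (le_max_right _ _)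
  have hC3 : s⁻¹ ≤ C := (le_max_right _ _).trans (le_max_right _ _)
  have hR0 : 0 < R := by positivity
  have hC0 : 1 ≤ C := by linarith
  set E := max (max (Real.exp (Real.pi * ‖β‖)) (Real.exp (Real.pi * ‖-2 * β‖)))
    (Real.exp (Real.pi * ‖-β‖)) with hE
  have hE0 : 0 ≤ E := le_trans (Real.exp_pos _).le (le_max_right _ _)
  -- The exponent counts `4 * m` for the four complex powers, `1` for the logarithmic derivative,
  -- and `2` for `1 + t ^ 2 ≤ τ ^ 2`.
  obtain ⟨K, hK⟩ := hw.ray_decay he hn (4 * m + 3)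
  have hK0 : 0 ≤ K := le_trans (by positivity) (hK 1 one_pos)
  refine ⟨ε, hε0, E ^ 4 * C ^ (4 * m) * (1 + ‖β‖ * (3 * C)) * K, fun ζ hζ t ht => ?_⟩
  set z := (t : ℂ) * e with hz
  have hzn : ‖z‖ = t := by
    rw [hz, norm_mul, hn, norm_real, Real.norm_of_nonneg ht.le, mul_one]
  have hzi : z.im = t * s := by simp [hz, hs]
  set τ := t + t⁻¹ with hτ
  have ht' : 0 < t⁻¹ := inv_pos.2 ht
  have hτ1 : 1 ≤ τ := by
    rcases le_total 1 t with h | h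
    · linarith
    · have := (one_le_inv₀ ht).2 h
      linarith
  have hτ2 : 1 + t ^ 2 ≤ τ ^ 2 := by
    have e1 : τ ^ 2 = t ^ 2 + 2 + t⁻¹ ^ 2 := by rw [hτ]; field_simp; ring
    nlinarith [sq_nonneg t⁻¹]
  set T := C * τ with hT
  have hT1 : 1 ≤ T := one_le_mul_of_one_le_of_one_le hC0 hτ1
  have hTτ : τ ≤ T := le_mul_of_one_le_left (by linarith) hC0
  have hTC : C ≤ T := le_mul_of_one_le_right (by linarith) hτ1
  have hfar : ∀ z : ℂ, z ∉ sector θ → ε ≤ ‖z - ζ‖ := by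
    intro z hz
    by_contra! hlt
    refine hz (hball ?_)
    rw [Metric.mem_ball] at hζ ⊢
    rw [← dist_eq_norm] at hlt
    linarith [dist_triangle z ζ ζ₀]
  obtain ⟨n1, n2⟩ := mul_ray_notMem_sector h0 hπ ht
  have f1 : ε ≤ ‖z - ζ‖ := hfar _ n1
  have f2 : ε ≤ ‖conj z - ζ‖ := hfar _ n2
  have hzc : ‖conj z‖ = t := by rw [norm_conj, hzn]
  have hζn : ‖ζ‖ ≤ R := by
    rw [Metric.mem_ball, dist_eq_norm] at hζ
    have := norm_sub_norm_le ζ ζ₀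
    linarith
  have hfac : ∀ x : ℂ, ‖x‖ = t → ε ≤ ‖x - ζ‖ → T⁻¹ ≤ ‖1 - ζ / x‖ ∧ ‖1 - ζ / x‖ ≤ T := by
    intro x hx hx'
    have hx0 : x ≠ 0 := norm_pos_iff.1 (by rw [hx]; exact ht)
    have e1 : ‖1 - ζ / x‖ = ‖x - ζ‖ * t⁻¹ := by
      have : 1 - ζ / x = (x - ζ) / x := by field_simp
      rw [this, norm_div, hx, div_eq_mul_inv]
    rw [e1]
    constructor
    · rw [hT, mul_inv]
      gcongr
      · refine le_trans ?_ hx'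
        rwa [inv_le_comm₀ (by linarith) hε0]
      · linarith
    · have e2 : ‖x - ζ‖ ≤ t + R := (norm_sub_le _ _).trans (by rw [hx]; gcongr)
      calc ‖x - ζ‖ * t⁻¹ ≤ (t + R) * t⁻¹ := by gcongr
        _ = 1 + R * t⁻¹ := by field_simp
        _ ≤ 1 * τ + R * τ := by
          gcongr
          · linarith
          · linarith
        _ = (1 + R) * τ := by ring
        _ ≤ T := by rw [hT]; gcongr
  obtain ⟨g1, g2⟩ := hfac z hzn f1
  obtain ⟨g3, g4⟩ := hfac (conj z) hzc f2
  have hTinv : T⁻¹ ≤ τ⁻¹ := by gcongr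
  have hy : ‖(z.im : ℂ)‖ = t * s := by
    rw [norm_real, hzi, Real.norm_of_nonneg (by positivity)]
  have hs1 : s ≤ 1 := by
    rw [hs, ← hn]; exact (le_abs_self _).trans (abs_im_le_norm e)
  have hy1 : T⁻¹ ≤ ‖(z.im : ℂ)‖ := by
    rw [hy, hT, mul_inv, mul_comm]
    gcongr
    · rw [inv_le_comm₀ (by linarith) ht]; linarith
    · rwa [inv_le_comm₀ (by linarith) he]
  have hy2 : ‖(z.im : ℂ)‖ ≤ T := by
    rw [hy]
    calc t * s ≤ t * 1 := by gcongr
      _ ≤ T := by linarith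
  have hn1 : T⁻¹ ≤ ‖(‖z‖ : ℂ)‖ := by
    rw [norm_real, norm_norm, hzn]
    refine hTinv.trans ?_
    rw [inv_le_comm₀ (by linarith) ht]; linarith
  have hn2 : ‖(‖z‖ : ℂ)‖ ≤ T := by
    rw [norm_real, norm_norm, hzn]; linarith
  have hV : ‖kernelPow β ζ z‖ ≤ E ^ 4 * T ^ (4 * m) := by
    rw [kernelPow, norm_mul, norm_mul, norm_mul]
    have k1 : ‖(z.im : ℂ) ^ β‖ ≤ E * T ^ m := (norm_cpow_le_pow hT1 hy1 hy2 hm1).trans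
      (by gcongr; exact (le_max_left _ _).trans (le_max_left _ _))
    have k2 : ‖(‖z‖ : ℂ) ^ (-2 * β)‖ ≤ E * T ^ m := (norm_cpow_le_pow hT1 hn1 hn2 hm).trans
      (by gcongr; exact (le_max_right _ _).trans (le_max_left _ _))
    have k3 : ‖(1 - ζ / z) ^ (-β)‖ ≤ E * T ^ m := (norm_cpow_le_pow hT1 g1 g2 hm2).trans
      (by gcongr; exact le_max_right _ _)
    have k4 : ‖(1 - ζ / conj z) ^ (-β)‖ ≤ E * T ^ m := (norm_cpow_le_pow hT1 g3 g4 hm2).trans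
      (by gcongr; exact le_max_right _ _)
    calc _ ≤ (E * T ^ m) * (E * T ^ m) * (E * T ^ m) * (E * T ^ m) := by gcongr
      _ = _ := by ring
  have hen : ‖I * e‖ = 1 := by simp [hn]
  have hLD : ‖poissonLogDeriv ζ z (I * e)‖ ≤ 3 * C * τ := by
    have l1 : ‖((I * e).im : ℂ) / z.im‖ ≤ C * τ := by
      rw [norm_div, hy, norm_real, div_eq_mul_inv, mul_inv]
      have : ‖(I * e).im‖ ≤ 1 := hen ▸ abs_im_le_norm (I * e)
      calc _ ≤ 1 * (τ * C) := by gcongr; linarith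
        _ = _ := by ring
    have l2 : ∀ x a : ℂ, ‖a‖ = 1 → ε ≤ ‖x‖ → ‖a / x‖ ≤ C * τ := by
      intro x a ha hx
      rw [norm_div, ha, one_div]
      calc ‖x‖⁻¹ ≤ ε⁻¹ := by gcongr
        _ ≤ C * τ := hC2.trans hTC
    have l3 := l2 _ (I * e) hen f1
    have l4 := l2 _ (conj (I * e)) (by rw [norm_conj, hen]) f2
    rw [poissonLogDeriv]
    refine (norm_sub_le _ _).trans ?_
    have := norm_sub_le (((I * e).im : ℂ) / z.im) (I * e / (z - ζ))
    linarith
  have hDw : ‖fderiv ℝ w z (I * e)‖ ≤ ‖fderiv ℝ w z‖ := by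
    have := (fderiv ℝ w z).le_opNorm (I * e)
    rwa [hen, mul_one] at this
  have key := hK t ht
  rw [le_div_iff₀ (by positivity)]
  set g := ‖w z‖ + ‖fderiv ℝ w z‖ with hg
  have hg1 : ‖w z‖ ≤ g := by linarith [norm_nonneg (fderiv ℝ w z)]
  have hg2 : ‖fderiv ℝ w z‖ ≤ g := by linarith [norm_nonneg (w z)]
  have hin : ‖fderiv ℝ w z (I * e) - w z * (β * poissonLogDeriv ζ z (I * e))‖ ≤
      g * (1 + ‖β‖ * (3 * C)) * τ := by
    refine (norm_sub_le _ _).trans ?_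
    rw [norm_mul, norm_mul]
    calc _ ≤ g * τ + g * (‖β‖ * (3 * C * τ)) := by
          gcongr
          exact (hDw.trans hg2).trans (le_mul_of_one_le_right (by positivity) hτ1)
      _ = _ := by ring
  rw [kernelForm, norm_mul]
  calc _ ≤ E ^ 4 * T ^ (4 * m) * (g * (1 + ‖β‖ * (3 * C)) * τ) * τ ^ 2 := by gcongr
    _ = E ^ 4 * C ^ (4 * m) * (1 + ‖β‖ * (3 * C)) * (g * τ ^ (4 * m + 3)) := by
      rw [hT, mul_pow, pow_add]; ring
    _ ≤ _ := by gcongr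

end Kernel

end PeriodHecke

/-! ### Holomorphic continuation of the period transform. -/

namespace PeriodHecke

open Complex Filter Topology InnerProductSpace ComplexConjugate MeasureTheory
open UpperHalfPlane hiding I

/-- The integral of `η(w, R_ζ^β)` along the ray with argument `θ`. -/
noncomputable def rayIntegral (β : ℂ) (w : ℂ → ℂ) (θ : ℝ) (ζ : ℂ) : ℂ :=
  ∫ t in Set.Ioi (0 : ℝ), kernelForm β w ζ (t * ray θ) (ray θ)

section RayIntegral

variable {β : ℂ} {w : ℂ → ℂ} {θ : ℝ}

theorem integrableOn_kernelForm (hw : CuspEigen β w) (h0 : 0 < θ) (hπ : θ < Real.pi) {ζ : ℂ}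
    (hζ : ζ ∈ sector θ) :
    IntegrableOn (fun t : ℝ => kernelForm β w ζ (t * ray θ) (ray θ)) (Set.Ioi 0) := by
  obtain ⟨ε, hε, K, hK⟩ := norm_kernelForm_le h0 hπ hw hζ
  exact integrableOn_of_norm_le_inv_one_add_sq (continuousOn_kernelForm h0 hπ hw hζ _)
    (hK ζ (Metric.mem_ball_self hε))

theorem differentiableOn_rayIntegral (hw : CuspEigen β w) (h0 : 0 < θ) (hπ : θ < Real.pi) :
    DifferentiableOn ℂ (rayIntegral β w θ) (sector θ) :=
  differentiableOn_integral_of_norm_le (isOpen_sector θ)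
    (fun _ hζ => continuousOn_kernelForm h0 hπ hw hζ _)
    (fun _ ht => differentiableOn_kernelForm h0 hπ β w ht _)
    (fun _ hζ => norm_kernelForm_le h0 hπ hw hζ)

theorem ofReal_mem_sector (h0 : 0 < θ) {x : ℝ} (hx : 0 < x) : (x : ℂ) ∈ sector θ :=
  ⟨ofReal_mem_slitPlane.2 hx, by rw [arg_ofReal_of_nonneg hx.le, abs_zero]; exact h0⟩

/-- The ray ends at the cusps `∞` and `0 = S∞`; near `0` it is the image under `z ↦ -1 / z` of an
upward ray. The value does not involve `θ`, which is how different rays are compared. -/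
theorem rayIntegral_eq_sub (hw : CuspEigen β w) (h0 : 0 < θ) (hπ : θ < Real.pi) {ζ : ℝ}
    (hζ : 0 < ζ) {Φ : ℂ → ℂ}
    (hΦ : ∀ z : ℂ, 0 < z.im → HasFDerivAt Φ (etaForm w (horo β 1 (-ζ)) z) z)
    {L : Matrix (Fin 2) (Fin 2) ℤ → ℂ}
    (hL : ∀ N, 0 < N.det → ∀ e c : ℂ, 0 < e.im →
      Tendsto (fun t : ℝ => Φ (act N (t * e + c))) atTop (𝓝 (L N))) :
    rayIntegral β w θ ζ = L 1 - L matS := by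
  have he := ray_im_pos h0 hπ
  have hne : ray θ ≠ 0 := by
    intro h; simp [h] at he
  refine integral_Ioi_eq_sub_of_tendsto (f := fun t : ℝ => Φ (t * ray θ)) (fun t ht => ?_)
    (integrableOn_kernelForm hw h0 hπ (ofReal_mem_sector h0 hζ)) ?_ ?_
  · have him : 0 < ((t : ℂ) * ray θ).im := by simp; positivity
    rw [← etaForm_horo_eq_kernelForm hζ β w him]
    have hl : HasDerivAt (fun t : ℝ => (t : ℂ) * ray θ) (ray θ) t := by
      simpa using (hasDerivAt_id t).ofReal_comp.mul_const (ray θ)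
    exact (hΦ _ him).comp_hasDerivAt t hl
  · have hi : 0 < (-(ray θ)⁻¹).im := by
      rw [neg_im, inv_im, neg_div, neg_neg]
      exact div_pos he (normSq_pos.2 hne)
    have := (hL matS (by rw [det_matS]; norm_num) (-(ray θ)⁻¹) 0 hi).comp
      tendsto_inv_nhdsGT_zero
    refine this.congr fun t => ?_
    simp [act_matS, mul_comm]
  · have := hL 1 (by simp) (ray θ) 0 he
    refine this.congr fun t => ?_
    rw [← one_smul ℤ (1 : Matrix (Fin 2) (Fin 2) ℤ), act_scalar one_ne_zero, add_zero]

theorem exists_primitive_horo (hw : CuspEigen β w) (ζ : ℝ) : ∃ (Φ : ℂ → ℂ)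
    (L : Matrix (Fin 2) (Fin 2) ℤ → ℂ),
    (∀ z : ℂ, 0 < z.im → HasFDerivAt Φ (etaForm w (horo β 1 (-ζ)) z) z) ∧
    ∀ N, 0 < N.det → ∀ e c : ℂ, 0 < e.im →
      Tendsto (fun t : ℝ => Φ (act N (t * e + c))) atTop (𝓝 (L N)) := by
  have h : (1 : ℝ) ≠ 0 ∨ -ζ ≠ 0 := Or.inl one_ne_zero
  obtain ⟨Φ, hΦ⟩ := exists_primitive hw.isEigen (isEigen_horo h β)
  obtain ⟨L, hL⟩ := exists_cuspLimit hw h hΦ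
  exact ⟨Φ, L, hΦ, hL⟩

/-- The sector is the image of a horizontal strip under `exp`. -/
theorem isPreconnected_sector (hπ : θ ≤ Real.pi) : IsPreconnected (sector θ) := by
  have h : sector θ = exp '' {w : ℂ | |w.im| < θ} := by
    ext ζ
    constructor
    · rintro ⟨h1, h2⟩
      exact ⟨log ζ, by simpa [log_im] using h2, exp_log (slitPlane_ne_zero h1)⟩
    · rintro ⟨w, hw, rfl⟩
      have hw' : |w.im| < θ := hw
      obtain ⟨h1, h2⟩ := abs_lt.1 hw'
      have h3 : arg (exp w) = w.im := by
        rw [← log_im, log_exp (by linarith) (by linarith)]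
      refine ⟨mem_slitPlane_iff_arg.2 ⟨?_, exp_ne_zero w⟩, ?_⟩
      · rw [h3]; linarith
      · rw [h3]; exact hw'
  have hc : Convex ℝ {w : ℂ | |w.im| < θ} := by
    have : {w : ℂ | |w.im| < θ} = {w : ℂ | -θ < w.im} ∩ {w : ℂ | w.im < θ} := by
      ext; simp [abs_lt]
    rw [this]
    exact (convex_halfSpace_im_gt _).inter (convex_halfSpace_im_lt _)
  rw [h]
  exact hc.isPreconnected.image _ continuous_exp.continuousOn

theorem sector_pi : sector Real.pi = slitPlane := by
  ext ζ
  refine ⟨fun h => h.1, fun h => ⟨h, ?_⟩⟩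
  exact abs_lt.2 ⟨neg_pi_lt_arg ζ, lt_of_le_of_ne (arg_le_pi ζ) (mem_slitPlane_iff_arg.1 h).1⟩

/-- Identity theorem: the points `1 + 1 / (n + 1)` accumulate at `1`, inside a connected open set.
-/
theorem eqOn_sector_of_eq_ofReal (h0 : 0 < θ) (hπ : θ ≤ Real.pi) {f g : ℂ → ℂ}
    (hf : DifferentiableOn ℂ f (sector θ)) (hg : DifferentiableOn ℂ g (sector θ))
    (h : ∀ x : ℝ, 0 < x → f x = g x) : Set.EqOn f g (sector θ) := by
  refine (hf.analyticOnNhd (isOpen_sector θ)).eqOn_of_preconnected_of_frequently_eq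
    (hg.analyticOnNhd (isOpen_sector θ)) (isPreconnected_sector hπ)
    (z₀ := ((1 : ℝ) : ℂ)) (ofReal_mem_sector h0 one_pos) ?_
  have hlim : Tendsto (fun n : ℕ => (((1 + 1 / ((n : ℝ) + 1)) : ℝ) : ℂ)) atTop
      (𝓝[≠] ((1 : ℝ) : ℂ)) := by
    refine tendsto_nhdsWithin_iff.2 ⟨?_, Eventually.of_forall fun n => ?_⟩
    · refine (continuous_ofReal.tendsto _).comp ?_
      simpa using tendsto_one_div_add_atTop_nhds_zero_nat.const_add (1 : ℝ)
    · have : 0 < 1 / ((n : ℝ) + 1) := by positivity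
      rw [Set.mem_compl_singleton_iff, Ne, ofReal_inj]
      linarith
  exact hlim.frequently (Eventually.of_forall fun n => h _ (by positivity)).frequently

theorem rayIntegral_eq_rayIntegral (hw : CuspEigen β w) {θ' : ℝ} (h0 : 0 < θ) (h : θ ≤ θ')
    (hπ : θ' < Real.pi) {ζ : ℂ} (hζ : ζ ∈ sector θ) :
    rayIntegral β w θ ζ = rayIntegral β w θ' ζ := by
  have hsub : sector θ ⊆ sector θ' := fun ζ hζ => ⟨hζ.1, hζ.2.trans_le h⟩
  refine eqOn_sector_of_eq_ofReal h0 (h.trans hπ.le)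
    (differentiableOn_rayIntegral hw h0 (h.trans_lt hπ))
    ((differentiableOn_rayIntegral hw (h0.trans_le h) hπ).mono hsub) (fun x hx => ?_) hζ
  obtain ⟨Φ, L, hΦ, hL⟩ := exists_primitive_horo hw x
  rw [rayIntegral_eq_sub hw h0 (h.trans_lt hπ) hx hΦ hL,
    rayIntegral_eq_sub hw (h0.trans_le h) hπ hx hΦ hL]

theorem rayIntegral_congr_angle (hw : CuspEigen β w) {θ' : ℝ} (h0 : 0 < θ) (hπ : θ < Real.pi)
    (h0' : 0 < θ') (hπ' : θ' < Real.pi) {ζ : ℂ} (hζ : ζ ∈ sector θ) (hζ' : ζ ∈ sector θ') :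
    rayIntegral β w θ ζ = rayIntegral β w θ' ζ := by
  rcases le_total θ θ' with h | h
  · exact rayIntegral_eq_rayIntegral hw h0 h hπ' hζ
  · exact (rayIntegral_eq_rayIntegral hw h0' h hπ hζ').symm

end RayIntegral

theorem ray_pi_div_two : ray (Real.pi / 2) = I := by
  rw [ray]; push_cast; exact exp_pi_div_two_mul_I

theorem mem_sector_pi_div_two {ζ : ℂ} (hζ : 0 < ζ.re) : ζ ∈ sector (Real.pi / 2) :=
  ⟨Or.inl hζ, abs_arg_lt_pi_div_two_iff.2 (Or.inl hζ)⟩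

theorem periodIntegrand_eq_kernelForm (β : ℂ) (f : ℍ → ℂ) {ζ : ℂ} (hζ : 0 < ζ.re) {y : ℝ}
    (hy : 0 < y) : periodIntegrand β f ζ y =
      kernelForm β (f ∘ ofComplex) ζ (y * ray (Real.pi / 2)) (ray (Real.pi / 2)) := by
  rw [periodIntegrand, eta_eq_etaForm, etaForm_poisson_axis_eq_kernelForm hζ hy, ray_pi_div_two]

/-- The period transform of a function that decays rapidly at the cusps exists. -/
theorem exists_isPeriodTransform {β : ℂ} {f : ℍ → ℂ} (hf : CuspEigen β (f ∘ ofComplex)) :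
    ∃ F : ℂ → ℂ, IsPeriodTransform β f F := by
  have hp := Real.pi_pos
  set w := f ∘ ofComplex with hw
  -- An admissible angle for each `ζ`, halfway between `|arg ζ|` and `π`. Since `key` makes the
  -- integral independent of the angle, near each point it may be frozen, which gives holomorphy;
  -- angle `π / 2` recovers the integral along the imaginary axis.
  set ang : ℂ → ℝ := fun ζ => (|arg ζ| + Real.pi) / 2 with hang
  have hang0 : ∀ ζ, 0 < ang ζ := fun ζ => by
    have := abs_nonneg (arg ζ)
    simp only [hang]; linarith
  have hangπ : ∀ ζ ∈ slitPlane, |arg ζ| < ang ζ ∧ ang ζ < Real.pi := fun ζ hζ => by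
    rw [← sector_pi] at hζ
    have := hζ.2
    simp only [hang]
    constructor <;> linarith
  have hmem : ∀ ζ ∈ slitPlane, ζ ∈ sector (ang ζ) := fun ζ hζ => ⟨hζ, (hangπ ζ hζ).1⟩
  have key : ∀ θ, 0 < θ → θ < Real.pi → ∀ ζ ∈ sector θ,
      rayIntegral β w (ang ζ) ζ = rayIntegral β w θ ζ := fun θ h0 hπ ζ hζ =>
    rayIntegral_congr_angle hf (hang0 ζ) (hangπ ζ hζ.1).2 h0 hπ (hmem ζ hζ.1) hζ
  refine ⟨fun ζ => rayIntegral β w (ang ζ) ζ, fun ζ₀ hζ₀ => ?_, fun ζ hζ => ?_⟩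
  · have hn := (isOpen_sector _).mem_nhds (hmem ζ₀ hζ₀)
    refine DifferentiableAt.differentiableWithinAt ?_
    refine ((differentiableOn_rayIntegral hf (hang0 ζ₀)
      (hangπ ζ₀ hζ₀).2).differentiableAt hn).congr_of_eventuallyEq ?_
    filter_upwards [hn] with ζ hζ using key _ (hang0 ζ₀) (hangπ ζ₀ hζ₀).2 ζ hζ
  · have hs := mem_sector_pi_div_two hζ
    have h0 : 0 < Real.pi / 2 := by positivity
    have hπ : Real.pi / 2 < Real.pi := by linarith
    refine ⟨(integrableOn_kernelForm hf h0 hπ hs).congr_fun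
      (fun y hy => (periodIntegrand_eq_kernelForm β f hζ hy).symm) measurableSet_Ioi, ?_⟩
    refine (key _ h0 hπ ζ hs).trans ?_
    rw [rayIntegral]
    exact setIntegral_congr_fun measurableSet_Ioi fun y hy =>
      (periodIntegrand_eq_kernelForm β f hζ hy).symm

theorem isPeriodTransform_periodTransform {β : ℂ} {f : ℍ → ℂ}
    (hf : CuspEigen β (f ∘ ofComplex)) : IsPeriodTransform β f (periodTransform β f) := by
  have h := exists_isPeriodTransform hf
  rw [periodTransform, dif_pos h]
  exact h.choose_spec

/-- For positive `ζ` the period transform is a difference of limits of a primitive at two cusps. -/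
theorem periodTransform_eq_sub {β : ℂ} {f : ℍ → ℂ} (hf : CuspEigen β (f ∘ ofComplex)) {ζ : ℝ}
    (hζ : 0 < ζ) {Φ : ℂ → ℂ}
    (hΦ : ∀ z : ℂ, 0 < z.im → HasFDerivAt Φ (etaForm (f ∘ ofComplex) (horo β 1 (-ζ)) z) z)
    {L : Matrix (Fin 2) (Fin 2) ℤ → ℂ}
    (hL : ∀ N, 0 < N.det → ∀ e c : ℂ, 0 < e.im →
      Tendsto (fun t : ℝ => Φ (act N (t * e + c))) atTop (𝓝 (L N))) :
    periodTransform β f ζ = L 1 - L matS := by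
  have hζ' : 0 < (ζ : ℂ).re := by simpa using hζ
  have hp := Real.pi_pos
  rw [((isPeriodTransform_periodTransform hf).2 ζ hζ').2,
    ← rayIntegral_eq_sub hf (θ := Real.pi / 2) (by positivity) (by linarith) hζ hΦ hL, rayIntegral]
  exact setIntegral_congr_fun measurableSet_Ioi fun y hy =>
    periodIntegrand_eq_kernelForm β f hζ' hy

end PeriodHecke

/-! ### The map `K` and telescoping along a chain of cusps. -/

namespace PeriodHecke

open Complex Filter Topology InnerProductSpace
open UpperHalfPlane hiding I

section Step

theorem stepK_eq_mul (M : Matrix (Fin 2) (Fin 2) ℤ) : ∃ q : ℤ, stepK M = !![q, -1; 1, 0] * M := by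
  refine ⟨⌈(M 1 1 : ℚ) / (M 0 1 : ℚ)⌉, ?_⟩
  ext a b
  fin_cases a <;> fin_cases b <;> simp [stepK, Matrix.mul_apply, Fin.sum_univ_two] <;> ring

theorem det_stepK (M : Matrix (Fin 2) (Fin 2) ℤ) : (stepK M).det = M.det := by
  obtain ⟨q, hq⟩ := stepK_eq_mul M
  rw [hq, Matrix.det_mul]
  simp [Matrix.det_fin_two]

/-- With `q = ⌈d / b⌉` one has `d ≤ q b < d + b`, so the new upper right entry lies in `[0, b)`.
Since `b < d`, also `q ≥ 2`, which preserves the inequality between the entries of the first column.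
-/
theorem stepK_mem_setS {m : ℕ} {M : Matrix (Fin 2) (Fin 2) ℤ} (hM : M ∈ setS m) (h0 : M 0 1 ≠ 0) :
    stepK M ∈ setS m ∧ stepK M 0 1 < M 0 1 := by
  obtain ⟨h1, h2, h3, h4, h5⟩ := hM
  have hb : 0 < M 0 1 := lt_of_le_of_ne h5 (Ne.symm h0)
  have hbq : (0 : ℚ) < M 0 1 := by exact_mod_cast hb
  set q := ⌈(M 1 1 : ℚ) / (M 0 1 : ℚ)⌉ with hq
  have q2 : 2 ≤ q := by
    have : (1 : ℤ) < q := by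
      rw [hq, Int.lt_ceil, lt_div_iff₀ hbq]
      push_cast
      rw [one_mul]
      exact_mod_cast h4
    omega
  have q3 : M 1 1 ≤ q * M 0 1 := by
    have := Int.le_ceil ((M 1 1 : ℚ) / (M 0 1 : ℚ))
    rw [← hq, div_le_iff₀ hbq] at this
    exact_mod_cast this
  have q4 : q * M 0 1 < M 1 1 + M 0 1 := by
    have := Int.ceil_lt_add_one ((M 1 1 : ℚ) / (M 0 1 : ℚ))
    rw [← hq, ← sub_lt_iff_lt_add, lt_div_iff₀ hbq] at this
    have h6 : (q - 1) * M 0 1 < M 1 1 := by exact_mod_cast this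
    linarith
  have e00 : stepK M 0 0 = -M 1 0 + q * M 0 0 := by simp [stepK, hq]
  have e01 : stepK M 0 1 = -M 1 1 + q * M 0 1 := by simp [stepK, hq]
  have e10 : stepK M 1 0 = M 0 0 := by simp [stepK]
  have e11 : stepK M 1 1 = M 0 1 := by simp [stepK]
  refine ⟨⟨by rw [det_stepK, h1], ?_, ?_, ?_, ?_⟩, ?_⟩
  · rw [e10, e00]; nlinarith
  · rw [e10]; linarith
  · rw [e01, e11]; linarith
  · rw [e01]; linarith
  · rw [e01]; linarith

/-- The upper right entry is a nonnegative integer that strictly decreases until it is zero. -/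
theorem exists_iterate_stepK_mem_setY {m : ℕ} {M : Matrix (Fin 2) (Fin 2) ℤ} (hM : M ∈ setS m) :
    ∃ j, stepK^[j] M ∈ setY m := by
  generalize hr : (M 0 1).toNat = r
  induction r using Nat.strong_induction_on generalizing M with
  | _ r ih =>
    by_cases h0 : M 0 1 = 0
    · exact ⟨0, hM, h0⟩
    · obtain ⟨h1, h2⟩ := stepK_mem_setS hM h0
      have h3 := hM.2.2.2.2
      have h4 := h1.2.2.2.2
      obtain ⟨j, hj⟩ := ih (stepK M 0 1).toNat (by omega) h1 rfl
      exact ⟨j + 1, hj⟩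

theorem iterate_stepCount_mem_setY {m : ℕ} {M : Matrix (Fin 2) (Fin 2) ℤ} (hM : M ∈ setS m) :
    stepK^[stepCount m M] M ∈ setY m :=
  Nat.sInf_mem (s := {j | stepK^[j] M ∈ setY m}) (exists_iterate_stepK_mem_setY hM)

theorem iterate_stepK_mem_setS {m : ℕ} {M : Matrix (Fin 2) (Fin 2) ℤ} (hM : M ∈ setS m) {j : ℕ}
    (hj : j ≤ stepCount m M) : stepK^[j] M ∈ setS m := by
  induction j with
  | zero => exact hM
  | succ j ih =>
    have h1 := ih (by omega)
    have h2 : stepK^[j] M ∉ setY m := Nat.notMem_of_lt_sInf (s := {j | stepK^[j] M ∈ setY m}) hj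
    rw [Function.iterate_succ_apply']
    exact (stepK_mem_setS h1 fun h0 => h2 ⟨h1, h0⟩).1

end Step

/-- An upper triangular matrix fixes `∞` and maps upward lines to upward lines, so `L N` depends
only on the cusp `N∞`. -/
theorem cuspLimit_mul_upper {Φ : ℂ → ℂ} {L : Matrix (Fin 2) (Fin 2) ℤ → ℂ}
    (hL : ∀ N, 0 < N.det → ∀ e c : ℂ, 0 < e.im →
      Tendsto (fun t : ℝ => Φ (act N (t * e + c))) atTop (𝓝 (L N)))
    {N : Matrix (Fin 2) (Fin 2) ℤ} (hN : 0 < N.det) {a b d : ℤ}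
    (h : 0 < a * d) : L (N * !![a, b; 0, d]) = L N := by
  have hdT : (!![a, b; 0, d] : Matrix (Fin 2) (Fin 2) ℤ).det = a * d := by
    simp [Matrix.det_fin_two]
  have hd : (d : ℂ) ≠ 0 := by
    have : d ≠ 0 := by rintro rfl; simp at h
    exact_mod_cast this
  have hr : (0 : ℝ) < (a : ℝ) / d := by
    have h1 : (0 : ℝ) < a * d := by exact_mod_cast h
    have h2 : (d : ℝ) ≠ 0 := by rintro h0; simp [h0] at h1
    rw [show (a : ℝ) / d = a * d / d ^ 2 by field_simp]
    positivity
  have h1 := hL (N * !![a, b; 0, d]) (by rw [Matrix.det_mul, hdT]; positivity) I 0 (by simp)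
  have h2 := hL N hN (((a : ℝ) / d : ℝ) * I) (b / d) (by simpa using hr)
  refine tendsto_nhds_unique (h1.congr' ?_) h2
  filter_upwards [eventually_gt_atTop 0] with t ht
  rw [act_mul (by rw [hdT]; exact h) (by simpa using ht)]
  congr 2
  simp [act, mob]
  field_simp

/-- The cusp identity `(KM)⁻¹∞ = M⁻¹0`: the inverse of `(q, -1; 1, 0)` sends `∞` to `0` for every
`q`. The value of `q` plays no role, so the step is also valid when the upper right entry of `M` is
zero. -/
theorem cuspLimit_adjugate_stepK {Φ : ℂ → ℂ} {L : Matrix (Fin 2) (Fin 2) ℤ → ℂ}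
    (hL : ∀ N, 0 < N.det → ∀ e c : ℂ, 0 < e.im →
      Tendsto (fun t : ℝ => Φ (act N (t * e + c))) atTop (𝓝 (L N)))
    {M : Matrix (Fin 2) (Fin 2) ℤ} (hM : 0 < M.det) :
    L (stepK M).adjugate = L (M.adjugate * matS) := by
  obtain ⟨q, hq⟩ := stepK_eq_mul M
  have h1 : 0 < (M.adjugate * matS).det := by
    rw [Matrix.det_mul, det_matS, Matrix.det_adjugate]; simpa using hM
  have h2 : (stepK M).adjugate = M.adjugate * matS * !![-1, q; 0, -1] := by
    rw [hq, Matrix.adjugate_mul_distrib, Matrix.mul_assoc]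
    congr 1
    simp [Matrix.adjugate_fin_two, matS]
  rw [h2, cuspLimit_mul_upper hL h1 (by norm_num)]

theorem act_pos {m : ℕ} [NeZero m] {G : Matrix (Fin 2) (Fin 2) ℤ} (hG : G ∈ setS m) {ζ : ℝ}
    (hζ : 0 < ζ) : 0 < (G 1 0 : ℝ) * ζ + G 1 1 ∧
      0 < ((G 0 0 : ℝ) * ζ + G 0 1) / ((G 1 0 : ℝ) * ζ + G 1 1) := by
  obtain ⟨h1, h2, h3, h4, h5⟩ := hG
  have a : (0 : ℝ) < G 0 0 := by exact_mod_cast h3.trans_lt h2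
  have b : (0 : ℝ) ≤ G 0 1 := by exact_mod_cast h5
  have c : (0 : ℝ) ≤ G 1 0 := by exact_mod_cast h3
  have d : (0 : ℝ) < G 1 1 := by exact_mod_cast h5.trans_lt h4
  constructor <;> positivity

theorem det_pos_of_mem_setS {m : ℕ} [NeZero m] {G : Matrix (Fin 2) (Fin 2) ℤ} (hG : G ∈ setS m) :
    0 < G.det := by
  rw [hG.1]; exact_mod_cast Nat.pos_of_ne_zero (NeZero.ne m)

/-- `κ⁻¹ * Φ ∘ G⁻¹` is a primitive of `η(g, R_ξ^β)` with `ξ = Gζ`, where `κ` is precisely the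
automorphy factor of the slash action. Its values at `∞` and `0` are those of `κ⁻¹ * Φ` at `G⁻¹∞`
and `G⁻¹0`. -/
theorem slash_periodTransform_eq_sub {m : ℕ} [NeZero m] {β : ℂ} {w : ℂ → ℂ} (hw : IsEigen β w)
    {g : ℍ → ℂ} (hg : CuspEigen β (g ∘ ofComplex)) {G : Matrix (Fin 2) (Fin 2) ℤ}
    (hG : G ∈ setS m) (hwg : ∀ z : ℂ, 0 < z.im → w z = (g ∘ ofComplex) (act G z)) {ζ : ℝ}
    (hζ : 0 < ζ) {Φ : ℂ → ℂ}
    (hΦ : ∀ z : ℂ, 0 < z.im → HasFDerivAt Φ (etaForm w (horo β 1 (-ζ)) z) z)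
    {L : Matrix (Fin 2) (Fin 2) ℤ → ℂ}
    (hL : ∀ N, 0 < N.det → ∀ e c : ℂ, 0 < e.im →
      Tendsto (fun t : ℝ => Φ (act N (t * e + c))) atTop (𝓝 (L N))) :
    slash β (periodTransform β g) G ζ = L G.adjugate - L (G.adjugate * matS) := by
  have hdet := det_pos_of_mem_setS hG
  obtain ⟨hs, hξ⟩ := act_pos hG hζ
  set s : ℝ := (G 1 0 : ℝ) * ζ + G 1 1 with hs_def
  set ξ : ℝ := ((G 0 0 : ℝ) * ζ + G 0 1) / s with hξ_def
  have hdA : G.adjugate.det = G.det := by rw [Matrix.det_adjugate]; simp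
  have hdA0 : 0 < G.adjugate.det := by rw [hdA]; exact hdet
  set κ : ℂ := ((G.det : ℝ) : ℂ) ^ β * (s : ℂ) ^ (-2 * β) with hκ
  have hκ0 : κ ≠ 0 := by
    have h1 : ((G.det : ℝ) : ℂ) ≠ 0 := by exact_mod_cast hdet.ne'
    have h2 : (s : ℂ) ≠ 0 := by exact_mod_cast hs.ne'
    exact mul_ne_zero (fun h => h1 ((cpow_eq_zero_iff _ _).1 h).1)
      fun h => h2 ((cpow_eq_zero_iff _ _).1 h).1
  have hwA : ∀ z : ℂ, 0 < z.im → (w ∘ act G.adjugate) z = (g ∘ ofComplex) z := by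
    intro z hz
    rw [Function.comp_apply, hwg _ (act_im_pos hdA0 hz), ← act_mul hdA0 hz, Matrix.mul_adjugate,
      act_scalar hdet.ne']
  have hΦ' : ∀ z : ℂ, 0 < z.im → HasFDerivAt (fun z => κ⁻¹ * Φ (act G.adjugate z))
      (etaForm (g ∘ ofComplex) (horo β 1 (-ξ)) z) z := by
    intro z hz
    have h1 := (hasFDerivAt_primitive_comp_act hw (Or.inl one_ne_zero) hΦ hdA0 hz).const_mul κ⁻¹
    refine h1.congr_fderiv ?_
    have hev1 : w ∘ act G.adjugate =ᶠ[𝓝 z] g ∘ ofComplex := by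
      filter_upwards [isOpen_upperHalfPlaneSet.mem_nhds hz] with y hy using hwA y hy
    -- The row identity `(1, -ζ) * adj G = s * (1, -ξ)` together with homogeneity.
    have hev2 : horo β (1 * G.adjugate 0 0 + -ζ * G.adjugate 1 0)
        (1 * G.adjugate 0 1 + -ζ * G.adjugate 1 1) =ᶠ[𝓝 z]
        fun y => (s : ℂ) ^ (-2 * β) * horo β 1 (-ξ) y := by
      filter_upwards [isOpen_upperHalfPlaneSet.mem_nhds hz] with y hy
      rw [← horo_smul hs β 1 (-ξ) hy]
      congr 1
      · simp [Matrix.adjugate_fin_two, hs_def]; ring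
      · have : s * -ξ = -((G 0 0 : ℝ) * ζ + G 0 1) := by rw [hξ_def]; field_simp
        rw [this]
        simp [Matrix.adjugate_fin_two]; ring
    rw [etaForm_congr hev1 hev2, etaForm_const_mul_right _ _ _
      ((isEigen_horo (Or.inl one_ne_zero) β).differentiableAt hz), hdA, smul_smul, smul_smul, mul_assoc,
      ← hκ,
      inv_mul_cancel₀ hκ0, one_smul]
  have hL' : ∀ N : Matrix (Fin 2) (Fin 2) ℤ, 0 < N.det → ∀ e c : ℂ, 0 < e.im →
      Tendsto (fun t : ℝ => κ⁻¹ * Φ (act G.adjugate (act N (t * e + c)))) atTop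
        (𝓝 (κ⁻¹ * L (G.adjugate * N))) := by
    intro N hN e c he
    refine ((hL (G.adjugate * N) (by rw [Matrix.det_mul]; positivity) e c he).const_mul
      κ⁻¹).congr' ?_
    filter_upwards [eventually_gt_atTop (-c.im / e.im)] with t ht
    rw [act_mul hN]
    rw [div_lt_iff₀ he] at ht
    simp
    linarith
  have key := periodTransform_eq_sub hg hξ hΦ' (L := fun N => κ⁻¹ * L (G.adjugate * N)) hL'
  have habs : ((|G.det| : ℤ) : ℂ) = ((G.det : ℝ) : ℂ) := by rw [abs_of_pos hdet]; simp
  have e1 : (G 1 0 : ℂ) * ζ + (G 1 1 : ℂ) = s := by rw [hs_def]; push_cast; rfl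
  have e2 : ((G 0 0 : ℂ) * ζ + (G 0 1 : ℂ)) / ((G 1 0 : ℂ) * ζ + (G 1 1 : ℂ)) = ξ := by
    rw [e1, hξ_def]; push_cast; rfl
  rw [slash, e2, e1, habs, key, ← hκ, mul_one]
  field_simp

/-- The period transform of `w` along `0 → i∞`, decomposed along the chain of cusps given by the
iterates of `K`. -/
theorem sum_slash_periodTransform {m : ℕ} [NeZero m] {β : ℂ} {W : ℍ → ℂ}
    (hW : CuspEigen β (W ∘ ofComplex)) {A : Matrix (Fin 2) (Fin 2) ℤ} (hA : A ∈ setS m)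
    (hA0 : A 1 0 = 0) {g : ℕ → ℍ → ℂ} (hg : ∀ j, CuspEigen β (g j ∘ ofComplex))
    (hWg : ∀ j, ∀ z : ℂ, 0 < z.im →
      (W ∘ ofComplex) z = (g j ∘ ofComplex) (act (stepK^[j] A) z)) {ζ : ℝ} (hζ : 0 < ζ) :
    ∑ j ∈ Finset.range (stepCount m A + 1),
      slash β (periodTransform β (g j)) (stepK^[j] A) ζ = periodTransform β W ζ := by
  obtain ⟨Φ, L, hΦ, hL⟩ := exists_primitive_horo hW ζ
  rw [periodTransform_eq_sub hW hζ hΦ hL]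
  -- The last difference uses one iterate beyond `stepCount`, where `K` is applied to a matrix with
  -- upper right entry zero. The quotient by zero makes `q = 0` there, and the cusp identity still
  -- holds.
  have hterm : ∀ j ∈ Finset.range (stepCount m A + 1),
      slash β (periodTransform β (g j)) (stepK^[j] A) ζ =
        L (stepK^[j] A).adjugate - L (stepK^[j + 1] A).adjugate := by
    intro j hj
    have hS := iterate_stepK_mem_setS hA (Nat.lt_succ_iff.1 (Finset.mem_range.1 hj))
    rw [slash_periodTransform_eq_sub hW.isEigen (hg j) hS (hWg j) hζ hΦ hL,
      Function.iterate_succ_apply', cuspLimit_adjugate_stepK hL (det_pos_of_mem_setS hS)]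
  rw [Finset.sum_congr rfl hterm, Finset.sum_range_sub' (fun j => L (stepK^[j] A).adjugate)]
  have hY := iterate_stepCount_mem_setY hA
  congr 1
  -- The chain starts at `A⁻¹∞ = ∞`, as `A` is upper triangular.
  · obtain ⟨h1, h2, h3, h4, h5⟩ := hA
    have : A.adjugate = 1 * !![A 1 1, -A 0 1; 0, A 0 0] := by
      rw [one_mul, Matrix.adjugate_fin_two, hA0, neg_zero]
    rw [Function.iterate_zero_apply, this]
    refine cuspLimit_mul_upper hL (by simp) (mul_pos ?_ ?_) <;> omega
  -- The chain ends at `X⁻¹0 = 0`, as the last iterate `X` is lower triangular.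
  · rw [Function.iterate_succ_apply', cuspLimit_adjugate_stepK hL (det_pos_of_mem_setS hY.1)]
    obtain ⟨⟨h1, h2, h3, h4, h5⟩, h6⟩ := hY
    set X := stepK^[stepCount m A] A
    have : X.adjugate * matS = matS * !![X 0 0, X 1 0; 0, X 1 1] := by
      rw [Matrix.adjugate_fin_two, h6]
      simp [matS]
    rw [this]
    refine cuspLimit_mul_upper hL (by rw [det_matS]; norm_num) (mul_pos ?_ ?_) <;> omega

end PeriodHecke

/-! ### Cosets of `Γ₀(n)`, the permutation `hₙ` and the matrices `Aᵢ`. -/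

namespace PeriodHecke

open UpperHalfPlane hiding I
open CongruenceSubgroup Matrix.SpecialLinearGroup

/-- The index `[x : y]ₙ` of the lower row of a matrix in `SL(2, ℤ)`. -/
def rowIdx (n : ℕ) (γ : SL(2, ℤ)) : Idx n :=
  Quotient.mk _ ⟨(γ.1 1 0, γ.1 1 1), by
    have h := γ.2
    rw [Matrix.det_fin_two] at h
    have : Int.gcd (γ.1 1 0) (γ.1 1 1) = 1 := Int.isCoprime_iff_gcd_eq_one.1
      ⟨-γ.1 0 1, γ.1 0 0, by linear_combination h⟩
    simp [this]⟩

theorem mem_gamma0_iff_dvd {n : ℕ} {γ : SL(2, ℤ)} : γ ∈ Gamma0 n ↔ (n : ℤ) ∣ γ.1 1 0 := by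
  rw [Gamma0_mem]
  exact ZMod.intCast_zmod_eq_zero_iff_dvd _ _

/-- The lower left entry of `γ' γ⁻¹` is the determinant of the two lower rows up to sign, so it
vanishes modulo `n` for proportional rows. Conversely the factor of proportionality is the lower
right entry, a unit modulo `n`. Thus `Iₙ` is `Γ₀(n) \ SL(2, ℤ)`. -/
theorem rowIdx_eq_iff {n : ℕ} {γ γ' : SL(2, ℤ)} :
    rowIdx n γ = rowIdx n γ' ↔ γ' * γ⁻¹ ∈ Gamma0 n := by
  have hd := γ.2
  have hd' := (γ' * γ⁻¹).2
  rw [Matrix.det_fin_two] at hd hd'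
  have e : (γ' * γ⁻¹).1 1 0 = γ'.1 1 0 * γ.1 1 1 - γ'.1 1 1 * γ.1 1 0 := by
    rw [coe_mul, coe_inv, Matrix.adjugate_fin_two]
    simp [Matrix.mul_apply, Fin.sum_univ_two]
    ring
  rw [mem_gamma0_iff_dvd]
  constructor
  · intro h
    obtain ⟨k, hk, h1, h2⟩ : scaleRel n _ _ := Quotient.exact h
    obtain ⟨s, hs⟩ := h1.dvd
    obtain ⟨t, ht⟩ := h2.dvd
    rw [e]
    exact ⟨t * γ.1 1 0 - s * γ.1 1 1, by linear_combination γ.1 1 0 * ht - γ.1 1 1 * hs⟩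
  · intro h
    have hγ : γ'.1 = (γ' * γ⁻¹).1 * γ.1 := by rw [← coe_mul, inv_mul_cancel_right]
    set δ := (γ' * γ⁻¹).1
    obtain ⟨t, ht⟩ := h
    have h0 : γ'.1 1 0 = δ 1 0 * γ.1 0 0 + δ 1 1 * γ.1 1 0 := by
      rw [hγ, Matrix.mul_apply, Fin.sum_univ_two]
    have h1 : γ'.1 1 1 = δ 1 0 * γ.1 0 1 + δ 1 1 * γ.1 1 1 := by
      rw [hγ, Matrix.mul_apply, Fin.sum_univ_two]
    refine Quotient.sound ⟨δ 1 1, Int.isCoprime_iff_gcd_eq_one.1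
      ⟨δ 0 0, -δ 0 1 * t, by linear_combination hd' + δ 0 1 * ht⟩, ?_, ?_⟩
    · exact (Int.modEq_iff_dvd.2 ⟨t * γ.1 0 0, by
        linear_combination h0 + γ.1 0 0 * ht⟩ : _ ≡ _ [ZMOD _]).symm
    · exact (Int.modEq_iff_dvd.2 ⟨t * γ.1 0 1, by
        linear_combination h1 + γ.1 0 1 * ht⟩ : _ ≡ _ [ZMOD _]).symm

theorem rowIdx_cosetRep (n : ℕ) [NeZero n] (i : Idx n) : rowIdx n (cosetRep n i) = i :=
  (idxEquiv n).apply_symm_apply i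

theorem proj_rowIdx {d N : ℕ} (h : d ∣ N) (γ : SL(2, ℤ)) : proj h (rowIdx N γ) = rowIdx d γ := rfl

theorem rowIdx_mul_left {n : ℕ} {δ : SL(2, ℤ)} (hδ : δ ∈ Gamma0 n) (γ : SL(2, ℤ)) :
    rowIdx n (δ * γ) = rowIdx n γ :=
  (rowIdx_eq_iff.2 (by rwa [mul_inv_cancel_right])).symm

/-- The translation `z ↦ z + 1`. -/
abbrev matT : SL(2, ℤ) := ModularGroup.T

theorem mul_matT_lower_row (γ : SL(2, ℤ)) :
    (γ * matT).1 1 0 = γ.1 1 0 ∧ (γ * matT).1 1 1 = γ.1 1 0 + γ.1 1 1 := by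
  constructor <;> rw [coe_mul, Matrix.mul_apply, Fin.sum_univ_two] <;> simp [ModularGroup.T]

/-- `hₙ` is right multiplication by `T`: the number `dₙ(c, b')` is congruent to `c + b'`, hence to
`c + d`, modulo `n / c`, and `(c, c + d)` is the lower row of `Rᵢ T`. -/
theorem hMap_rowIdx (n : ℕ) [NeZero n] (γ : SL(2, ℤ)) :
    hMap n (rowIdx n γ) = rowIdx n (γ * matT) := by
  have h0 : hMap n (rowIdx n γ) = rowIdx n (cosetRep n (rowIdx n γ) * matT) := by
    set p := (idxEquiv n).symm (rowIdx n γ) with hp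
    obtain ⟨h1, -⟩ := dMin_spec p
    have hlt := Nat.mod_lt (dMin n p.1.1 p.1.2) p.pos.2
    let q : DivPair n := ⟨(p.1.1, dMin n p.1.1 p.1.2 % (n / p.1.1)), p.2.1, hlt,
      gcd_mod_eq_one h1⟩
    obtain ⟨h2, k, h3⟩ := dMin_spec q
    have e : hMap n (rowIdx n γ) = toIdx n q := rfl
    rw [e]
    suffices er : scaleRel n ((p.1.1 : ℤ), (p.1.1 : ℤ) + dMin n p.1.1 p.1.2)
        ((q.1.1 : ℤ), (dMin n q.1.1 q.1.2 : ℤ)) by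
      obtain ⟨e0, e1⟩ := mul_matT_lower_row (cosetRep n (rowIdx n γ))
      refine Quotient.sound (scaleRel_symm ?_)
      change scaleRel n ((cosetRep n (rowIdx n γ) * matT).1 1 0,
        (cosetRep n (rowIdx n γ) * matT).1 1 1) _
      rw [e0, e1]
      exact er
    refine scaleRel_of_modEq p.2.1 ?_ ?_ ?_
    · simpa [Int.gcd_natCast_natCast] using h1
    · rw [Int.gcd_natCast_natCast]; exact h2
    · rw [h3]
      simp only [q]
      obtain ⟨t, ht⟩ := (Int.mod_modEq (dMin n p.1.1 p.1.2 : ℤ) (n / p.1.1 : ℕ)).dvd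
      refine (Int.modEq_iff_dvd.2 ⟨k - t, ?_⟩ : _ ≡ _ [ZMOD _]).symm
      push_cast at ht ⊢
      linear_combination -ht
  rw [h0, rowIdx_eq_iff]
  have := rowIdx_eq_iff.1 (rowIdx_cosetRep n (rowIdx n γ))
  simpa [mul_assoc] using this

theorem hMap_injective (n : ℕ) [NeZero n] : Function.Injective (hMap n) := by
  intro i j h
  rw [← rowIdx_cosetRep n i, ← rowIdx_cosetRep n j, hMap_rowIdx, hMap_rowIdx, rowIdx_eq_iff] at h
  rw [← rowIdx_cosetRep n i, ← rowIdx_cosetRep n j, rowIdx_eq_iff]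
  simpa [mul_assoc] using h

/-- `hₙ` as a permutation of `Iₙ`. -/
noncomputable def hEquiv (n : ℕ) [NeZero n] : Idx n ≃ Idx n :=
  Equiv.ofBijective (hMap n) (Finite.injective_iff_bijective.1 (hMap_injective n))

theorem hEquiv_rowIdx (n : ℕ) [NeZero n] (γ : SL(2, ℤ)) :
    hEquiv n (rowIdx n γ) = rowIdx n (γ * matT) := hMap_rowIdx n γ

theorem proj_hEquiv {d N : ℕ} [NeZero d] [NeZero N] (h : d ∣ N) (i : Idx N) :
    proj h (hEquiv N i) = hEquiv d (proj h i) := by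
  rw [← rowIdx_cosetRep N i, hEquiv_rowIdx, proj_rowIdx, proj_rowIdx, hEquiv_rowIdx]

/-- Row `i` of the permutation matrix has its only entry `1` in the column `j` with `hₙ(j) = i`. -/
theorem hAct_eq (n : ℕ) [NeZero n] (φ : Idx n → ℂ → ℂ) (i : Idx n) :
    hAct n φ i = φ ((hEquiv n).symm i) := by
  ext z
  simp only [hAct, hMatrix, Matrix.mulVec, dotProduct, Matrix.of_apply, ite_mul, one_mul, zero_mul]
  rw [Finset.sum_eq_single ((hEquiv n).symm i)]
  · rw [if_pos]; exact (hEquiv n).apply_symm_apply i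
  · intro j _ hj
    rw [if_neg]
    rintro rfl
    exact hj ((hEquiv n).symm_apply_apply j).symm
  · simp

/-- The matrix `B_m = (m, 0; 0, 1)`. -/
def matB (m : ℕ) : Matrix (Fin 2) (Fin 2) ℤ := !![(m : ℤ), 0; 0, 1]

theorem det_matB (m : ℕ) : (matB m).det = m := by simp [matB]

theorem matB_mul (n m : ℕ) : matB (n * m) = matB n * matB m := by simp [matB]

/-- Conjugation by `B_m` carries `Γ₀(nm)` into `Γ₀(n)`; `mem_gamma0_of_matB_mul` is a partial
converse. -/
theorem exists_matB_mul {n m : ℕ} {δ : SL(2, ℤ)} (hδ : δ ∈ Gamma0 (n * m)) :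
    ∃ δ' ∈ Gamma0 n, matB m * δ.1 = δ'.1 * matB m := by
  obtain ⟨t, ht⟩ := mem_gamma0_iff_dvd.1 hδ
  have hd := δ.2
  rw [Matrix.det_fin_two] at hd
  push_cast at ht
  refine ⟨⟨!![δ.1 0 0, m * δ.1 0 1; n * t, δ.1 1 1], ?_⟩, mem_gamma0_iff_dvd.2 ⟨t, ?_⟩, ?_⟩
  · rw [Matrix.det_fin_two_of]
    linear_combination hd + δ.1 0 1 * ht
  · simp
  · ext a b
    fin_cases a <;> fin_cases b <;> simp [matB, Matrix.mul_apply, Fin.sum_univ_two]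
    · ring
    · linear_combination ht

theorem mem_gamma0_of_matB_mul {n : ℕ} {γ δ : SL(2, ℤ)} (h : matB n * δ.1 = γ.1 * matB n) :
    δ ∈ Gamma0 n := by
  rw [mem_gamma0_iff_dvd]
  have := congrFun (congrFun h 1) 0
  simp [matB, Matrix.mul_apply, Fin.sum_univ_two] at this
  exact ⟨γ.1 1 0, by rw [mul_comm]; exact this⟩

theorem matB_mul_eq (n : ℕ) (M : Matrix (Fin 2) (Fin 2) ℤ) :
    matB n * M = !![n * M 0 0, n * M 0 1; M 1 0, M 1 1] := by
  ext a b
  fin_cases a <;> fin_cases b <;> simp [matB, Matrix.mul_apply, Fin.sum_univ_two]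

theorem matA_idxEquiv (n : ℕ) [NeZero n] (p : DivPair n) :
    matA n (idxEquiv n p) = triMat n p.1.1 p.1.2 := by
  rw [matA, Equiv.symm_apply_apply]

/-- Explains the role of `hₙ`: it translates between `Aᵢ`, a Hermite representative of `SL(2, ℤ) \
SL(2, ℤ) B_n SL(2, ℤ)`, and the coset representative `R` in `B_n R`. -/
theorem exists_matA_rowIdx (n : ℕ) [NeZero n] (R : SL(2, ℤ)) :
    ∃ γ : SL(2, ℤ), matA n (rowIdx n (R * matT)) = γ.1 * (matB n * R.1) := by
  have key : ∃ γ : SL(2, ℤ), matA n (rowIdx n (R * matT)) =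
      γ.1 * (matB n * (cosetRep n (rowIdx n R)).1) := by
    rw [← hMap_rowIdx]
    set Q := cosetRep n (rowIdx n R) with hQ
    have hdet := Q.2
    rw [Matrix.det_fin_two] at hdet
    set p := (idxEquiv n).symm (rowIdx n R) with hp
    have hn := p.mul_div
    have hA : matA n (hMap n (rowIdx n R)) =
        triMat n p.1.1 (dMin n p.1.1 p.1.2 % (n / p.1.1)) := by
      exact matA_idxEquiv n ⟨(p.1.1, dMin n p.1.1 p.1.2 % (n / p.1.1)), p.2.1,
        Nat.mod_lt _ p.pos.2, gcd_mod_eq_one (dMin_spec p).1⟩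
    have hQ10 : Q.1 1 0 = p.1.1 := by simp [hQ, cosetRep, ← hp]
    have hQ11 : Q.1 1 1 = dMin n p.1.1 p.1.2 := by simp [hQ, cosetRep, ← hp]
    have hdiv : ((dMin n p.1.1 p.1.2 % (n / p.1.1) : ℕ) : ℤ) +
        (n / p.1.1 : ℕ) * (dMin n p.1.1 p.1.2 / (n / p.1.1) : ℕ) = dMin n p.1.1 p.1.2 := by
      exact_mod_cast Nat.mod_add_div _ _
    rw [hA, triMat]
    rw [hQ10, hQ11] at hdet
    generalize dMin n p.1.1 p.1.2 % (n / p.1.1) = b at *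
    generalize dMin n p.1.1 p.1.2 / (n / p.1.1) = t at *
    generalize dMin n p.1.1 p.1.2 = d at *
    generalize n / p.1.1 = e at *
    generalize p.1.1 = c at *
    -- The entries of `A (B_n Q)⁻¹`, which are integral because `n = c e` and `d = b + e t`.
    refine ⟨⟨!![(t : ℤ), b * Q.1 0 0 - c * Q.1 0 1; -1, e * Q.1 0 0], ?_⟩, ?_⟩
    · rw [Matrix.det_fin_two_of]
      linear_combination hdet + Q.1 0 0 * hdiv
    · have e00 : (c : ℤ) = t * (n * Q.1 0 0) + (b * Q.1 0 0 - c * Q.1 0 1) * c := by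
        rw [← hn]
        linear_combination -c * hdet - c * Q.1 0 0 * hdiv
      have e01 : (b : ℤ) = t * (n * Q.1 0 1) + (b * Q.1 0 0 - c * Q.1 0 1) * d := by
        rw [← hn]
        linear_combination -b * hdet - c * Q.1 0 1 * hdiv
      have e10 : (0 : ℤ) = -(n * Q.1 0 0) + e * Q.1 0 0 * c := by rw [← hn]; ring
      have e11 : (e : ℤ) = -(n * Q.1 0 1) + e * Q.1 0 0 * d := by
        rw [← hn]; linear_combination -e * hdet
      rw [matB_mul_eq, hQ10, hQ11]
      ext i j
      fin_cases i <;> fin_cases j <;> simp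
      · exact e00
      · exact e01
      · exact e10
      · exact e11
  obtain ⟨γ, hγ⟩ := key
  -- An arbitrary `R` differs from the chosen representative by an element of `Γ₀(n)`, which `B_n`
  -- conjugates into `SL(2, ℤ)`.
  have h1 := rowIdx_eq_iff.1 (rowIdx_cosetRep n (rowIdx n R)).symm
  obtain ⟨δ, -, hδ⟩ := exists_matB_mul (n := 1) (m := n) (by rwa [one_mul])
  refine ⟨γ * δ, ?_⟩
  rw [hγ, coe_mul, Matrix.mul_assoc γ.1, ← Matrix.mul_assoc δ.1, ← hδ, Matrix.mul_assoc (matB n),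
    ← coe_mul, inv_mul_cancel_right]

theorem transferIdx_spec (n m : ℕ) [NeZero n] [NeZero m] (i : Idx (n * m)) (j : ℕ) :
    ∃ γ : SL(2, ℤ), matA n (transferIdx n m i j) *
      stepK^[j] (matA m (proj (dvd_mul_left m n) i)) = γ.1 * matA (n * m) i :=
  (existsUnique_transfer n m i j).choose_spec.1

/-- In `A_l K^j(A_σ) = γ A_s`, write each triangular matrix as a unimodular one times `B_n Q`, `B_m
R` or `B_n B_m R`, and cancel `B_m R` on the right. What remains says that `B_n` conjugates `δ` to
an integral matrix, that is, `δ ∈ Γ₀(n)`. -/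
theorem exists_gamma0_transfer {n m : ℕ} [NeZero n] [NeZero m] {s : Idx (n * m)} {j : ℕ}
    {R Q : SL(2, ℤ)} (hR : rowIdx (n * m) (R * matT) = s)
    (hQ : rowIdx n (Q * matT) = transferIdx n m s j) :
    ∃ δ ∈ Gamma0 n, Q.1 * stepK^[j] (matA m (proj (dvd_mul_left m n) s)) =
      δ.1 * (matB m * R.1) := by
  obtain ⟨γ, hγ⟩ := transferIdx_spec n m s j
  obtain ⟨γ₁, h1⟩ := exists_matA_rowIdx n Q
  obtain ⟨γ₂, h2⟩ := exists_matA_rowIdx (n * m) R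
  obtain ⟨γ₃, h3⟩ := exists_matA_rowIdx m R
  obtain ⟨H, hH⟩ := stepK_iterate (matA m (proj (dvd_mul_left m n) s)) j
  rw [hQ] at h1
  rw [hR] at h2
  rw [← proj_rowIdx (dvd_mul_left m n), hR] at h3
  rw [hH, h1, h2, h3, matB_mul] at hγ
  have hinj : ∀ X Y : Matrix (Fin 2) (Fin 2) ℤ, X * (matB m * R.1) = Y * (matB m * R.1) →
      X = Y := by
    intro X Y h
    have hm : (m : ℤ) ≠ 0 := by exact_mod_cast NeZero.ne m
    have hd : (matB m * R.1).det = m := by rw [Matrix.det_mul, det_matB, R.2, mul_one]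
    have := congrArg (· * (matB m * R.1).adjugate) h
    simp only [Matrix.mul_assoc X, Matrix.mul_assoc Y, Matrix.mul_adjugate, hd, Matrix.mul_smul,
      mul_one] at this
    exact smul_right_injective _ hm this
  have h4 : γ₁.1 * (matB n * (Q * H * γ₃).1) = γ.1 * γ₂.1 * matB n := by
    apply hinj
    simpa only [coe_mul, Matrix.mul_assoc] using hγ
  have h5 : matB n * (Q * H * γ₃).1 = (γ₁⁻¹ * γ * γ₂).1 * matB n := by
    rw [mul_assoc γ₁⁻¹, coe_mul γ₁⁻¹, coe_mul γ, Matrix.mul_assoc, ← h4, ← Matrix.mul_assoc,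
      ← coe_mul γ₁⁻¹, inv_mul_cancel, coe_one, one_mul]
  refine ⟨Q * H * γ₃, mem_gamma0_of_matB_mul h5, ?_⟩
  rw [hH, h3]
  simp only [coe_mul, Matrix.mul_assoc]

theorem matA_mem_setS (m : ℕ) [NeZero m] (i : Idx m) : matA m i ∈ setS m ∧ matA m i 1 0 = 0 := by
  have hp := ((idxEquiv m).symm i).pos
  have hlt := ((idxEquiv m).symm i).2.2.1
  refine ⟨⟨triMat_det _, ?_, ?_, ?_, ?_⟩, ?_⟩ <;> simp [matA, triMat]
  · exact hp.1
  · exact_mod_cast hlt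

end PeriodHecke

/-! ### Cusp forms, the Hecke operator, and the identity on the positive axis. -/

namespace PeriodHecke

open Complex Filter Topology InnerProductSpace
open UpperHalfPlane hiding I
open CongruenceSubgroup

section Forms

theorem comp_ofComplex_act (u : ℍ → ℂ) (γ : SL(2, ℤ)) {z : ℂ} (hz : 0 < z.im) :
    (u ∘ ofComplex) (act γ.1 z) = u (γ • ofComplex z) := by
  have h : ((ofComplex z : ℍ) : ℂ) = z := by rw [ofComplex_apply_of_im_pos hz]
  have h1 := coe_smul_eq_act γ (ofComplex z)
  rw [h] at h1
  rw [Function.comp_apply, ← h1, ofComplex_apply]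

/-- Column reduction by the gcd. It reduces decay along any integer matrix to decay at a cusp `γ∞`,
up to an affine change of variable. -/
theorem exists_eq_mul_upper {M : Matrix (Fin 2) (Fin 2) ℤ} (hM : 0 < M.det) :
    ∃ (γ : SL(2, ℤ)) (a b d : ℤ), 0 < a ∧ 0 < d ∧ M = γ.1 * !![a, b; 0, d] := by
  rw [Matrix.det_fin_two] at hM
  have hne : Int.gcd (M 0 0) (M 1 0) ≠ 0 := by
    intro h
    rw [Int.gcd_eq_zero_iff] at h
    rw [h.1, h.2] at hM
    simp at hM
  have hbez := Int.gcd_eq_gcd_ab (M 0 0) (M 1 0)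
  obtain ⟨x, hx⟩ := Int.gcd_dvd_left (a := M 0 0) (b := M 1 0)
  obtain ⟨y, hy⟩ := Int.gcd_dvd_right (a := M 0 0) (b := M 1 0)
  generalize Int.gcdA (M 0 0) (M 1 0) = s at hbez
  generalize Int.gcdB (M 0 0) (M 1 0) = t at hbez
  have hc : (0 : ℤ) < Int.gcd (M 0 0) (M 1 0) := by exact_mod_cast Nat.pos_of_ne_zero hne
  generalize (Int.gcd (M 0 0) (M 1 0) : ℤ) = c at *
  have h1 : x * s + y * t = 1 := by
    rw [hx, hy] at hbez
    exact mul_left_cancel₀ hc.ne' (by linear_combination -hbez)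
  have hd : 0 < x * M 1 1 - y * M 0 1 := by
    rw [hx, hy] at hM
    exact pos_of_mul_pos_right (by linarith : 0 < c * (x * M 1 1 - y * M 0 1)) hc.le
  refine ⟨⟨!![x, -t; y, s], by rw [Matrix.det_fin_two_of]; linear_combination h1⟩,
    c, s * M 0 1 + t * M 1 1, x * M 1 1 - y * M 0 1, hc, hd, ?_⟩
  ext i j
  fin_cases i <;> fin_cases j <;> simp [Matrix.mul_apply, Fin.sum_univ_two]
  · linear_combination hx
  · linear_combination -M 0 1 * h1
  · linear_combination hy
  · linear_combination -M 1 1 * h1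

theorem act_upper_im {a b d : ℤ} (hd : 0 < d) (z : ℂ) :
    (act !![a, b; 0, d] z).im = a / d * z.im := by
  have hd' : (d : ℝ) ≠ 0 := by exact_mod_cast hd.ne'
  have : act !![a, b; 0, d] z = ((a / d : ℝ) : ℂ) * z + ((b / d : ℝ) : ℂ) := by
    have : (d : ℂ) ≠ 0 := by exact_mod_cast hd.ne'
    simp [act, mob]
    field_simp
  rw [this, Complex.add_im, Complex.im_ofReal_mul, Complex.ofReal_im, add_zero]

theorem IsMaassCuspForm.cuspEigen {n : ℕ} {β : ℂ} {u : ℍ → ℂ} (hu : IsMaassCuspForm n β u) :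
    CuspEigen β (u ∘ ofComplex) := by
  refine ⟨hu.analytic, fun z hz => ?_, fun M hM k => ?_⟩
  · have := hu.eigen ⟨z, hz⟩
    rw [Function.comp_apply, ofComplex_apply_of_im_pos hz]
    exact this
  · obtain ⟨γ, a, b, d, ha, hd, rfl⟩ := exists_eq_mul_upper hM
    obtain ⟨K, hK⟩ := Asymptotics.isBigO_iff.1 (hu.decay γ (-k))
    obtain ⟨Y, hY⟩ := (atImInfty_mem _).1 hK
    have hdet : 0 < (!![a, b; 0, d] : Matrix (Fin 2) (Fin 2) ℤ).det := by
      rw [Matrix.det_fin_two_of]; simp; positivity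
    have hr : (0 : ℝ) < (a : ℝ) / d := by
      have : (0 : ℝ) < a := by exact_mod_cast ha
      have : (0 : ℝ) < d := by exact_mod_cast hd
      positivity
    refine ⟨K * ((a : ℝ) / d) ^ (-(k : ℝ)), max 1 (Y / (a / d)), by positivity, fun z hz => ?_⟩
    have hz0 : 0 < z.im := one_pos.trans_le ((le_max_left _ _).trans hz)
    have hz1 := (le_max_right _ _).trans hz
    rw [div_le_iff₀ hr] at hz1
    have h1 := act_im_pos hdet hz0
    rw [act_mul hdet hz0, comp_ofComplex_act u γ h1, ofComplex_apply_of_im_pos h1]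
    have h2 : (a / d : ℝ) * z.im = (act !![a, b; 0, d] z).im := (act_upper_im hd z).symm
    have h3 := hY ⟨_, h1⟩ (by change Y ≤ (act !![a, b; 0, d] z).im; rw [← h2]; linarith)
    simp only [Set.mem_ofPred_eq] at h3
    change _ ≤ K * ‖((act !![a, b; 0, d] z).im) ^ (-(k : ℝ))‖ at h3
    rw [← h2, Real.norm_of_nonneg (by positivity), Real.mul_rpow hr.le hz0.le] at h3
    calc _ ≤ K * ((a / d : ℝ) ^ (-(k : ℝ)) * z.im ^ (-(k : ℝ))) * z.im ^ k := by gcongr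
      _ = K * (a / d : ℝ) ^ (-(k : ℝ)) * (z.im ^ (-(k : ℝ)) * z.im ^ k) := by ring
      _ = _ := by
        rw [← Real.rpow_natCast z.im k, ← Real.rpow_add hz0, neg_add_cancel, Real.rpow_zero,
          mul_one]

theorem CuspEigen.isMaassCuspForm {n : ℕ} {β : ℂ} {u : ℍ → ℂ} (h : CuspEigen β (u ∘ ofComplex))
    (hinv : ∀ g ∈ Gamma0 n, ∀ z : ℍ, u (g • z) = u z) : IsMaassCuspForm n β u := by
  refine ⟨h.analytic, hinv, fun z => ?_, fun g C => ?_⟩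
  · have := h.eigen z z.im_pos
    rwa [Function.comp_apply, ofComplex_apply] at this
  · obtain ⟨k, hk⟩ := exists_nat_ge (-C)
    obtain ⟨K, Y, hY, hK⟩ := h.decay g.1 (by rw [g.2]; exact one_pos) k
    refine Asymptotics.isBigO_iff.2 ⟨K, (atImInfty_mem _).2 ⟨max 1 Y, fun z hz => ?_⟩⟩
    have h1 : 1 ≤ z.im := (le_max_left _ _).trans hz
    have h2 := hK z ((le_max_right _ _).trans hz)
    rw [comp_ofComplex_act u g z.im_pos, ofComplex_apply] at h2
    have hz0 := z.im_pos
    have hK0 : 0 ≤ K := (mul_nonneg (norm_nonneg _) (pow_nonneg hz0.le _)).trans h2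
    change ‖u (g • z)‖ ≤ K * ‖z.im ^ C‖
    rw [Real.norm_of_nonneg (by positivity)]
    calc ‖u (g • z)‖ ≤ K * z.im ^ (-(k : ℝ)) := by
          rw [Real.rpow_neg hz0.le, Real.rpow_natCast, ← div_eq_mul_inv,
            le_div_iff₀ (by positivity)]
          exact h2
      _ ≤ K * z.im ^ C := by
          gcongr
          linarith

end Forms

section Hecke

theorem IsMaassCuspForm.act_gamma0 {n : ℕ} {β : ℂ} {u : ℍ → ℂ} (hu : IsMaassCuspForm n β u)
    {δ : SL(2, ℤ)} (hδ : δ ∈ Gamma0 n) {z : ℂ} (hz : 0 < z.im) :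
    (u ∘ ofComplex) (act δ.1 z) = (u ∘ ofComplex) z := by
  rw [comp_ofComplex_act u δ hz, hu.invariant δ hδ, Function.comp_apply]

theorem det_matB_mul_pos (m : ℕ) [NeZero m] (γ : SL(2, ℤ)) : 0 < (matB m * γ.1).det := by
  rw [Matrix.det_mul, det_matB, γ.2, mul_one]
  exact_mod_cast Nat.pos_of_ne_zero (NeZero.ne m)

theorem dilate_smul {m : ℕ} (u : ℍ → ℂ) (γ : SL(2, ℤ)) (z : ℍ) :
    dilate m u (γ • z) = (u ∘ ofComplex) (act (matB m * γ.1) z) := by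
  rw [act_mul (by rw [γ.2]; exact one_pos) z.im_pos, ← coe_smul_eq_act, dilate, Function.comp_apply]
  congr 2
  simp [act, mob, matB]

/-- A change of `γ` by `Γ₀(nm)` on the left passes through `B_m` as an element of `Γ₀(n)`, under
which `u` is invariant. So the Hecke sum may use any representatives. -/
theorem IsMaassCuspForm.act_matB_congr {n m : ℕ} [NeZero m] {β : ℂ} {u : ℍ → ℂ}
    (hu : IsMaassCuspForm n β u) {γ γ' : SL(2, ℤ)}
    (h : rowIdx (n * m) γ = rowIdx (n * m) γ') {z : ℂ} (hz : 0 < z.im) :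
    (u ∘ ofComplex) (act (matB m * γ.1) z) = (u ∘ ofComplex) (act (matB m * γ'.1) z) := by
  obtain ⟨δ, hδ, hδ'⟩ := exists_matB_mul (rowIdx_eq_iff.1 h)
  have e : matB m * γ'.1 = δ.1 * (matB m * γ.1) := by
    rw [← Matrix.mul_assoc, ← hδ', Matrix.mul_assoc, ← Matrix.SpecialLinearGroup.coe_mul,
      inv_mul_cancel_right]
  have hd := det_matB_mul_pos m γ
  rw [e, act_mul hd hz, hu.act_gamma0 hδ (act_im_pos hd hz)]

variable {n m : ℕ} [NeZero n] [NeZero m] {β : ℂ} {u : ℍ → ℂ}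

/-- The functions `u(B_m R_s z)`, for `R_s` a representative of the coset `s` of `Γ₀(n m)`. -/
noncomputable def dilateCoset (n m : ℕ) [NeZero n] [NeZero m] (u : ℍ → ℂ) (s : Idx (n * m))
    (z : ℍ) : ℂ :=
  dilate m u (cosetRep (n * m) s • z)

theorem dilateCoset_comp_ofComplex (u : ℍ → ℂ) (s : Idx (n * m)) {z : ℂ} (hz : 0 < z.im) :
    (dilateCoset n m u s ∘ ofComplex) z =
      (u ∘ ofComplex) (act (matB m * (cosetRep (n * m) s).1) z) := by
  rw [Function.comp_apply, dilateCoset, dilate_smul, ofComplex_apply_of_im_pos hz]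

theorem IsMaassCuspForm.cuspEigen_dilateCoset (hu : IsMaassCuspForm n β u) (s : Idx (n * m)) :
    CuspEigen β (dilateCoset n m u s ∘ ofComplex) :=
  (hu.cuspEigen.comp_act (det_matB_mul_pos m _)).congr fun _ hz => dilateCoset_comp_ofComplex u s hz

/-- If `R_j` runs through the cosets of `Γ₀(nm)` in `Γ₀(n)`, then the lower rows of `R_j R` run once
through the fibre over the index of `R`. -/
theorem heckeOp_smul (hu : IsMaassCuspForm n β u) (R : SL(2, ℤ)) (z : ℍ) :
    heckeOp n m u (R • z) =
      ∑ s : Idx (n * m) with proj (dvd_mul_right n m) s = rowIdx n R, dilateCoset n m u s z := by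
  refine Finset.sum_bij (fun j _ => rowIdx (n * m) ((Quotient.out j : Gamma0 n).1 * R)) ?_ ?_ ?_ ?_
  · intro j _
    rw [Finset.mem_filter]
    exact ⟨Finset.mem_univ _, by rw [proj_rowIdx, rowIdx_mul_left (Quotient.out j).2]⟩
  · intro j _ j' _ h
    rw [rowIdx_eq_iff, mul_inv_rev, mul_assoc, mul_inv_cancel_left] at h
    rw [← Quotient.out_eq j, ← Quotient.out_eq j']
    refine Quotient.sound ((QuotientGroup.rightRel_apply).2 ?_)
    rw [Subgroup.mem_subgroupOf]
    exact h
  · intro s hs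
    have h0 := (Finset.mem_filter.1 hs).2
    rw [← rowIdx_cosetRep (n * m) s, proj_rowIdx, eq_comm, rowIdx_eq_iff] at h0
    refine ⟨Quotient.mk _ ⟨_, h0⟩, Finset.mem_univ _, ?_⟩
    conv_rhs => rw [← rowIdx_cosetRep (n * m) s]
    rw [rowIdx_eq_iff, mul_inv_rev, ← mul_assoc]
    have := QuotientGroup.rightRel_apply.1 (Quotient.mk_out
      (s := QuotientGroup.rightRel ((Gamma0 (n * m)).subgroupOf (Gamma0 n))) ⟨_, h0⟩)
    rw [Subgroup.mem_subgroupOf] at this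
    exact this
  · intro j _
    rw [← mul_smul, dilate_smul, dilateCoset, dilate_smul]
    exact hu.act_matB_congr (rowIdx_cosetRep _ _).symm z.im_pos

theorem vecForm_heckeOp (hu : IsMaassCuspForm n β u) (i : Idx n) (z : ℍ) :
    vecForm n (heckeOp n m u) i z =
      ∑ s : Idx (n * m) with proj (dvd_mul_right n m) s = i, dilateCoset n m u s z := by
  rw [vecForm, heckeOp_smul hu, rowIdx_cosetRep]

/-- Regularity, eigenvalue and decay hold termwise. Invariance holds because the sum at `g • z` is
indexed by the fibre over the class of `g`, which for `g ∈ Γ₀(n)` is the class of `1`. -/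
theorem IsMaassCuspForm.heckeOp (hu : IsMaassCuspForm n β u) :
    IsMaassCuspForm n β (heckeOp n m u) := by
  have h1 : ∀ z : ℍ, PeriodHecke.heckeOp n m u z = ∑ s : Idx (n * m) with
      proj (dvd_mul_right n m) s = rowIdx n 1, dilateCoset n m u s z := fun z => by
    rw [← heckeOp_smul hu, one_smul]
  refine CuspEigen.isMaassCuspForm ?_ fun g hg z => ?_
  · exact (CuspEigen.sum _ fun s _ => hu.cuspEigen_dilateCoset s).congr fun z _ => h1 _
  · rw [heckeOp_smul hu, h1, ← mul_one g, rowIdx_mul_left hg]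

theorem IsMaassCuspForm.cuspEigen_vecForm (hu : IsMaassCuspForm n β u) (i : Idx n) :
    CuspEigen β (vecForm n u i ∘ ofComplex) :=
  (hu.cuspEigen.comp_act (M := (cosetRep n i).1) (by rw [(cosetRep n i).2]; exact one_pos)).congr
    fun _ hz => (comp_ofComplex_act u _ hz).symm

/-- `Q K^j(A_σ(s)) = δ B_m R` with `δ ∈ Γ₀(n)`, read off on `u`. The right side varies with `j`, the
left does not: this is the hypothesis of the telescoping argument. -/
theorem dilateCoset_eq_vecForm (hu : IsMaassCuspForm n β u) (s : Idx (n * m)) (j : ℕ) {z : ℂ}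
    (hz : 0 < z.im) :
    (dilateCoset n m u ((hEquiv (n * m)).symm s) ∘ ofComplex) z =
      (vecForm n u ((hEquiv n).symm (transferIdx n m s j)) ∘ ofComplex)
        (act (stepK^[j] (matA m (proj (dvd_mul_left m n) s))) z) := by
  obtain ⟨δ, hδ, h⟩ := exists_gamma0_transfer (n := n) (m := m) (s := s) (j := j)
    (R := cosetRep (n * m) ((hEquiv (n * m)).symm s))
    (Q := cosetRep n ((hEquiv n).symm (transferIdx n m s j)))
    (by rw [← hEquiv_rowIdx, rowIdx_cosetRep, Equiv.apply_symm_apply])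
    (by rw [← hEquiv_rowIdx, rowIdx_cosetRep, Equiv.apply_symm_apply])
  obtain ⟨H, hH⟩ := stepK_iterate (matA m (proj (dvd_mul_left m n) s)) j
  have hd : 0 < (stepK^[j] (matA m (proj (dvd_mul_left m n) s))).det := by
    rw [hH, Matrix.det_mul, H.2, one_mul]
    exact det_pos_of_mem_setS (matA_mem_setS m _).1
  have hd' := det_matB_mul_pos m (cosetRep (n * m) ((hEquiv (n * m)).symm s))
  rw [dilateCoset_comp_ofComplex u _ hz, Function.comp_apply (f := vecForm n u _), vecForm,
    ← comp_ofComplex_act u _ (act_im_pos hd hz), ← act_mul hd hz, h, act_mul hd' hz,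
    hu.act_gamma0 hδ (act_im_pos hd' hz)]

end Hecke

section Sum

theorem etaForm_sum_left {ι : Type*} (s : Finset ι) {f : ι → ℂ → ℂ} (v : ℂ → ℂ) {z : ℂ}
    (hf : ∀ i ∈ s, DifferentiableAt ℝ (f i) z) :
    etaForm (fun y => ∑ i ∈ s, f i y) v z = ∑ i ∈ s, etaForm (f i) v z := by
  ext a
  rw [_root_.sum_apply, etaForm_apply, fderiv_fun_sum hf]
  simp only [_root_.sum_apply, etaForm_apply, Finset.mul_sum, Finset.sum_mul,
    Finset.sum_sub_distrib]

/-- A sum of primitives is a primitive of the summed form, and the cusp limits add. -/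
theorem periodTransform_sum {ι : Type*} (s : Finset ι) {β : ℂ} {f : ι → ℍ → ℂ} {F : ℍ → ℂ}
    (hf : ∀ i, CuspEigen β (f i ∘ ofComplex)) (hF : ∀ z, F z = ∑ i ∈ s, f i z) {ζ : ℝ}
    (hζ : 0 < ζ) : periodTransform β F ζ = ∑ i ∈ s, periodTransform β (f i) ζ := by
  choose Φ L hΦ hL using fun i => exists_primitive_horo (hf i) ζ
  have hF' : F ∘ ofComplex = fun z => ∑ i ∈ s, (f i ∘ ofComplex) z := by
    ext z; exact hF _
  have h1 : CuspEigen β (F ∘ ofComplex) := by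
    rw [hF']; exact CuspEigen.sum s fun i _ => hf i
  rw [periodTransform_eq_sub h1 hζ (Φ := fun z => ∑ i ∈ s, Φ i z) (L := fun N => ∑ i ∈ s, L i N),
    ← Finset.sum_sub_distrib]
  · exact Finset.sum_congr rfl fun i _ =>
      (periodTransform_eq_sub (hf i) hζ (hΦ i) (hL i)).symm
  · intro z hz
    rw [hF', etaForm_sum_left s _ fun i _ => (hf i).isEigen.differentiableAt hz]
    exact HasFDerivAt.fun_sum fun i _ => hΦ i z hz
  · exact fun N hN e c he => tendsto_finsetSum _ fun i _ => hL i N hN e c he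

end Sum

section Main

variable {n m : ℕ} [NeZero n] [NeZero m] {β : ℂ} {u : ℍ → ℂ}

/-- Matrices in `setS m` have nonnegative entries, a positive diagonal and positive determinant.
They map positive reals to positive reals and preserve the sign of the imaginary part, hence
preserve the cut plane, and the principal power of the denominator is holomorphic there. -/
theorem differentiableOn_slash {φ : ℂ → ℂ} (hφ : DifferentiableOn ℂ φ slitPlane)
    {G : Matrix (Fin 2) (Fin 2) ℤ} (hG : G ∈ setS m) :
    DifferentiableOn ℂ (slash β φ G) slitPlane := by
  obtain ⟨h1, h2, h3, h4, h5⟩ := hG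
  have hm : (0 : ℤ) < m := by exact_mod_cast Nat.pos_of_ne_zero (NeZero.ne m)
  have a0 : (0 : ℝ) < G 0 0 := by exact_mod_cast h3.trans_lt h2
  have b0 : (0 : ℝ) ≤ G 0 1 := by exact_mod_cast h5
  have c0 : (0 : ℝ) ≤ G 1 0 := by exact_mod_cast h3
  have d0 : (0 : ℝ) < G 1 1 := by exact_mod_cast h5.trans_lt h4
  have hdet : (0 : ℝ) < G 0 0 * G 1 1 - G 0 1 * G 1 0 := by
    rw [det_cast, h1]; exact_mod_cast hm
  have hden : ∀ z ∈ slitPlane, (G 1 0 : ℂ) * z + (G 1 1 : ℂ) ∈ slitPlane := by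
    intro z hz
    rw [mem_slitPlane_iff] at hz ⊢
    simp only [Complex.add_re, Complex.add_im, Complex.mul_re, Complex.mul_im, Complex.intCast_re,
      Complex.intCast_im]
    rcases c0.eq_or_lt with h | h
    · left; rw [← h]; simpa using d0
    · rcases hz with hz | hz
      · left; nlinarith
      · right; simpa [h.ne'] using hz
  have hnum : ∀ z ∈ slitPlane, ((G 0 0 : ℂ) * z + (G 0 1 : ℂ)) / ((G 1 0 : ℂ) * z + (G 1 1 : ℂ)) ∈
      slitPlane := by
    intro z hz
    have h0 := slitPlane_ne_zero (hden z hz)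
    have hn0 := normSq_pos.2 h0
    rw [mem_slitPlane_iff] at hz ⊢
    rw [Complex.div_re, Complex.div_im]
    simp only [Complex.add_re, Complex.add_im, Complex.mul_re, Complex.mul_im, Complex.intCast_re,
      Complex.intCast_im, zero_mul, sub_zero, add_zero]
    by_cases hi : z.im = 0
    · left
      have hr : 0 < z.re := hz.resolve_right (not_not.2 hi)
      rw [hi]
      simp only [mul_zero, zero_div, add_zero]
      positivity
    · right
      have : ((G 0 0 : ℝ) * z.im) * (G 1 0 * z.re + G 1 1) / normSq (G 1 0 * z + G 1 1) -
          (G 0 0 * z.re + G 0 1) * (G 1 0 * z.im) / normSq (G 1 0 * z + G 1 1) =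
          (G 0 0 * G 1 1 - G 0 1 * G 1 0) * z.im / normSq (G 1 0 * z + G 1 1) := by ring
      rw [this]
      exact div_ne_zero (mul_ne_zero hdet.ne' hi) hn0.ne'
  have hlin : ∀ p q : ℤ, DifferentiableOn ℂ (fun z : ℂ => (p : ℂ) * z + (q : ℂ)) slitPlane :=
    fun p q => by fun_prop
  refine ((hlin _ _).cpow (differentiableOn_const _) hden |>.const_mul _).mul
    (hφ.comp ((hlin _ _).div (hlin _ _) fun z hz => slitPlane_ne_zero (hden z hz)) hnum)

/-- The outer sum is reindexed by `h_{nm}`, which is compatible with `hₙ` under projection; each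
inner sum over `j` telescopes to the period transform of one summand of the Hecke operator. -/
theorem heckeLike_vecPeriod_eq_ofReal (hu : IsMaassCuspForm n β u) (i : Idx n) {ζ : ℝ}
    (hζ : 0 < ζ) :
    heckeLike n m β (hAct n (vecPeriod n β (vecForm n u))) i ζ =
      hAct n (vecPeriod n β (vecForm n (heckeOp n m u))) i ζ := by
  rw [hAct_eq n _ i, vecPeriod, periodTransform_sum _ (fun s => hu.cuspEigen_dilateCoset s)
    (vecForm_heckeOp hu _) hζ, heckeLike]
  refine Finset.sum_equiv (hEquiv (n * m)).symm (fun s => ?_) fun s _ => ?_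
  · simp only [Finset.mem_filter, Finset.mem_univ, true_and]
    rw [Equiv.eq_symm_apply, ← proj_hEquiv, Equiv.apply_symm_apply]
  · obtain ⟨hA, hA0⟩ := matA_mem_setS m (proj (dvd_mul_left m n) s)
    simp only [hAct_eq, vecPeriod]
    exact sum_slash_periodTransform (hu.cuspEigen_dilateCoset _) hA hA0
      (g := fun j => vecForm n u ((hEquiv n).symm (transferIdx n m s j)))
      (fun j => hu.cuspEigen_vecForm _) (fun j z hz => dilateCoset_eq_vecForm hu s j hz) hζ

end Main

end PeriodHecke

theorem mainTheorem2 (n m : ℕ) [NeZero n] [NeZero m] (β : ℂ) (u : UpperHalfPlane → ℂ)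
    (hu : PeriodHecke.IsMaassCuspForm n β u) :
    PeriodHecke.IsMaassCuspForm n β (PeriodHecke.heckeOp n m u) ∧
    (∀ i, PeriodHecke.IsPeriodTransform β (PeriodHecke.vecForm n u i)
      (PeriodHecke.vecPeriod n β (PeriodHecke.vecForm n u) i)) ∧
    (∀ i, PeriodHecke.IsPeriodTransform β (PeriodHecke.vecForm n (PeriodHecke.heckeOp n m u) i)
      (PeriodHecke.vecPeriod n β (PeriodHecke.vecForm n (PeriodHecke.heckeOp n m u)) i)) ∧
    ∀ i, ∀ z ∈ Complex.slitPlane,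
      PeriodHecke.heckeLike n m β
          (PeriodHecke.hAct n (PeriodHecke.vecPeriod n β (PeriodHecke.vecForm n u))) i z =
        PeriodHecke.hAct n
          (PeriodHecke.vecPeriod n β (PeriodHecke.vecForm n (PeriodHecke.heckeOp n m u))) i z := by
  have hH := hu.heckeOp (m := m)
  have h1 := fun i => PeriodHecke.isPeriodTransform_periodTransform (hu.cuspEigen_vecForm i)
  have h2 := fun i => PeriodHecke.isPeriodTransform_periodTransform (hH.cuspEigen_vecForm i)
  refine ⟨hH, h1, h2, fun i => ?_⟩
  -- The cut plane is the sector of half-angle `π`, so equality on the positive axis propagates to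
  -- it once both sides are known to be holomorphic.
  rw [← PeriodHecke.sector_pi]
  refine PeriodHecke.eqOn_sector_of_eq_ofReal Real.pi_pos le_rfl ?_ ?_
    fun x hx => PeriodHecke.heckeLike_vecPeriod_eq_ofReal hu i hx
  · rw [PeriodHecke.sector_pi]
    refine DifferentiableOn.fun_sum fun s _ => DifferentiableOn.fun_sum fun j hj => ?_
    refine PeriodHecke.differentiableOn_slash (m := m) ?_ (PeriodHecke.iterate_stepK_mem_setS
      (PeriodHecke.matA_mem_setS m _).1 (Nat.lt_succ_iff.1 (Finset.mem_range.1 hj)))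
    rw [PeriodHecke.hAct_eq]
    exact (h1 _).1
  · rw [PeriodHecke.sector_pi, PeriodHecke.hAct_eq]
    exact (h2 _).1
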